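/- **Setting.** Let $\Theta\subset\mathbb R^d$ be compact and let $f_\theta:\mathbb N_0^{\mathbb N}\to(0,\infty)$, $\theta\in\Theta$, be measurable. For $j=1,2$ let $Y^{(j)}=\{Y^{(j)}_t,\ t\in\mathbb Z\}$ be stationary ergodic $\mathbb N_0$-valued processes on one probability space (their joint law is otherwise arbitrary) with $$\mathbb E\big(Y^{(j)}_t\mid \mathcal F^{(j)}_{t-1}\big)=f_{\theta_j^*}(Y^{(j)}_{t-1},Y^{(j)}_{t-2},\dots)\quad\text{for all }t\in\mathbb Z,\qquad \mathcal F^{(j)}_{t-1}=\sigma(Y^{(j)}_{t-1},Y^{(j)}_{t-2},\dots),$$ where $\theta_1^*\ne\theta_2^*$ are interior points of $\Theta$. **Assumptions on the model.** There is $\underline c>0$ with $f_\theta(y)\ge\underline c$ for all $\theta\in\Theta$, $y\in\mathbb N_0^{\mathbb N}$. For $i=0,1,2$ and every $y$, the map $\theta\mapsto f_\theta(y)$ is $i$ times continuously differentiable on $\Theta$ with $\sup_{\theta\in\Theta}\|\partial^i_\theta f_\theta(y)\|<\infty$, and there are $\alpha^{(i)}_k\ge0$ with $\sum_k\alpha_k^{(0)}<1$,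 $\sum_k\alpha_k^{(1)}<\infty$, $\sum_k\alpha_k^{(2)}<\infty$ and $\sup_{\theta\in\Theta}\|\partial_\theta^i f_\theta(y)-\partial_\theta^i f_\theta(y')\|\le\sum_k\alpha^{(i)}_k|y_k-y'_k|$ for all $y,y'$. Moreover $\alpha_k^{(0)}+\alpha_k^{(1)}=O(k^{-\gamma})$ for some $\gamma>3/2$. **Assumptions on each regime** ($Y=Y^{(j)}$, $\theta^*=\theta^*_j$, $\lambda_t(\theta)=f_\theta(Y_{t-1},Y_{t-2},\dots)$, $\hat\lambda_t(\theta)=f_\theta(Y_{t-1},\dots,Y_1,0,0,\dots)$, $\ell_t(\theta)=Y_t\log\lambda_t(\theta)-\lambda_t(\theta)$): - $\sup_t\mathbb E\,Y_t^{1+\epsilon}<\infty$ for some $\epsilon>2$; - for $\theta,\theta'\in\Theta$, if $\lambda_t(\theta)=\lambda_t(\theta')$ a.s. for some $t\in\mathbb N$, then $\theta=\theta'$; - $a_t\to0$ and $Y_ta_t\to0$ a.s., where $a_t=\sup_{\theta\in\Theta}|\hat\lambda_t(\theta)-\lambda_t(\theta)|$; - the matrices $J=\mathbb E\big[\lambda_t(\theta^*)^{-1}\,\partial_\theta\lambda_t(\theta^*)\,\partial_{\theta'}\lambda_t(\theta^*)\big]$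 and $I=\mathbb E\big[\mathrm{Var}(Y_t\mid\mathcal F_{t-1})\,\lambda_t(\theta^*)^{-2}\,\partial_\theta\lambda_t(\theta^*)\,\partial_{\theta'}\lambda_t(\theta^*)\big]$ exist (all entries are integrable); - if $c\in\mathbb R^d$ and $c'\,\partial_\theta\lambda_t(\theta^*)=0$ a.s., then $c=0$; - $\mathbb E\sup_{\theta\in V}|\partial^2_{\theta_i\theta_k}\ell_t(\theta)|<\infty$ for all $i,k$ and some neighbourhood $V\subset\Theta$ of $\theta^*$; - for some $h>1/2$, almost surely $b_t$, $b_tY_t$ and $a_td_tY_t$ are $O(t^{-h})$, where $b_t=\sup_{\theta\in\Theta}\mathbb E\|\partial_\theta\hat\lambda_t(\theta)-\partial_\theta\lambda_t(\theta)\|$ and $d_t=\sup_{\theta\in\Theta}\max\{\mathbb E\|\hat\lambda_t(\theta)^{-1}\partial_\theta\hat\lambda_t(\theta)\|,\ \mathbb E\|\lambda_t(\theta)^{-1}\partial_\theta\lambda_t(\theta)\|\}$. Moreover the matrix $I$ of the first regime is positive definite. **Procedure.** Let $T\in(1,\infty]$, $T^*\in(1,T)$, $k^*=k^*(m)=[T^*m]$.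 Let $b:(0,\infty)\to(0,\infty)$ be non-increasing, continuous and bounded, with $\inf b>0$. Let $v'_m$ be natural numbers with $v'_m\to\infty$ and $v'_m/\sqrt m\to0$, and put $\Pi_{m,k}=\{m-v'_m,\dots,k-v'_m\}$. For each historical sample size $m$ the observations $X_1,X_2,\dots$ (depending on $m$) are $X_t=Y^{(1)}_t$ for $1\le t\le k^*$ and $X_t=Y^{(2)}_{t-s_m}$ for $t>k^*$, with $s_m\in\mathbb Z$. From now on $\hat\lambda_t(\theta)=f_\theta(X_{t-1},\dots,X_1,0,0,\dots)$. Put $T_{\ell,k}=\{\ell,\dots,k\}$, let $\hat\theta(T_{\ell,k})$ be any maximizer over $\Theta$ of $\sum_{t\in T_{\ell,k}}\big(X_t\log\hat\lambda_t(\theta)-\hat\lambda_t(\theta)\big)$, and, with $\hat\lambda_t$ and its gradient evaluated at $\hat\theta(T_{1,m})$, $$\hat J=\frac1m\sum_{t=1}^m\frac1{\hat\lambda_t}\,\partial_\theta\hat\lambda_t\,\partial_{\theta'}\hat\lambda_t,\qquad \hat I=\frac1m\sum_{t=1}^m\Big(\frac{X_t}{\hat\lambda_t}-1\Big)^2\partial_\theta\hat\lambda_t\,\partial_{\theta'}\hat\lambda_t,$$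 $$\hat D_{k,\ell}=\sqrt m\,\frac{k-\ell}{k}\,\big\|\hat I^{-1/2}\hat J\big(\hat\theta(T_{\ell,k})-\hat\theta(T_{1,m})\big)\big\|,$$ $$\tau(m)=\inf\{k:\ m<k\le[Tm]+1,\ \hat D_{k,\ell}>b((k-\ell)/m)\text{ for some }\ell\in\Pi_{m,k}\},\qquad\inf\emptyset=\infty$$ (there is no upper limit on $k$ if $T=\infty$). **Theorem 4.3.** For $\delta\in(1/2,1)$ let $k_m=k^*(m)+[m^\delta]$ and $M_m=\max_{\ell\in\Pi_{m,k_m}}\hat D_{k_m,\ell}/b((k_m-\ell)/m)$. 1. If $s_m=k^*(m)$ for all $m$, that is, if $X_{k^*+n}=Y^{(2)}_n$ for $n\ge1$, then for every $\delta\in(1/2,1)$, $M_m\to\infty$ almost surely as $m\to\infty$. 2. For arbitrary $s_m\in\mathbb Z$ (in particular for $s_m=0$, that is, $X_t=Y^{(2)}_t$ for $t>k^*$) and every $\delta\in(1/2,1)$, $M_m\to\infty$ in probability. 3. For arbitrary $s_m\in\mathbb Z$ and every $\varepsilon>0$, the detection delay $\hat d_m=(\tau(m)-k^*(m))^+$ (with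 $\hat d_m=\infty$ if $\tau(m)=\infty$) is $O_P(m^{1/2+\varepsilon})$: for every $\eta>0$ there is $C>0$ with $\mathbb P(\hat d_m\ge C\,m^{1/2+\varepsilon})\le\eta$ for all large $m$. -/

import Mathlib

open MeasureTheory ProbabilityTheory Filter Topology
open scoped ENNReal NNReal

noncomputable section

namespace ChangePoint

/-- The parameter space `ℝᵈ` with its Euclidean norm. -/
abbrev Param (d : ℕ) := EuclideanSpace ℝ (Fin d)

/-! ### Derivatives with respect to the parameter -/

/-- The `i`-th partial derivative of `g` at `θ`, taken within `Θ` (at interior points of `Θ` this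
is the usual partial derivative). -/
def pderiv {d : ℕ} (Θ : Set (Param d)) (g : Param d → ℝ) (i : Fin d) (θ : Param d) : ℝ :=
  fderivWithin ℝ g Θ θ (EuclideanSpace.single i 1)

/-- The gradient of `g` at `θ`, as a column vector. -/
def grad {d : ℕ} (Θ : Set (Param d)) (g : Param d → ℝ) (θ : Param d) : Param d :=
  WithLp.toLp 2 (fun i => pderiv Θ g i θ)

/-! ### The model

A model is a map `f : Param d → (ℕ → ℕ) → ℝ`; in `f θ y`, the entry `y k` is the observation with
lag `k + 1`. -/

/-- The sequence `(Y_{t-1}, Y_{t-2}, …)`. -/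
def past {Ω : Type*} (Y : ℤ → Ω → ℕ) (t : ℤ) (ω : Ω) : ℕ → ℕ :=
  fun k => Y (t - 1 - (k : ℤ)) ω

/-- The sequence `(x_{t-1}, …, x_1, 0, 0, …)`. -/
def truncPast (x : ℕ → ℕ) (t : ℕ) : ℕ → ℕ :=
  fun k => if k + 1 < t then x (t - 1 - k) else 0

/-- The σ-field generated by `Y_{t-1}, Y_{t-2}, …`. -/
abbrev pastSigma {Ω : Type*} (Y : ℤ → Ω → ℕ) (t : ℤ) : MeasurableSpace Ω :=
  ⨆ s ∈ Set.Iio t, MeasurableSpace.comap (Y s) ⊤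

/-- `Y` is a stationary ergodic integer-valued process indexed by `ℤ` with
`E(Y_t | Y_{t-1}, Y_{t-2}, …) = f_θ(Y_{t-1}, Y_{t-2}, …)` for all `t`. -/
structure IsODProcess {Ω : Type*} [MeasurableSpace Ω] (μ : Measure Ω) {d : ℕ}
    (f : Param d → (ℕ → ℕ) → ℝ) (θ : Param d) (Y : ℤ → Ω → ℕ) : Prop where
  measurable : ∀ t, Measurable (Y t)
  ergodic : Ergodic (fun (y : ℤ → ℕ) (t : ℤ) => y (t + 1)) (μ.map (fun ω t => Y t ω))
  condExp_eq : ∀ t, μ[fun ω => (Y t ω : ℝ) | pastSigma Y t] =ᵐ[μ] fun ω => f θ (past Y t ω)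

/-- The smoothness and Lipschitz condition of order `i` on the model, with Lipschitz coefficients
`α` (`α k` belongs to lag `k + 1`). The right-hand side of the Lipschitz bound is `+∞`, and the
bound is void, if the series diverges. -/
structure SmoothLipschitz {d : ℕ} (Θ : Set (Param d)) (f : Param d → (ℕ → ℕ) → ℝ)
    (i : ℕ) (α : ℕ → ℝ) : Prop where
  contDiffOn : ∀ y, ContDiffOn ℝ i (fun θ => f θ y) Θ
  bounded : ∀ y, ∃ B : ℝ, ∀ θ ∈ Θ, ‖iteratedFDerivWithin ℝ i (fun θ' => f θ' y) Θ θ‖ ≤ B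
  nonneg : ∀ k, 0 ≤ α k
  summable : Summable α
  lipschitz : ∀ y y' : ℕ → ℕ, Summable (fun k => α k * |(y k : ℝ) - (y' k : ℝ)|) →
    ∀ θ ∈ Θ, ‖iteratedFDerivWithin ℝ i (fun θ' => f θ' y) Θ θ
        - iteratedFDerivWithin ℝ i (fun θ' => f θ' y') Θ θ‖
      ≤ ∑' k, α k * |(y k : ℝ) - (y' k : ℝ)|

/-- `λ_t(θ) = f_θ(Y_{t-1}, Y_{t-2}, …)`. -/
def lam {Ω : Type*} {d : ℕ} (f : Param d → (ℕ → ℕ) → ℝ) (Y : ℤ → Ω → ℕ) (t : ℤ) (ω : Ω)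
    (θ : Param d) : ℝ :=
  f θ (past Y t ω)

/-- `λ̂_t(θ) = f_θ(x_{t-1}, …, x_1, 0, 0, …)`, computed from the observations `x_1, x_2, …`. -/
def lamHat {d : ℕ} (f : Param d → (ℕ → ℕ) → ℝ) (x : ℕ → ℕ) (t : ℕ) (θ : Param d) : ℝ :=
  f θ (truncPast x t)

/-- The observations with positive time index of a process indexed by `ℤ`. -/
def obs {Ω : Type*} (Y : ℤ → Ω → ℕ) (ω : Ω) : ℕ → ℕ := fun t => Y (t : ℤ) ω

/-- `ℓ_t(θ) = Y_t log λ_t(θ) - λ_t(θ)`. -/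
def logLik {Ω : Type*} {d : ℕ} (f : Param d → (ℕ → ℕ) → ℝ) (Y : ℤ → Ω → ℕ) (t : ℤ) (ω : Ω)
    (θ : Param d) : ℝ :=
  (Y t ω : ℝ) * Real.log (lam f Y t ω θ) - lam f Y t ω θ

/-- The integrand of the `(i, j)` entry of the matrix `J`. -/
def integrandJ {Ω : Type*} {d : ℕ} (Θ : Set (Param d)) (f : Param d → (ℕ → ℕ) → ℝ)
    (θ : Param d) (Y : ℤ → Ω → ℕ) (t : ℤ) (i j : Fin d) (ω : Ω) : ℝ :=
  (lam f Y t ω θ)⁻¹ * (pderiv Θ (lam f Y t ω) i θ * pderiv Θ (lam f Y t ω) j θ)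

/-- The integrand of the `(i, j)` entry of the matrix `I`. -/
def integrandI {Ω : Type*} [MeasurableSpace Ω] (μ : Measure Ω) {d : ℕ} (Θ : Set (Param d))
    (f : Param d → (ℕ → ℕ) → ℝ) (θ : Param d) (Y : ℤ → Ω → ℕ) (t : ℤ) (i j : Fin d)
    (ω : Ω) : ℝ :=
  Var[fun ω' => (Y t ω' : ℝ); μ | pastSigma Y t] ω / (lam f Y t ω θ) ^ 2
    * (pderiv Θ (lam f Y t ω) i θ * pderiv Θ (lam f Y t ω) j θ)

/-- The matrix `I = E[Var(Y_t | F_{t-1}) λ_t(θ)⁻² ∂λ_t(θ) ∂λ_t(θ)']`, written at `t = 0`. -/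
def matrixI {Ω : Type*} [MeasurableSpace Ω] (μ : Measure Ω) {d : ℕ} (Θ : Set (Param d))
    (f : Param d → (ℕ → ℕ) → ℝ) (θ : Param d) (Y : ℤ → Ω → ℕ) : Matrix (Fin d) (Fin d) ℝ :=
  Matrix.of fun i j => ∫ ω, integrandI μ Θ f θ Y 0 i j ω ∂μ

/-- `a_t = sup_{θ ∈ Θ} |λ̂_t(θ) - λ_t(θ)|`. -/
def seqA {Ω : Type*} {d : ℕ} (Θ : Set (Param d)) (f : Param d → (ℕ → ℕ) → ℝ) (Y : ℤ → Ω → ℕ)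
    (t : ℕ) (ω : Ω) : ℝ≥0∞ :=
  ⨆ θ ∈ Θ, ‖lamHat f (obs Y ω) t θ - lam f Y t ω θ‖ₑ

/-- `b_t = sup_{θ ∈ Θ} E‖∂λ̂_t(θ) - ∂λ_t(θ)‖`. -/
def seqB {Ω : Type*} [MeasurableSpace Ω] (μ : Measure Ω) {d : ℕ} (Θ : Set (Param d))
    (f : Param d → (ℕ → ℕ) → ℝ) (Y : ℤ → Ω → ℕ) (t : ℕ) : ℝ≥0∞ :=
  ⨆ θ ∈ Θ, ∫⁻ ω, ‖grad Θ (lamHat f (obs Y ω) t) θ - grad Θ (lam f Y t ω) θ‖ₑ ∂μ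

/-- `d_t = sup_{θ ∈ Θ} max {E‖∂λ̂_t(θ) / λ̂_t(θ)‖, E‖∂λ_t(θ) / λ_t(θ)‖}`. -/
def seqD {Ω : Type*} [MeasurableSpace Ω] (μ : Measure Ω) {d : ℕ} (Θ : Set (Param d))
    (f : Param d → (ℕ → ℕ) → ℝ) (Y : ℤ → Ω → ℕ) (t : ℕ) : ℝ≥0∞ :=
  ⨆ θ ∈ Θ, max
    (∫⁻ ω, ‖(lamHat f (obs Y ω) t θ)⁻¹ • grad Θ (lamHat f (obs Y ω) t) θ‖ₑ ∂μ)
    (∫⁻ ω, ‖(lam f Y t ω θ)⁻¹ • grad Θ (lam f Y t ω) θ‖ₑ ∂μ)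

/-- The regularity conditions on a process `Y` which follows the model with true parameter `θ`,
including its moment condition. -/
structure Regular {Ω : Type*} [MeasurableSpace Ω] (μ : Measure Ω) {d : ℕ} (Θ : Set (Param d))
    (f : Param d → (ℕ → ℕ) → ℝ) (θ : Param d) (Y : ℤ → Ω → ℕ) : Prop where
  /-- moments of an order larger than `3`, bounded in time -/
  moment : ∃ C : ℝ≥0, ∃ ε : ℝ, 2 < ε ∧ ∀ t, ∫⁻ ω, (Y t ω : ℝ≥0∞) ^ (1 + ε) ∂μ < C
  /-- identifiability -/
  identifiable : ∀ θ₁ ∈ Θ, ∀ θ₂ ∈ Θ,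
    (∃ t : ℕ, ∀ᵐ ω ∂μ, f θ₁ (past Y t ω) = f θ₂ (past Y t ω)) → θ₁ = θ₂
  mem_interior : θ ∈ interior Θ
  approx : ∀ᵐ ω ∂μ, Tendsto (fun t => seqA Θ f Y t ω) atTop (𝓝 0)
  approx_mul : ∀ᵐ ω ∂μ,
    Tendsto (fun t : ℕ => (Y (t : ℤ) ω : ℝ≥0∞) * seqA Θ f Y t ω) atTop (𝓝 0)
  exists_J : ∀ t i j, Integrable (integrandJ Θ f θ Y t i j) μ
  exists_I : ∀ t i j, Integrable (integrandI μ Θ f θ Y t i j) μ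
  nondegenerate : ∀ (t : ℤ) (c : Param d),
    (∀ᵐ ω ∂μ, ∑ i, c i * pderiv Θ (lam f Y t ω) i θ = 0) → c = 0
  secondDeriv : ∃ V ∈ 𝓝 θ, V ⊆ Θ ∧ ∀ (t : ℤ) (i k : Fin d),
    ∫⁻ ω, ⨆ θ' ∈ V, ‖pderiv Θ (pderiv Θ (logLik f Y t ω) k) i θ'‖ₑ ∂μ < ∞
  rate : ∃ h : ℝ, 1 / 2 < h ∧ ∀ᵐ ω ∂μ, ∃ C : ℝ≥0, ∀ᶠ t : ℕ in atTop,
    seqB μ Θ f Y t ≤ C * (t : ℝ≥0∞) ^ (-h) ∧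
    seqB μ Θ f Y t * (Y (t : ℤ) ω : ℝ≥0∞) ≤ C * (t : ℝ≥0∞) ^ (-h) ∧
    seqA Θ f Y t ω * seqD μ Θ f Y t * (Y (t : ℤ) ω : ℝ≥0∞) ≤ C * (t : ℝ≥0∞) ^ (-h)

/-! ### Estimation from the observations `x_1, x_2, …` -/

/-- The Poisson quasi-log-likelihood computed on the window `{l, …, k}`. -/
def quasiLogLik {d : ℕ} (f : Param d → (ℕ → ℕ) → ℝ) (x : ℕ → ℕ) (l k : ℕ) (θ : Param d) : ℝ :=
  ∑ t ∈ Finset.Icc l k, ((x t : ℝ) * Real.log (lamHat f x t θ) - lamHat f x t θ)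

/-- `θ` is a Poisson quasi-maximum likelihood estimate computed on the window `{l, …, k}`. -/
def IsPQMLE {d : ℕ} (Θ : Set (Param d)) (f : Param d → (ℕ → ℕ) → ℝ) (x : ℕ → ℕ) (l k : ℕ)
    (θ : Param d) : Prop :=
  θ ∈ Θ ∧ ∀ θ' ∈ Θ, quasiLogLik f x l k θ' ≤ quasiLogLik f x l k θ

/-- The matrix `Ĵ` on the window `{l, …, k}`, evaluated at the estimate `θ`. -/
def hatJ {d : ℕ} (Θ : Set (Param d)) (f : Param d → (ℕ → ℕ) → ℝ) (x : ℕ → ℕ) (l k : ℕ)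
    (θ : Param d) : Matrix (Fin d) (Fin d) ℝ :=
  ((k : ℝ) - (l : ℝ) + 1)⁻¹ • ∑ t ∈ Finset.Icc l k, (lamHat f x t θ)⁻¹ •
    Matrix.vecMulVec (grad Θ (lamHat f x t) θ) (grad Θ (lamHat f x t) θ)

/-- The matrix `Î` on the window `{l, …, k}`, evaluated at the estimate `θ`. -/
def hatI {d : ℕ} (Θ : Set (Param d)) (f : Param d → (ℕ → ℕ) → ℝ) (x : ℕ → ℕ) (l k : ℕ)
    (θ : Param d) : Matrix (Fin d) (Fin d) ℝ :=
  ((k : ℝ) - (l : ℝ) + 1)⁻¹ • ∑ t ∈ Finset.Icc l k, ((x t : ℝ) / lamHat f x t θ - 1) ^ 2 •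
    Matrix.vecMulVec (grad Θ (lamHat f x t) θ) (grad Θ (lamHat f x t) θ)

/-- `A^{-1/2}` for a symmetric positive definite matrix `A`. -/
def invSqrt {d : ℕ} (A : Matrix (Fin d) (Fin d) ℝ) : Matrix (Fin d) (Fin d) ℝ :=
  cfc (fun z : ℝ => (Real.sqrt z)⁻¹) A

/-! ### The sequential procedure

`est l k` is the estimate computed on the window `{l, …, k}`, and `v` is the sequence `v'_m`. -/

/-- The detector `D̂_{k,l}` with historical sample size `m`. -/
def detector {d : ℕ} (Θ : Set (Param d)) (f : Param d → (ℕ → ℕ) → ℝ) (x : ℕ → ℕ)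
    (est : ℕ → ℕ → Param d) (m k l : ℕ) : ℝ :=
  Real.sqrt m * (((k : ℝ) - (l : ℝ)) / (k : ℝ)) *
    ‖(WithLp.toLp 2 ((invSqrt (hatI Θ f x 1 m (est 1 m)) * hatJ Θ f x 1 m (est 1 m)).mulVec
      (est l k - est 1 m : Param d)) : Param d)‖

/-- `Π_{m,k} = {m - v'_m, …, k - v'_m}`. -/
def window (v : ℕ → ℕ) (m k : ℕ) : Finset ℕ := Finset.Icc (m - v m) (k - v m)

/-- `max_{l ∈ Π_{m,k}} D̂_{k,l} / b((k - l)/m)`. -/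
def maxDetector {d : ℕ} (Θ : Set (Param d)) (f : Param d → (ℕ → ℕ) → ℝ) (x : ℕ → ℕ)
    (est : ℕ → ℕ → Param d) (b : ℝ → ℝ) (v : ℕ → ℕ) (m k : ℕ) : ℝ :=
  sSup ((fun l : ℕ => detector Θ f x est m k l / b (((k : ℝ) - (l : ℝ)) / (m : ℝ))) ''
    (window v m k : Set ℕ))

/-- The stopping time `τ(m)`, with `inf ∅ = ∞`; `T = ∞` is the open-end procedure. -/
def stoppingTime {d : ℕ} (Θ : Set (Param d)) (f : Param d → (ℕ → ℕ) → ℝ) (x : ℕ → ℕ)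
    (est : ℕ → ℕ → Param d) (b : ℝ → ℝ) (v : ℕ → ℕ) (T : ℝ≥0∞) (m : ℕ) : ℕ∞ :=
  sInf ((fun k : ℕ => (k : ℕ∞)) ''
    {k : ℕ | m < k ∧ (T = ∞ ∨ k ≤ ⌊T.toReal * (m : ℝ)⌋₊ + 1) ∧
      ∃ l ∈ window v m k, b (((k : ℝ) - (l : ℝ)) / (m : ℝ)) < detector Θ f x est m k l})

/-- The detection delay `τ(m) - k*`: it is `∞` if no change is detected, and `0` after an alarm
which is not later than `k*`. -/
def detectionDelay (kstar : ℕ) (τ : ℕ∞) : ℝ≥0∞ := (τ : ℝ≥0∞) - (kstar : ℝ≥0∞)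

/-- `X_m = O_P(r_m)` for a sequence of `[0, ∞]`-valued random variables. -/
def IsBigOP {Ω : Type*} [MeasurableSpace Ω] (μ : Measure Ω) (X : ℕ → Ω → ℝ≥0∞)
    (r : ℕ → ℝ) : Prop :=
  ∀ η : ℝ, 0 < η → ∃ C : ℝ, 0 < C ∧
    ∀ᶠ m in atTop, μ {ω | ENNReal.ofReal (C * r m) ≤ X m ω} ≤ ENNReal.ofReal η

/-- The change point `k*(m) = [T* m]`. -/
def changeTime (Tstar : ℝ) (m : ℕ) : ℕ := ⌊Tstar * (m : ℝ)⌋₊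

/-- The monitoring instant `k_m = k*(m) + [m^δ]`. -/
def monitorTime (Tstar δ : ℝ) (m : ℕ) : ℕ := changeTime Tstar m + ⌊(m : ℝ) ^ δ⌋₊

/-- The observations with a change after time `kstar`: `Y₁ t` at the times `t ≤ kstar`, and
`Y₂ (t - s)` at the times `t > kstar`. For `s = kstar` the observation at time `kstar + n` is
`Y₂ n`; for `s = 0` the observation at time `t > kstar` is `Y₂ t`. -/
def observed {Ω : Type*} (Y₁ Y₂ : ℤ → Ω → ℕ) (kstar : ℕ) (s : ℤ) (ω : Ω) : ℕ → ℕ :=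
  fun t => if t ≤ kstar then Y₁ (t : ℤ) ω else Y₂ ((t : ℤ) - s) ω

end ChangePoint

end

/-! The window `{k* + 1, …, k* + N}` with `N = [m^δ]` lies entirely after the change, and its left
end belongs to `Π_{m,k_m}` because `v m + 1 ≤ N` eventually. The estimate on this window approaches
`θ₂` and the historical estimate approaches `θ₁`, so the two are eventually at least `ρ = |θ₁ - θ₂|
/ 3` apart. If moreover `‖Î^{-1/2} Ĵ u‖ ≥ q ‖u‖` with a fixed `q > 0`, the detector at this window
is at least a constant times `√m · N / m`, that is, of order `m^(δ - 1/2)`, and diverges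
(`le_maxDetector_of_good`, `eventually_rpow_le_lower_bound`). A value of the maximal detector above
`1` forces an alarm by time `k* + N` (`detectionDelay_le`); taking `δ` close to `1/2` turns
divergence in probability into the bound on the delay.

Consistency is Wald's argument. The expected log-likelihood ratio is negative away from the true
parameter, by `log z ≤ z - 1` and identifiability (`integral_qll_sub_neg`). Compactness reduces this
to finitely many majorants with negative integrals (`exists_finite_majorants`), to which the ergodic
theorem applies. What remains is the error from computing the intensity with a wrong remote past,
which the Lipschitz property bounds by weighted tails of the lags.

After the change the remote past consists of the first regime. At time `k* + n` the error involves
`∑ᵢ a (n - 1 + i) Y₁ (k* - i)`. Since the coefficients decay with exponent `γ > 3/2`, this exponent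
can be shared between `n` and `i`: the part in `n` is summable, and Cauchy-Schwarz in `i` together
with `∑_{t ≤ k*} Y₁(t)² = O(k*)` costs a factor `√k*`. The total error is `O(√m)`, hence `o(N)` for
`δ > 1/2` (`PolyDecay.ae_oldTail_le`, `ae_pqmle_consistent_after`). This needs one fixed trajectory
after the change. For arbitrary shifts almost sure limits are not available, but the law of the
second regime is shift invariant and the expected error per observation tends to zero, so Markov's
inequality and Cesàro means give convergence in probability (`tendsto_measure_pqmle_after`). Only
second moments of each regime enter, so the joint law plays no role.

The lower bound for `Î^{-1/2} Ĵ` comes from `Î → I` and `Ĵ → J`, both limits being positive definite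
(`ae_matrices_consistent`, `exists_lower_bound_invSqrt_mul`). For `Ĵ`, a locally uniform law of
large numbers and consistency suffice. For `Î`, the derivative of the score is of the order of the
cube `Z³` of an envelope `Z` having only a moment of some order `r > 3`, so the squared error
involves `Z⁶`, which need not be integrable. A rate compensates: the score is a square-integrable
martingale difference, its sums are `O(m^σ)` for every `σ > 1/2`, and a Taylor expansion gives `‖θ̂
- θ₁‖ = O(m^(σ-1))` (`ae_pqmle_rate`). With `max Z³ = O(m^(3/r))` the mean squared error is `O(m^(2σ
- 2 + 3/r))`, which vanishes for `σ` close to `1/2`. -/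

/-! ### The pointwise ergodic theorem for ergodic maps -/

namespace Ergodic

variable {X : Type*} {S : X → X} {g : X → ℝ}

/-- The running maximum `max (0, g, g + g ∘ S, …)` of the Birkhoff sums. -/
def maxBirkhoff (S : X → X) (g : X → ℝ) : ℕ → X → ℝ
  | 0 => fun _ => 0
  | n + 1 => fun x => max 0 (g x + maxBirkhoff S g n (S x))

theorem maxBirkhoff_nonneg (n : ℕ) (x : X) : 0 ≤ maxBirkhoff S g n x := by
  cases n with
  | zero => exact le_rfl
  | succ n => exact le_max_left _ _

theorem maxBirkhoff_le_succ (n : ℕ) : ∀ x : X, maxBirkhoff S g n x ≤ maxBirkhoff S g (n + 1) x := by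
  induction n with
  | zero => exact fun x => le_max_left _ _
  | succ n ih => exact fun x => max_le_max le_rfl (add_le_add_right (ih (S x)) _)

theorem maxBirkhoff_mono (x : X) : Monotone fun n => maxBirkhoff S g n x :=
  monotone_nat_of_le_succ fun n => maxBirkhoff_le_succ n x

theorem birkhoffSum_le_maxBirkhoff (n : ℕ) :
    ∀ x : X, birkhoffSum S g n x ≤ maxBirkhoff S g n x := by
  induction n with
  | zero => exact fun x => by simp [maxBirkhoff]
  | succ n ih =>
    intro x
    rw [birkhoffSum_succ']
    exact (add_le_add_right (ih (S x)) _).trans (le_max_right _ _)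

variable [MeasurableSpace X] {P : Measure X}

theorem measurable_maxBirkhoff (hS : Measurable S) (hg : Measurable g) (n : ℕ) :
    Measurable (maxBirkhoff S g n) := by
  induction n with
  | zero => exact measurable_const
  | succ n ih => exact measurable_const.max (hg.add (ih.comp hS))

theorem integrable_maxBirkhoff (hS : MeasurePreserving S P P) (hg : Integrable g P) (n : ℕ) :
    Integrable (maxBirkhoff S g n) P := by
  induction n with
  | zero => exact integrable_zero _ _ _
  | succ n ih =>
    exact (integrable_zero _ _ _).sup (hg.add (hS.integrable_comp_of_integrable ih))

/-- The Birkhoff sums of a function with negative integral are almost surely bounded above. -/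
theorem ae_bddAbove_birkhoffSum [IsProbabilityMeasure P] (hS : Ergodic S P) (hgm : Measurable g)
    (hg : Integrable g P) (hneg : ∫ x, g x ∂P < 0) :
    ∀ᵐ x ∂P, BddAbove (Set.range fun n => birkhoffSum S g n x) := by
  -- This set is invariant by the recursion `M (n+1) = max 0 (g + M n ∘ S)`, so by ergodicity it is
  -- null or conull.
  set A : Set X := {x | BddAbove (Set.range fun n => maxBirkhoff S g n x)} with hA
  have hAm : MeasurableSet A :=
    measurableSet_bddAbove_range fun n => measurable_maxBirkhoff hS.measurable hgm n
  have hinv : S ⁻¹' A = A := by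
    ext x
    constructor
    · rintro ⟨C, hC⟩
      refine ⟨max 0 (g x + C), ?_⟩
      rintro _ ⟨n, rfl⟩
      refine (maxBirkhoff_le_succ n x).trans (max_le_max le_rfl (add_le_add_right ?_ _))
      exact hC ⟨n, rfl⟩
    · rintro ⟨C, hC⟩
      refine ⟨C - g x, ?_⟩
      rintro _ ⟨n, rfl⟩
      have h1 : maxBirkhoff S g (n + 1) x ≤ C := hC ⟨n + 1, rfl⟩
      have h2 : g x + maxBirkhoff S g n (S x) ≤ maxBirkhoff S g (n + 1) x := le_max_right _ _
      change maxBirkhoff S g n (S x) ≤ _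
      linarith
  rcases hS.toPreErgodic.ae_mem_or_ae_notMem hAm hinv with h | h
  · filter_upwards [h] with x hx
    obtain ⟨C, hC⟩ := hx
    refine ⟨C, ?_⟩
    rintro _ ⟨n, rfl⟩
    exact (birkhoffSum_le_maxBirkhoff n x).trans (hC ⟨n, rfl⟩)
  · exfalso
    -- If `M n ↑ ∞` almost everywhere, then `M (n+1) - M n ∘ S = max (-M n ∘ S) g` converges to `g`.
    -- Its integrals are nonnegative because `M` increases and `S` preserves the measure, which
    -- contradicts `∫ g < 0`.
    have hlim : Tendsto (fun n => ∫ x, max (-maxBirkhoff S g n (S x)) (g x) ∂P) atTop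
        (𝓝 (∫ x, g x ∂P)) := by
      refine tendsto_integral_of_dominated_convergence (fun x => |g x|) (fun n => ?_) hg.abs
        (fun n => ?_) ?_
      · exact ((((measurable_maxBirkhoff hS.measurable hgm n).comp hS.measurable).neg).max
          hgm).aestronglyMeasurable
      · filter_upwards with x
        rw [Real.norm_eq_abs, abs_le]
        have := maxBirkhoff_nonneg (S := S) (g := g) n (S x)
        exact ⟨(neg_abs_le _).trans (le_max_right _ _),
          max_le (by linarith [abs_nonneg (g x)]) (le_abs_self _)⟩
      · filter_upwards [h] with x hx
        have hx' : ¬ BddAbove (Set.range fun n => maxBirkhoff S g n (S x)) := fun hb => by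
          have : S x ∈ A := hb
          rw [← Set.mem_preimage, hinv] at this
          exact hx this
        have ht := tendsto_atTop_atTop_of_monotone' (maxBirkhoff_mono (S := S) (g := g) (S x)) hx'
        refine tendsto_const_nhds.congr' ?_
        filter_upwards [ht.eventually_ge_atTop (-g x)] with n hn
        rw [max_eq_right]
        linarith
    have hnn : ∀ n, 0 ≤ ∫ x, max (-maxBirkhoff S g n (S x)) (g x) ∂P := by
      intro n
      have hi := integrable_maxBirkhoff hS.toMeasurePreserving hg n
      have hi1 := integrable_maxBirkhoff hS.toMeasurePreserving hg (n + 1)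
      have hi2 := hS.toMeasurePreserving.integrable_comp_of_integrable hi
      have he : ∫ x, maxBirkhoff S g n (S x) ∂P = ∫ x, maxBirkhoff S g n x ∂P := by
        rw [← integral_map hS.measurable.aemeasurable (by rw [hS.map_eq]; exact hi.1), hS.map_eq]
      calc (0 : ℝ) ≤ ∫ x, maxBirkhoff S g (n + 1) x ∂P - ∫ x, maxBirkhoff S g n (S x) ∂P := by
            rw [he, sub_nonneg]
            exact integral_mono hi hi1 fun x => maxBirkhoff_le_succ n x
        _ = ∫ x, (maxBirkhoff S g (n + 1) x - maxBirkhoff S g n (S x)) ∂P :=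
            (integral_sub hi1 hi2).symm
        _ = _ := by
            refine integral_congr_ae (Eventually.of_forall fun x => ?_)
            change max 0 (g x + maxBirkhoff S g n (S x)) - maxBirkhoff S g n (S x) = _
            rw [← max_sub_sub_right]
            simp
    exact absurd (ge_of_tendsto' hlim hnn) (not_le.mpr hneg)

/-- For `c'` strictly between `∫ g` and `c`, the Birkhoff sums of `g - c'` are bounded above by some
`C`, so the averages of `g` exceed `c'` by at most `C / n`. -/
theorem ae_eventually_birkhoffAverage_lt [IsProbabilityMeasure P] (hS : Ergodic S P)
    (hgm : Measurable g) (hg : Integrable g P) {c : ℝ} (hc : ∫ x, g x ∂P < c) :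
    ∀ᵐ x ∂P, ∀ᶠ n : ℕ in atTop, (n : ℝ)⁻¹ * birkhoffSum S g n x < c := by
  obtain ⟨c', h1, h2⟩ := exists_between hc
  have hneg : ∫ x, (g x - c') ∂P < 0 := by
    rw [integral_sub hg (integrable_const _)]
    simpa using h1
  filter_upwards [ae_bddAbove_birkhoffSum hS (hgm.sub_const c') (hg.sub (integrable_const _)) hneg]
    with x hx
  obtain ⟨C, hC⟩ := hx
  have ht : Tendsto (fun n : ℕ => (n : ℝ)⁻¹ * C + c') atTop (𝓝 (0 * C + c')) :=
    (tendsto_inv_atTop_nhds_zero_nat.mul_const C).add_const c'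
  rw [zero_mul, zero_add] at ht
  filter_upwards [ht.eventually_lt_const h2, eventually_gt_atTop 0] with n hn hn0
  refine lt_of_le_of_lt ?_ hn
  have h3 : birkhoffSum S (fun x => g x - c') n x ≤ C := hC ⟨n, rfl⟩
  have h4 : birkhoffSum S (fun x => g x - c') n x = birkhoffSum S g n x - n * c' := by
    simp [birkhoffSum, Finset.sum_sub_distrib]
  have hn' : (0 : ℝ) < n := by exact_mod_cast hn0
  rw [h4] at h3
  have h5 : birkhoffSum S g n x ≤ C + n * c' := by linarith
  calc (n : ℝ)⁻¹ * birkhoffSum S g n x ≤ (n : ℝ)⁻¹ * (C + n * c') := by gcongr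
    _ = _ := by field_simp

/-- **Birkhoff's pointwise ergodic theorem** for ergodic transformations. -/
theorem ae_tendsto_birkhoff [IsProbabilityMeasure P] (hS : Ergodic S P)
    (hgm : Measurable g) (hg : Integrable g P) :
    ∀ᵐ x ∂P, Tendsto (fun n : ℕ => (n : ℝ)⁻¹ * birkhoffSum S g n x) atTop
      (𝓝 (∫ x, g x ∂P)) := by
  have h1 : ∀ᵐ x ∂P, ∀ j : ℕ, ∀ᶠ n : ℕ in atTop,
      (n : ℝ)⁻¹ * birkhoffSum S g n x < ∫ x, g x ∂P + 1 / ((j : ℝ) + 1) :=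
    ae_all_iff.2 fun j => ae_eventually_birkhoffAverage_lt hS hgm hg (by
      linarith [Nat.one_div_pos_of_nat (α := ℝ) (n := j)])
  have h2 : ∀ᵐ x ∂P, ∀ j : ℕ, ∀ᶠ n : ℕ in atTop,
      (n : ℝ)⁻¹ * birkhoffSum S (fun x => -g x) n x < -∫ x, g x ∂P + 1 / ((j : ℝ) + 1) :=
    ae_all_iff.2 fun j => ae_eventually_birkhoffAverage_lt hS hgm.neg hg.neg (by
      change ∫ x, -g x ∂P < _
      rw [integral_neg]
      linarith [Nat.one_div_pos_of_nat (α := ℝ) (n := j)])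
  filter_upwards [h1, h2] with x hx1 hx2
  rw [Metric.tendsto_nhds]
  intro ε hε
  obtain ⟨j, hj⟩ := exists_nat_one_div_lt hε
  filter_upwards [hx1 j, hx2 j] with n hn1 hn2
  have : birkhoffSum S (fun x => -g x) n x = -birkhoffSum S g n x := by simp [birkhoffSum]
  rw [this] at hn2
  rw [Real.dist_eq, abs_lt]
  constructor <;> linarith

end Ergodic

noncomputable section

namespace ChangePoint

/-! ### Stationary ergodic measures on the path space -/

/-- The shift of a path by `q` time units. -/
def shiftPath (q : ℤ) (y : ℤ → ℕ) : ℤ → ℕ := fun t => y (t + q)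

/-- The past of a path, seen from time `0`. -/
def pastPath (y : ℤ → ℕ) : ℕ → ℕ := fun k => y (-1 - (k : ℤ))

/-- A stationary ergodic probability measure on the path space. -/
structure StationaryErgodic (P : Measure (ℤ → ℕ)) : Prop where
  prob : IsProbabilityMeasure P
  ergodic : Ergodic (fun (y : ℤ → ℕ) (t : ℤ) => y (t + 1)) P

theorem measurable_shiftPath (q : ℤ) : Measurable (shiftPath q) :=
  measurable_pi_lambda _ fun t => measurable_pi_apply (t + q)

theorem measurable_pastPath : Measurable pastPath :=
  measurable_pi_lambda _ fun k => measurable_pi_apply (-1 - (k : ℤ))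

theorem shiftPath_shiftPath (q r : ℤ) (y : ℤ → ℕ) :
    shiftPath q (shiftPath r y) = shiftPath (q + r) y := by
  funext t
  simp [shiftPath, add_assoc]

@[simp]
theorem shiftPath_zero (y : ℤ → ℕ) : shiftPath 0 y = y := by
  funext t
  simp [shiftPath]

theorem past_eq_pastPath {Ω : Type*} (Y : ℤ → Ω → ℕ) (t : ℤ) (ω : Ω) :
    past Y t ω = pastPath (shiftPath t fun s => Y s ω) := by
  funext k
  simp only [past, pastPath, shiftPath]
  congr 1
  ring

theorem iterate_shift (n : ℕ) (y : ℤ → ℕ) :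
    (fun (y : ℤ → ℕ) (t : ℤ) => y (t + 1))^[n] y = shiftPath n y := by
  induction n with
  | zero => funext t; simp [shiftPath]
  | succ n ih =>
    rw [Function.iterate_succ_apply', ih]
    funext t
    simp only [shiftPath]
    congr 1
    push_cast
    ring

theorem sum_Icc_one_eq_sum_range {M : Type*} [AddCommMonoid M] (g : ℕ → M) (N : ℕ) :
    ∑ t ∈ Finset.Icc 1 N, g t = ∑ i ∈ Finset.range N, g (i + 1) := by
  induction N with
  | zero => simp
  | succ n ih => rw [Finset.sum_Icc_succ_top (by lia), ih, Finset.sum_range_succ]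

namespace StationaryErgodic

variable {P : Measure (ℤ → ℕ)}

theorem measurePreserving (hP : StationaryErgodic P) (q : ℤ) :
    MeasurePreserving (shiftPath q) P P := by
  have hnat : ∀ n : ℕ, MeasurePreserving (shiftPath n) P P := fun n => by
    have h := hP.ergodic.toMeasurePreserving.iterate n
    have he : (fun (y : ℤ → ℕ) (t : ℤ) => y (t + 1))^[n] = shiftPath n :=
      funext fun y => iterate_shift n y
    rwa [he] at h
  obtain ⟨n, rfl | rfl⟩ := q.eq_nat_or_neg
  · exact hnat n
  · refine ⟨measurable_shiftPath _, ?_⟩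
    conv_lhs => rw [← (hnat n).map_eq]
    rw [Measure.map_map (measurable_shiftPath _) (measurable_shiftPath _)]
    have : shiftPath (-(n : ℤ)) ∘ shiftPath n = id := by
      funext y t
      simp [shiftPath]
    rw [this, Measure.map_id]

theorem ae_shift (hP : StationaryErgodic P) (q : ℤ) {p : (ℤ → ℕ) → Prop} (h : ∀ᵐ y ∂P, p y) :
    ∀ᵐ y ∂P, p (shiftPath q y) :=
  (hP.measurePreserving q).quasiMeasurePreserving.ae h

theorem lintegral_shift (hP : StationaryErgodic P) (q : ℤ) {g : (ℤ → ℕ) → ℝ≥0∞}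
    (hg : Measurable g) : ∫⁻ y, g (shiftPath q y) ∂P = ∫⁻ y, g y ∂P :=
  (hP.measurePreserving q).lintegral_comp hg

/-- The ergodic theorem for averages over the times `1, …, N`. -/
theorem ae_tendsto_avg (hP : StationaryErgodic P) {g : (ℤ → ℕ) → ℝ} (hgm : Measurable g)
    (hg : Integrable g P) :
    ∀ᵐ y ∂P, Tendsto (fun N : ℕ => (N : ℝ)⁻¹ * ∑ t ∈ Finset.Icc 1 N, g (shiftPath t y)) atTop
      (𝓝 (∫ y, g y ∂P)) := by
  have := hP.prob
  filter_upwards [hP.ae_shift 1 (hP.ergodic.ae_tendsto_birkhoff hgm hg)] with y hy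
  refine hy.congr fun N => ?_
  rw [sum_Icc_one_eq_sum_range, birkhoffSum]
  simp_rw [iterate_shift, shiftPath_shiftPath]
  push_cast
  rfl

/-- Weighted sums of a stationary sequence with summable weights converge. -/
theorem ae_summable_weighted (hP : StationaryErgodic P) {g : (ℤ → ℕ) → ℝ} (hgm : Measurable g)
    (hg : Integrable g P) (hg0 : ∀ y, 0 ≤ g y) {w : ℕ → ℝ} (hw0 : ∀ n, 0 ≤ w n)
    (hw : Summable w) (e : ℕ → ℤ) :
    ∀ᵐ y ∂P, Summable fun n => w n * g (shiftPath (e n) y) := by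
  have hm : ∀ n, Measurable fun y => ENNReal.ofReal (w n * g (shiftPath (e n) y)) := fun n =>
    ((hgm.comp (measurable_shiftPath _)).const_mul _).ennreal_ofReal
  -- By Tonelli and stationarity the expectation is `(∑ w) · E g`, whatever the times `e n` are.
  have hfin : ∫⁻ y, ∑' n, ENNReal.ofReal (w n * g (shiftPath (e n) y)) ∂P ≠ ∞ := by
    rw [lintegral_tsum fun n => (hm n).aemeasurable]
    have h1 : ∀ n, ∫⁻ y, ENNReal.ofReal (w n * g (shiftPath (e n) y)) ∂P
        = ENNReal.ofReal (w n) * ∫⁻ y, ENNReal.ofReal (g y) ∂P := fun n => by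
      simp_rw [ENNReal.ofReal_mul (hw0 n)]
      rw [lintegral_const_mul' _ _ ENNReal.ofReal_ne_top,
        hP.lintegral_shift (e n) hgm.ennreal_ofReal]
    simp_rw [h1]
    rw [ENNReal.tsum_mul_right, ← ENNReal.ofReal_tsum_of_nonneg hw0 hw,
      ← ofReal_integral_eq_lintegral_ofReal hg (Eventually.of_forall hg0)]
    exact ENNReal.mul_ne_top ENNReal.ofReal_ne_top ENNReal.ofReal_ne_top
  filter_upwards [ae_lt_top' (AEMeasurable.tsum fun n =>
    (hm n).aemeasurable) hfin] with y hy
  have := ENNReal.summable_toReal hy.ne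
  refine this.congr fun n => ?_
  exact ENNReal.toReal_ofReal (mul_nonneg (hw0 n) (hg0 _))

end StationaryErgodic

/-! ### Lag-weighted sums -/

/-- The sum `∑ₖ aₖ pₖ` of the lags weighted by `a`. -/
def lagSum (a : ℕ → ℝ) (p : ℕ → ℕ) : ℝ := ∑' k, a k * (p k : ℝ)

/-- The part `∑ₖ aₙ₊ₖ pₙ₊ₖ` of the weighted sum of the lags which starts at the lag index `n`. -/
def tailSum (a : ℕ → ℝ) (n : ℕ) (p : ℕ → ℕ) : ℝ := ∑' k, a (n + k) * (p (n + k) : ℝ)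

/-- The sequence of lags with the lags of index at least `n` put to zero. -/
def cutPast (n : ℕ) (p : ℕ → ℕ) : ℕ → ℕ := fun k => if k < n then p k else 0

/-- The weighted sum of the lags converges. -/
def LagSummable (a : ℕ → ℝ) (p : ℕ → ℕ) : Prop := Summable fun k => a k * (p k : ℝ)

section Lags

variable {a a' : ℕ → ℝ} {p p' : ℕ → ℕ}

theorem LagSummable.mono (h : LagSummable a' p) (ha : ∀ k, 0 ≤ a k) (haa : ∀ k, a k ≤ a' k) :
    LagSummable a p :=
  Summable.of_nonneg_of_le (fun k => mul_nonneg (ha k) (Nat.cast_nonneg _))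
    (fun k => mul_le_mul_of_nonneg_right (haa k) (Nat.cast_nonneg _)) h

theorem LagSummable.tail (h : LagSummable a p) (n : ℕ) :
    Summable fun k => a (n + k) * (p (n + k) : ℝ) := by
  simpa only [add_comm n] using (summable_nat_add_iff n).2 h

theorem LagSummable.of_finite {n : ℕ} (h : ∀ k, n ≤ k → p k = 0) : LagSummable a p :=
  summable_of_ne_finset_zero (s := Finset.range n) fun k hk => by
    rw [h k (by simpa using hk)]
    simp

theorem LagSummable.cut (n : ℕ) : LagSummable a (cutPast n p) :=
  LagSummable.of_finite (n := n) fun _ hk => by simp [cutPast, not_lt.2 hk]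

theorem lagSum_nonneg (ha : ∀ k, 0 ≤ a k) : 0 ≤ lagSum a p :=
  tsum_nonneg fun k => mul_nonneg (ha k) (Nat.cast_nonneg _)

theorem tailSum_nonneg (ha : ∀ k, 0 ≤ a k) (n : ℕ) : 0 ≤ tailSum a n p :=
  tsum_nonneg fun _ => mul_nonneg (ha _) (Nat.cast_nonneg _)

theorem lagSum_cut_le (h : LagSummable a p) (ha : ∀ k, 0 ≤ a k) (n : ℕ) :
    lagSum a (cutPast n p) ≤ lagSum a p := by
  refine (LagSummable.cut n).tsum_le_tsum (fun k => ?_) h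
  refine mul_le_mul_of_nonneg_left ?_ (ha k)
  unfold cutPast
  split_ifs <;> simp

theorem tailSum_mono (h : LagSummable a' p) (ha : ∀ k, 0 ≤ a k) (haa : ∀ k, a k ≤ a' k) (n : ℕ) :
    tailSum a n p ≤ tailSum a' n p :=
  ((h.mono ha haa).tail n).tsum_le_tsum
    (fun _ => mul_le_mul_of_nonneg_right (haa _) (Nat.cast_nonneg _)) (h.tail n)

theorem tendsto_tailSum (a : ℕ → ℝ) (p : ℕ → ℕ) :
    Tendsto (fun n => tailSum a n p) atTop (𝓝 0) := by
  have := tendsto_sum_nat_add fun k => a k * (p k : ℝ)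
  simpa only [tailSum, add_comm] using this

theorem LagSummable.summable_abs_sub (ha : ∀ k, 0 ≤ a k) (h : LagSummable a p) (h' : LagSummable a p') :
    Summable fun k => a k * |(p k : ℝ) - (p' k : ℝ)| := by
  refine Summable.of_nonneg_of_le (fun k => mul_nonneg (ha k) (abs_nonneg _)) (fun k => ?_)
    (h.add h')
  rw [← mul_add]
  refine mul_le_mul_of_nonneg_left ?_ (ha k)
  refine (abs_sub _ _).trans ?_
  simp

/-- Sequences of lags which agree up to the lag index `n` are close. -/
theorem tsum_abs_sub_le_tailSum (ha : ∀ k, 0 ≤ a k) (h : LagSummable a p) (h' : LagSummable a p')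
    {n : ℕ} (hn : ∀ k < n, p k = p' k) :
    ∑' k, a k * |(p k : ℝ) - (p' k : ℝ)| ≤ tailSum a n p + tailSum a n p' := by
  have hs := LagSummable.summable_abs_sub ha h h'
  have h0 : ∑ k ∈ Finset.range n, a k * |(p k : ℝ) - (p' k : ℝ)| = 0 :=
    Finset.sum_eq_zero fun k hk => by rw [hn k (by simpa using hk)]; simp
  rw [← hs.sum_add_tsum_nat_add n, h0, zero_add, tailSum, tailSum,
    ← (h.tail n).tsum_add (h'.tail n)]
  refine ((summable_nat_add_iff n).2 hs).tsum_le_tsum (fun k => ?_) ((h.tail n).add (h'.tail n))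
  rw [← mul_add, add_comm n k]
  refine mul_le_mul_of_nonneg_left ?_ (ha _)
  refine (abs_sub _ _).trans ?_
  simp

theorem tailSum_cut (n : ℕ) : tailSum a n (cutPast n p) = 0 := by
  simp [tailSum, cutPast]

end Lags

/-! ### The envelope -/

/-- The random envelope `C + y₀ + ∑ₖ aₖ y₋₁₋ₖ`. -/
def envelope (C : ℝ) (a : ℕ → ℝ) (y : ℤ → ℕ) : ℝ := C + y 0 + lagSum a (pastPath y)

section Envelope

variable {P : Measure (ℤ → ℕ)} {a : ℕ → ℝ} {C : ℝ}

theorem measurable_coord (t : ℤ) : Measurable fun y : ℤ → ℕ => (y t : ℝ) :=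
  (measurable_from_top (f := fun n : ℕ => (n : ℝ))).comp (measurable_pi_apply t)

theorem measurable_lagSum (ha : ∀ k, 0 ≤ a k) : Measurable (lagSum a) := by
  have : lagSum a = fun p => (∑' k, ENNReal.ofReal (a k * (p k : ℝ))).toReal := by
    funext p
    rw [ENNReal.tsum_toReal_eq fun _ => ENNReal.ofReal_ne_top]
    exact tsum_congr fun k =>
      (ENNReal.toReal_ofReal (mul_nonneg (ha k) (Nat.cast_nonneg _))).symm
  rw [this]
  refine (Measurable.tsum fun k => Measurable.ennreal_ofReal ?_).ennreal_toReal
  exact ((measurable_from_top (f := fun n : ℕ => (n : ℝ))).comp (measurable_pi_apply k)).const_mul _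

theorem measurable_envelope (ha : ∀ k, 0 ≤ a k) : Measurable (envelope C a) :=
  ((measurable_coord 0).const_add C).add ((measurable_lagSum ha).comp measurable_pastPath)

theorem le_envelope (ha : ∀ k, 0 ≤ a k) (y : ℤ → ℕ) : C ≤ envelope C a y := by
  have h1 : (0 : ℝ) ≤ y 0 := Nat.cast_nonneg _
  have h2 := lagSum_nonneg ha (p := pastPath y)
  unfold envelope
  linarith

theorem coord_le_envelope (hC : 0 ≤ C) (ha : ∀ k, 0 ≤ a k) (y : ℤ → ℕ) :
    (y 0 : ℝ) ≤ envelope C a y := by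
  have h2 := lagSum_nonneg ha (p := pastPath y)
  unfold envelope
  linarith

/-- Jensen's inequality for the weights `a` gives `(∑ aₖ yₖ)^p ≤ (∑ aₖ)^(p-1) ∑ aₖ yₖ^p`, and by
stationarity all lags have the same `p`-th moment. -/
theorem lintegral_lagSum_rpow_lt_top (hP : StationaryErgodic P) (ha : ∀ k, 0 ≤ a k)
    (has : Summable a) {p : ℝ} (hp : 1 ≤ p) (hm : ∫⁻ y, (y 0 : ℝ≥0∞) ^ p ∂P < ∞) :
    ∫⁻ y, ENNReal.ofReal (lagSum a (pastPath y)) ^ p ∂P < ∞ := by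
  have hp0 : 0 < p := by linarith
  set w : ℕ → ℝ≥0∞ := fun k => ENNReal.ofReal (a k)
  have hw : ∑' k, w k ≠ ∞ := by
    rw [← ENNReal.ofReal_tsum_of_nonneg ha has]
    exact ENNReal.ofReal_ne_top
  have key : ∀ y : ℤ → ℕ, ENNReal.ofReal (lagSum a (pastPath y)) ^ p
      ≤ (∑' k, w k) ^ (p - 1) * ∑' k, w k * (pastPath y k : ℝ≥0∞) ^ p := by
    intro y
    have h1 : ENNReal.ofReal (lagSum a (pastPath y)) ≤ ∑' k, w k * (pastPath y k : ℝ≥0∞) := by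
      have hw' : ∀ k, w k * (pastPath y k : ℝ≥0∞) = ENNReal.ofReal (a k * (pastPath y k : ℝ)) :=
        fun k => by rw [ENNReal.ofReal_mul (ha k), ENNReal.ofReal_natCast]
      by_cases hs : LagSummable a (pastPath y)
      · rw [lagSum, ENNReal.ofReal_tsum_of_nonneg
          (fun k => mul_nonneg (ha k) (Nat.cast_nonneg _)) hs]
        exact (tsum_congr fun k => (hw' k).symm).le
      -- A divergent lag series has the default value `0` in `lagSum`, so the bound holds without
      -- any summability.
      · rw [lagSum, tsum_eq_zero_of_not_summable hs]
        simp
    have h2 : ∑' k, w k * (pastPath y k : ℝ≥0∞)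
        ≤ (∑' k, w k) ^ (1 - p⁻¹) * (∑' k, w k * (pastPath y k : ℝ≥0∞) ^ p) ^ p⁻¹ := by
      rw [ENNReal.tsum_eq_iSup_sum]
      refine iSup_le fun s => (ENNReal.inner_le_weight_mul_Lp_of_nonneg s hp _ _).trans ?_
      gcongr
      · exact sub_nonneg.2 (inv_le_one_of_one_le₀ hp)
      · exact ENNReal.sum_le_tsum s
      · exact ENNReal.sum_le_tsum s
    calc _ ≤ ((∑' k, w k) ^ (1 - p⁻¹) * (∑' k, w k * (pastPath y k : ℝ≥0∞) ^ p) ^ p⁻¹) ^ p := by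
          gcongr
          exact h1.trans h2
      _ = _ := by
          rw [ENNReal.mul_rpow_of_nonneg _ _ hp0.le, ← ENNReal.rpow_mul, ← ENNReal.rpow_mul,
            inv_mul_cancel₀ hp0.ne', ENNReal.rpow_one, sub_mul, one_mul, inv_mul_cancel₀ hp0.ne']
  have hmeas : ∀ t : ℤ, Measurable fun y : ℤ → ℕ => (y t : ℝ≥0∞) ^ p := fun t =>
    ((measurable_from_top (f := fun n : ℕ => (n : ℝ≥0∞))).comp (measurable_pi_apply t)).pow_const p
  have hmeas' : ∀ k, Measurable fun y : ℤ → ℕ => w k * (pastPath y k : ℝ≥0∞) ^ p := fun k =>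
    (hmeas _).const_mul _
  refine (lintegral_mono key).trans_lt ?_
  rw [lintegral_const_mul _ (Measurable.tsum hmeas'), lintegral_tsum fun k => (hmeas' k).aemeasurable]
  have h3 : ∀ k : ℕ, ∫⁻ y, w k * (pastPath y k : ℝ≥0∞) ^ p ∂P
      = w k * ∫⁻ y, (y 0 : ℝ≥0∞) ^ p ∂P := fun k => by
    rw [lintegral_const_mul' _ _ ENNReal.ofReal_ne_top, ← hP.lintegral_shift (-1 - (k : ℤ)) (hmeas 0)]
    simp [pastPath, shiftPath, w]
  simp_rw [h3]
  rw [ENNReal.tsum_mul_right]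
  exact ENNReal.mul_lt_top (ENNReal.rpow_lt_top_of_nonneg (by linarith) hw)
    (ENNReal.mul_lt_top hw.lt_top hm)

theorem integrable_envelope_rpow (hP : StationaryErgodic P) (hC : 0 ≤ C) (ha : ∀ k, 0 ≤ a k)
    (has : Summable a) {p : ℝ} (hp : 1 ≤ p) (hm : ∫⁻ y, (y 0 : ℝ≥0∞) ^ p ∂P < ∞) :
    Integrable (fun y => envelope C a y ^ p) P := by
  have := hP.prob
  have hp0 : 0 < p := by linarith
  refine ⟨((measurable_envelope ha).pow_const p).aestronglyMeasurable, ?_⟩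
  have hmeas : Measurable fun y : ℤ → ℕ => (y 0 : ℝ≥0∞) ^ p :=
    ((measurable_from_top (f := fun n : ℕ => (n : ℝ≥0∞))).comp (measurable_pi_apply 0)).pow_const p
  have hlag : Measurable fun y : ℤ → ℕ => ENNReal.ofReal (lagSum a (pastPath y)) ^ p :=
    ((measurable_lagSum ha).comp measurable_pastPath).ennreal_ofReal.pow_const p
  have key : ∀ y : ℤ → ℕ, ‖envelope C a y ^ p‖ₑ ≤ 2 ^ (p - 1) * (2 ^ (p - 1) *
      (ENNReal.ofReal C ^ p + (y 0 : ℝ≥0∞) ^ p) + ENNReal.ofReal (lagSum a (pastPath y)) ^ p) := by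
    intro y
    have h0 : 0 ≤ envelope C a y := hC.trans (le_envelope ha y)
    have h1 : ENNReal.ofReal (envelope C a y)
        = ENNReal.ofReal C + (y 0 : ℝ≥0∞) + ENNReal.ofReal (lagSum a (pastPath y)) := by
      rw [envelope, ENNReal.ofReal_add (by positivity) (lagSum_nonneg ha),
        ENNReal.ofReal_add hC (Nat.cast_nonneg _), ENNReal.ofReal_natCast]
    rw [Real.enorm_of_nonneg (Real.rpow_nonneg h0 _), ← ENNReal.ofReal_rpow_of_nonneg h0 hp0.le, h1]
    refine (ENNReal.rpow_add_le_mul_rpow_add_rpow _ _ hp).trans ?_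
    gcongr
    exact ENNReal.rpow_add_le_mul_rpow_add_rpow _ _ hp
  have h2 : (2 : ℝ≥0∞) ^ (p - 1) < ∞ := ENNReal.rpow_lt_top_of_nonneg (by linarith) (by simp)
  refine (lintegral_mono key).trans_lt ?_
  have hm1 : Measurable fun y : ℤ → ℕ => ENNReal.ofReal C ^ p + (y 0 : ℝ≥0∞) ^ p :=
    hmeas.const_add _
  have hm2 : Measurable fun y : ℤ → ℕ => 2 ^ (p - 1) * (ENNReal.ofReal C ^ p + (y 0 : ℝ≥0∞) ^ p)
      + ENNReal.ofReal (lagSum a (pastPath y)) ^ p := (hm1.const_mul _).add hlag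
  rw [lintegral_const_mul _ hm2, lintegral_add_right _ hlag, lintegral_const_mul _ hm1,
    lintegral_add_right _ hmeas, lintegral_const]
  refine ENNReal.mul_lt_top h2 (ENNReal.add_lt_top.2 ⟨ENNReal.mul_lt_top h2
    (ENNReal.add_lt_top.2 ⟨?_, hm⟩), lintegral_lagSum_rpow_lt_top hP ha has hp hm⟩)
  simpa using ENNReal.rpow_lt_top_of_nonneg hp0.le ENNReal.ofReal_ne_top

/-- The Lipschitz bounds for the model are only available for summable pasts; this gives a single
null set which serves all times. -/
theorem ae_forall_lagSummable (hP : StationaryErgodic P) (ha : ∀ k, 0 ≤ a k) (has : Summable a)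
    (hm : Integrable (fun y : ℤ → ℕ => (y 0 : ℝ)) P) :
    ∀ᵐ y ∂P, ∀ t : ℤ, LagSummable a (pastPath (shiftPath t y)) := by
  refine ae_all_iff.2 fun t => hP.ae_shift t (p := fun y => LagSummable a (pastPath y)) ?_
  filter_upwards [hP.ae_summable_weighted (measurable_coord 0) hm (fun y => Nat.cast_nonneg _) ha has
    fun k => -1 - (k : ℤ)] with y hy
  simpa [LagSummable, pastPath, shiftPath] using hy

end Envelope

/-! ### Bounds for the model -/

/-- The properties of the model which are used: the functions `θ ↦ f θ p` are twice continuously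
differentiable, and with their derivatives they are bounded by `C + lagSum A p` and Lipschitz in
`p` with coefficients `A`, and with coefficients `a` for the orders `0` and `1`. -/
structure ModelBounds {d : ℕ} (Θ : Set (Param d)) (f : Param d → (ℕ → ℕ) → ℝ) (c C : ℝ)
    (a A : ℕ → ℝ) : Prop where
  compact : IsCompact Θ
  measurable : ∀ θ ∈ Θ, Measurable (f θ)
  c_pos : 0 < c
  lower : ∀ θ ∈ Θ, ∀ p, c ≤ f θ p
  one_le_C : 1 ≤ C
  a_nonneg : ∀ k, 0 ≤ a k
  a_le : ∀ k, a k ≤ A k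
  A_summable : Summable A
  contDiffOn : ∀ p, ContDiffOn ℝ 2 (fun θ => f θ p) Θ
  bound : ∀ i ≤ 2, ∀ θ ∈ Θ, ∀ p, LagSummable A p →
    ‖iteratedFDerivWithin ℝ i (fun θ' => f θ' p) Θ θ‖ ≤ C + lagSum A p
  lipschitz : ∀ i ≤ 2, ∀ θ ∈ Θ, ∀ n p p', LagSummable A p → LagSummable A p' →
    (∀ k < n, p k = p' k) →
    ‖iteratedFDerivWithin ℝ i (fun θ' => f θ' p) Θ θ
      - iteratedFDerivWithin ℝ i (fun θ' => f θ' p') Θ θ‖ ≤ tailSum A n p + tailSum A n p'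
  lipschitz' : ∀ i ≤ 1, ∀ θ ∈ Θ, ∀ n p p', LagSummable A p → LagSummable A p' →
    (∀ k < n, p k = p' k) →
    ‖iteratedFDerivWithin ℝ i (fun θ' => f θ' p) Θ θ
      - iteratedFDerivWithin ℝ i (fun θ' => f θ' p') Θ θ‖ ≤ tailSum a n p + tailSum a n p'

/-- Two coefficient sequences are kept apart because `α 0 + α 1` decays polynomially, while `α 2` is
only summable. The pointwise bounds come from comparison with the zero past, at which the
derivatives are bounded on `Θ`. -/
theorem exists_modelBounds {d : ℕ} {Θ : Set (Param d)} (hΘ : IsCompact Θ)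
    {f : Param d → (ℕ → ℕ) → ℝ} (hf : ∀ θ ∈ Θ, Measurable (f θ))
    {c : ℝ} (hc : 0 < c) (hfc : ∀ θ ∈ Θ, ∀ y, c ≤ f θ y)
    {α : ℕ → ℕ → ℝ} (hα : ∀ i ≤ 2, SmoothLipschitz Θ f i (α i)) :
    ∃ C, ModelBounds Θ f c C (fun k => α 0 k + α 1 k) (fun k => α 0 k + α 1 k + α 2 k) := by
  have h0 := hα 0 (by norm_num)
  have h1 := hα 1 (by norm_num)
  have h2 := hα 2 le_rfl
  obtain ⟨B0, hB0⟩ := h0.bounded 0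
  obtain ⟨B1, hB1⟩ := h1.bounded 0
  obtain ⟨B2, hB2⟩ := h2.bounded 0
  have hA0 : ∀ k, 0 ≤ α 0 k + α 1 k + α 2 k := fun k =>
    add_nonneg (add_nonneg (h0.nonneg k) (h1.nonneg k)) (h2.nonneg k)
  have ha0 : ∀ k, 0 ≤ α 0 k + α 1 k := fun k => add_nonneg (h0.nonneg k) (h1.nonneg k)
  have hle : ∀ i ≤ 2, ∀ k, α i k ≤ α 0 k + α 1 k + α 2 k := by
    intro i hi k
    have := h0.nonneg k
    have := h1.nonneg k
    have := h2.nonneg k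
    interval_cases i <;> linarith
  have hle' : ∀ i ≤ 1, ∀ k, α i k ≤ α 0 k + α 1 k := by
    intro i hi k
    have := h0.nonneg k
    have := h1.nonneg k
    interval_cases i <;> linarith
  have hlip : ∀ i ≤ 2, ∀ θ ∈ Θ, ∀ n p p',
      LagSummable (fun k => α 0 k + α 1 k + α 2 k) p →
      LagSummable (fun k => α 0 k + α 1 k + α 2 k) p' → (∀ k < n, p k = p' k) →
      ‖iteratedFDerivWithin ℝ i (fun θ' => f θ' p) Θ θ
        - iteratedFDerivWithin ℝ i (fun θ' => f θ' p') Θ θ‖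
        ≤ tailSum (α i) n p + tailSum (α i) n p' := by
    intro i hi θ hθ n p p' hp hp' hn
    have hpi := hp.mono (hα i hi).nonneg (hle i hi)
    have hpi' := hp'.mono (hα i hi).nonneg (hle i hi)
    exact ((hα i hi).lipschitz p p' (hpi.summable_abs_sub (hα i hi).nonneg hpi') θ hθ).trans
      (tsum_abs_sub_le_tailSum (hα i hi).nonneg hpi hpi' hn)
  refine ⟨max 1 (max B0 (max B1 B2)), hΘ, hf, hc, hfc, le_max_left _ _, ha0,
    fun k => by linarith [h2.nonneg k], (h0.summable.add h1.summable).add h2.summable,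
    fun p => by exact_mod_cast h2.contDiffOn p, fun i hi θ hθ p hp => ?_,
    fun i hi θ hθ n p p' hp hp' hn => ?_, fun i hi θ hθ n p p' hp hp' hn => ?_⟩
  · have hz : LagSummable (fun k => α 0 k + α 1 k + α 2 k) (0 : ℕ → ℕ) :=
      LagSummable.of_finite (n := 0) fun _ _ => rfl
    have h := hlip i hi θ hθ 0 p 0 hp hz (by simp)
    have hB : ‖iteratedFDerivWithin ℝ i (fun θ' => f θ' 0) Θ θ‖ ≤ max 1 (max B0 (max B1 B2)) := by
      interval_cases i
      · exact (hB0 θ hθ).trans (by simp)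
      · exact (hB1 θ hθ).trans (by simp)
      · exact (hB2 θ hθ).trans (by simp)
    have ht0 : tailSum (α i) 0 (0 : ℕ → ℕ) = 0 := by simp [tailSum]
    have ht : tailSum (α i) 0 p ≤ lagSum (fun k => α 0 k + α 1 k + α 2 k) p := by
      refine (tailSum_mono hp (hα i hi).nonneg (hle i hi) 0).trans (le_of_eq ?_)
      simp [tailSum, lagSum]
    have := norm_le_norm_add_norm_sub' (iteratedFDerivWithin ℝ i (fun θ' => f θ' p) Θ θ)
      (iteratedFDerivWithin ℝ i (fun θ' => f θ' 0) Θ θ)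
    linarith
  · exact (hlip i hi θ hθ n p p' hp hp' hn).trans (add_le_add
      (tailSum_mono hp (hα i hi).nonneg (hle i hi) n)
      (tailSum_mono hp' (hα i hi).nonneg (hle i hi) n))
  · have hle2 : ∀ k, α 0 k + α 1 k ≤ α 0 k + α 1 k + α 2 k := fun k => by linarith [h2.nonneg k]
    exact (hlip i (by lia) θ hθ n p p' hp hp' hn).trans (add_le_add
      (tailSum_mono (hp.mono ha0 hle2) (hα i (by lia)).nonneg (hle' i hi) n)
      (tailSum_mono (hp'.mono ha0 hle2) (hα i (by lia)).nonneg (hle' i hi) n))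

/-- The partial derivative of the model in the parameter. -/
def fd1 {d : ℕ} (f : Param d → (ℕ → ℕ) → ℝ) (i : Fin d) (θ : Param d) (p : ℕ → ℕ) : ℝ :=
  fderiv ℝ (fun θ' => f θ' p) θ (EuclideanSpace.single i 1)

/-- The second partial derivative of the model in the parameter. -/
def fd2 {d : ℕ} (f : Param d → (ℕ → ℕ) → ℝ) (i j : Fin d) (θ : Param d) (p : ℕ → ℕ) : ℝ :=
  fderiv ℝ (fun θ' => fd1 f i θ' p) θ (EuclideanSpace.single j 1)

theorem fderiv_eq_sum {d : ℕ} (L : Param d →L[ℝ] ℝ) (u : Param d) :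
    L u = ∑ i, u i * L (EuclideanSpace.single i 1) := by
  have : u = ∑ i, u i • EuclideanSpace.single i (1 : ℝ) := by
    ext j
    simp [Finset.sum_apply, Pi.single_apply]
  conv_lhs => rw [this]
  simp [map_sum]

/-- Limits of difference quotients of functions depending measurably on a parameter are
measurable. -/
theorem measurable_fderiv_apply {d : ℕ} {E : Type*} [MeasurableSpace E] {U : Set (Param d)}
    (hU : IsOpen U) {F : Param d → E → ℝ} (hF : ∀ θ ∈ U, Measurable (F θ)) {θ : Param d}
    (hθ : θ ∈ U) (hd : ∀ p, DifferentiableAt ℝ (fun θ' => F θ' p) θ) (u : Param d) :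
    Measurable fun p => fderiv ℝ (fun θ' => F θ' p) θ u := by
  have hlim : Tendsto (fun n : ℕ => θ + ((n : ℝ) + 1)⁻¹ • u) atTop (𝓝 θ) := by
    have : Tendsto (fun n : ℕ => θ + ((n : ℝ) + 1)⁻¹ • u) atTop (𝓝 (θ + (0 : ℝ) • u)) := by
      refine tendsto_const_nhds.add (Tendsto.smul_const ?_ u)
      simpa [one_div] using tendsto_one_div_add_atTop_nhds_zero_nat (𝕜 := ℝ)
    simpa using this
  obtain ⟨N, hN⟩ := eventually_atTop.1 (hlim.eventually (hU.mem_nhds hθ))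
  -- Starting the difference quotients at `N` keeps all evaluation points inside `U`, where
  -- measurability is known.
  refine measurable_of_tendsto_metrizable (f := fun (n : ℕ) p =>
    (((n + N : ℕ) : ℝ) + 1) • (F (θ + (((n + N : ℕ) : ℝ) + 1)⁻¹ • u) p - F θ p)) (fun n => ?_) ?_
  · exact ((hF _ (hN (n + N) (by lia))).sub (hF _ hθ)).const_mul _
  · rw [tendsto_pi_nhds]
    intro p
    refine (hd p).hasFDerivAt.lim u (tendsto_norm_atTop_atTop.comp ?_)
    exact tendsto_atTop_add_const_right _ _
      (tendsto_natCast_atTop_atTop.comp (tendsto_add_atTop_nat N))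

namespace ModelBounds

variable {d : ℕ} {Θ U : Set (Param d)} {f : Param d → (ℕ → ℕ) → ℝ} {c C : ℝ} {a A : ℕ → ℝ}
  {θ : Param d} {p p' : ℕ → ℕ}

theorem A_nonneg (hM : ModelBounds Θ f c C a A) (k : ℕ) : 0 ≤ A k :=
  (hM.a_nonneg k).trans (hM.a_le k)

theorem pos (hM : ModelBounds Θ f c C a A) (hθ : θ ∈ Θ) (p : ℕ → ℕ) : 0 < f θ p :=
  hM.c_pos.trans_le (hM.lower θ hθ p)

theorem abs_le (hM : ModelBounds Θ f c C a A) (hθ : θ ∈ Θ) (hp : LagSummable A p) :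
    |f θ p| ≤ C + lagSum A p := by
  have := hM.bound 0 (by norm_num) θ hθ p hp
  rwa [norm_iteratedFDerivWithin_zero, Real.norm_eq_abs] at this

theorem abs_sub_le (hM : ModelBounds Θ f c C a A) (hθ : θ ∈ Θ) (hp : LagSummable A p)
    (hp' : LagSummable A p') {n : ℕ} (hn : ∀ k < n, p k = p' k) :
    |f θ p - f θ p'| ≤ tailSum a n p + tailSum a n p' := by
  refine le_trans (le_of_eq ?_) (hM.lipschitz' 0 (by norm_num) θ hθ n p p' hp hp' hn)
  rw [iteratedFDerivWithin_zero_eq_comp, iteratedFDerivWithin_zero_eq_comp, Function.comp_apply,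
    Function.comp_apply, ← map_sub, LinearIsometryEquiv.norm_map, Real.norm_eq_abs]

theorem continuousOn (hM : ModelBounds Θ f c C a A) (p : ℕ → ℕ) :
    ContinuousOn (fun θ => f θ p) Θ := (hM.contDiffOn p).continuousOn

theorem contDiffAt (hM : ModelBounds Θ f c C a A) (hU : IsOpen U) (hUΘ : U ⊆ Θ) (hθ : θ ∈ U)
    (p : ℕ → ℕ) : ContDiffAt ℝ 2 (fun θ => f θ p) θ :=
  (hM.contDiffOn p).contDiffAt (mem_of_superset (hU.mem_nhds hθ) hUΘ)

theorem iteratedFDerivWithin_eq (hU : IsOpen U) (hUΘ : U ⊆ Θ) (hθ : θ ∈ U) (i : ℕ)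
    (g : Param d → ℝ) : iteratedFDerivWithin ℝ i g Θ θ = iteratedFDeriv ℝ i g θ := by
  rw [← iteratedFDerivWithin_univ]
  refine iteratedFDerivWithin_congr_set ?_ i
  filter_upwards [hU.mem_nhds hθ] with x hx
  exact eq_true (hUΘ hx)

theorem pderiv_eq_fd1 (hU : IsOpen U) (hUΘ : U ⊆ Θ) (hθ : θ ∈ U) (i : Fin d) (p : ℕ → ℕ) :
    pderiv Θ (fun θ => f θ p) i θ = fd1 f i θ p := by
  rw [pderiv, fd1, fderivWithin_of_mem_nhds (mem_of_superset (hU.mem_nhds hθ) hUΘ)]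

theorem differentiableAt_fderiv (hM : ModelBounds Θ f c C a A) (hU : IsOpen U) (hUΘ : U ⊆ Θ)
    (hθ : θ ∈ U) (p : ℕ → ℕ) : DifferentiableAt ℝ (fderiv ℝ fun θ => f θ p) θ :=
  ((hM.contDiffAt hU hUΘ hθ p).fderiv_right (m := 1) (by norm_num)).differentiableAt
    (by norm_num)

theorem differentiableAt (hM : ModelBounds Θ f c C a A) (hU : IsOpen U) (hUΘ : U ⊆ Θ)
    (hθ : θ ∈ U) (p : ℕ → ℕ) : DifferentiableAt ℝ (fun θ => f θ p) θ :=
  (hM.contDiffAt hU hUΘ hθ p).differentiableAt (by norm_num)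

theorem differentiableAt_fd1 (hM : ModelBounds Θ f c C a A) (hU : IsOpen U) (hUΘ : U ⊆ Θ)
    (hθ : θ ∈ U) (i : Fin d) (p : ℕ → ℕ) : DifferentiableAt ℝ (fun θ => fd1 f i θ p) θ :=
  (hM.differentiableAt_fderiv hU hUΘ hθ p).clm_apply (differentiableAt_const _)

theorem fderiv_fd1_apply (hM : ModelBounds Θ f c C a A) (hU : IsOpen U) (hUΘ : U ⊆ Θ)
    (hθ : θ ∈ U) (i : Fin d) (p : ℕ → ℕ) (v : Param d) :
    fderiv ℝ (fun θ => fd1 f i θ p) θ v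
      = iteratedFDeriv ℝ 2 (fun θ => f θ p) θ ![v, EuclideanSpace.single i 1] := by
  rw [iteratedFDeriv_two_apply]
  unfold fd1
  rw [fderiv_clm_apply (hM.differentiableAt_fderiv hU hUΘ hθ p) (differentiableAt_const _)]
  simp

theorem fd1_eq (i : Fin d) (θ : Param d) (p : ℕ → ℕ) :
    fd1 f i θ p = iteratedFDeriv ℝ 1 (fun θ => f θ p) θ ![EuclideanSpace.single i 1] := by
  rw [iteratedFDeriv_one_apply]
  rfl

theorem fd2_eq (hM : ModelBounds Θ f c C a A) (hU : IsOpen U) (hUΘ : U ⊆ Θ)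
    (hθ : θ ∈ U) (i j : Fin d) (p : ℕ → ℕ) :
    fd2 f i j θ p = iteratedFDeriv ℝ 2 (fun θ => f θ p) θ
      ![EuclideanSpace.single j 1, EuclideanSpace.single i 1] :=
  hM.fderiv_fd1_apply hU hUΘ hθ i p _

theorem abs_fd1_le (hM : ModelBounds Θ f c C a A) (hU : IsOpen U) (hUΘ : U ⊆ Θ) (hθ : θ ∈ U)
    (i : Fin d) (hp : LagSummable A p) : |fd1 f i θ p| ≤ C + lagSum A p := by
  have h := hM.bound 1 (by norm_num) θ (hUΘ hθ) p hp
  rw [iteratedFDerivWithin_eq hU hUΘ hθ] at h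
  refine le_trans ?_ h
  rw [fd1_eq, ← Real.norm_eq_abs]
  refine (ContinuousMultilinearMap.le_opNorm _ _).trans (le_of_eq ?_)
  simp

theorem abs_fd1_sub_le (hM : ModelBounds Θ f c C a A) (hU : IsOpen U) (hUΘ : U ⊆ Θ) (hθ : θ ∈ U)
    (i : Fin d) (hp : LagSummable A p) (hp' : LagSummable A p') {n : ℕ}
    (hn : ∀ k < n, p k = p' k) :
    |fd1 f i θ p - fd1 f i θ p'| ≤ tailSum a n p + tailSum a n p' := by
  have h := hM.lipschitz' 1 le_rfl θ (hUΘ hθ) n p p' hp hp' hn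
  rw [iteratedFDerivWithin_eq hU hUΘ hθ, iteratedFDerivWithin_eq hU hUΘ hθ] at h
  refine le_trans ?_ h
  rw [fd1_eq, fd1_eq, ← Real.norm_eq_abs, ← sub_apply]
  refine (ContinuousMultilinearMap.le_opNorm _ _).trans (le_of_eq ?_)
  simp

theorem abs_fd2_le (hM : ModelBounds Θ f c C a A) (hU : IsOpen U) (hUΘ : U ⊆ Θ) (hθ : θ ∈ U)
    (i j : Fin d) (hp : LagSummable A p) : |fd2 f i j θ p| ≤ C + lagSum A p := by
  have h := hM.bound 2 le_rfl θ (hUΘ hθ) p hp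
  rw [iteratedFDerivWithin_eq hU hUΘ hθ] at h
  refine le_trans ?_ h
  rw [hM.fd2_eq hU hUΘ hθ, ← Real.norm_eq_abs]
  refine (ContinuousMultilinearMap.le_opNorm _ _).trans (le_of_eq ?_)
  simp [Fin.prod_univ_two]

theorem abs_fd2_sub_le (hM : ModelBounds Θ f c C a A) (hU : IsOpen U) (hUΘ : U ⊆ Θ) (hθ : θ ∈ U)
    (i j : Fin d) (hp : LagSummable A p) (hp' : LagSummable A p') {n : ℕ}
    (hn : ∀ k < n, p k = p' k) :
    |fd2 f i j θ p - fd2 f i j θ p'| ≤ tailSum A n p + tailSum A n p' := by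
  have h := hM.lipschitz 2 le_rfl θ (hUΘ hθ) n p p' hp hp' hn
  rw [iteratedFDerivWithin_eq hU hUΘ hθ, iteratedFDerivWithin_eq hU hUΘ hθ] at h
  refine le_trans ?_ h
  rw [hM.fd2_eq hU hUΘ hθ, hM.fd2_eq hU hUΘ hθ, ← Real.norm_eq_abs,
    ← sub_apply]
  refine (ContinuousMultilinearMap.le_opNorm _ _).trans (le_of_eq ?_)
  simp [Fin.prod_univ_two]

theorem continuousOn_fd1 (hM : ModelBounds Θ f c C a A) (hU : IsOpen U) (hUΘ : U ⊆ Θ)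
    (i : Fin d) (p : ℕ → ℕ) : ContinuousOn (fun θ => fd1 f i θ p) U :=
  fun _ hθ => (hM.differentiableAt_fd1 hU hUΘ hθ i p).continuousAt.continuousWithinAt

theorem continuousOn_fd2 (hM : ModelBounds Θ f c C a A) (hU : IsOpen U) (hUΘ : U ⊆ Θ)
    (i j : Fin d) (p : ℕ → ℕ) : ContinuousOn (fun θ => fd2 f i j θ p) U := by
  have h2 : ContDiffOn ℝ 2 (fun θ => f θ p) U := (hM.contDiffOn p).mono hUΘ
  have h1 : ContDiffOn ℝ 1 (fun θ => fd1 f i θ p) U :=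
    (h2.fderiv_of_isOpen hU (by norm_num)).clm_apply contDiffOn_const
  exact (h1.continuousOn_fderiv_of_isOpen hU le_rfl).clm_apply continuousOn_const

theorem measurable_fd1 (hM : ModelBounds Θ f c C a A) (hU : IsOpen U) (hUΘ : U ⊆ Θ) (hθ : θ ∈ U)
    (i : Fin d) : Measurable (fd1 f i θ) :=
  measurable_fderiv_apply hU (fun θ hθ => hM.measurable θ (hUΘ hθ)) hθ
    (hM.differentiableAt hU hUΘ hθ) _

theorem measurable_fd2 (hM : ModelBounds Θ f c C a A) (hU : IsOpen U) (hUΘ : U ⊆ Θ) (hθ : θ ∈ U)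
    (i j : Fin d) : Measurable (fd2 f i j θ) :=
  measurable_fderiv_apply hU (fun _ hθ => hM.measurable_fd1 hU hUΘ hθ i) hθ
    (hM.differentiableAt_fd1 hU hUΘ hθ i) _

theorem abs_sub_le_mul_norm (hM : ModelBounds Θ f c C a A) (hU : IsOpen U) (hUΘ : U ⊆ Θ)
    (hUc : Convex ℝ U) {θ' : Param d} (hθ : θ ∈ U) (hθ' : θ' ∈ U) (hp : LagSummable A p) :
    |f θ p - f θ' p| ≤ (C + lagSum A p) * ‖θ - θ'‖ := by
  refine hUc.norm_image_sub_le_of_norm_fderiv_le (f := fun θ => f θ p) (𝕜 := ℝ)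
    (fun x hx => hM.differentiableAt hU hUΘ hx p) (fun x hx => ?_) hθ' hθ
  have h := hM.bound 1 (by norm_num) x (hUΘ hx) p hp
  rwa [iteratedFDerivWithin_eq hU hUΘ hx, norm_iteratedFDeriv_one] at h

theorem abs_fd1_sub_le_mul_norm (hM : ModelBounds Θ f c C a A) (hU : IsOpen U) (hUΘ : U ⊆ Θ)
    (hUc : Convex ℝ U) {θ' : Param d} (hθ : θ ∈ U) (hθ' : θ' ∈ U) (i : Fin d)
    (hp : LagSummable A p) :
    |fd1 f i θ p - fd1 f i θ' p| ≤ (C + lagSum A p) * ‖θ - θ'‖ := by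
  refine hUc.norm_image_sub_le_of_norm_fderiv_le (f := fun θ => fd1 f i θ p) (𝕜 := ℝ)
    (fun x hx => hM.differentiableAt_fd1 hU hUΘ hx i p) (fun x hx => ?_) hθ' hθ
  have h := hM.bound 2 le_rfl x (hUΘ hx) p hp
  rw [iteratedFDerivWithin_eq hU hUΘ hx] at h
  refine ContinuousLinearMap.opNorm_le_bound _ ((norm_nonneg _).trans h) fun v => ?_
  rw [hM.fderiv_fd1_apply hU hUΘ hx]
  refine (ContinuousMultilinearMap.le_opNorm _ _).trans ?_
  simp only [Fin.prod_univ_two, Matrix.cons_val_zero, Matrix.cons_val_one]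
  have : ‖(EuclideanSpace.single i (1 : ℝ) : Param d)‖ = 1 := by simp
  rw [this, mul_one]
  gcongr

end ModelBounds

/-! ### Uniform laws of large numbers -/

/-- A dominated family which converges along a countably generated filter is close to its limit up
to a majorant with small integral. -/
theorem exists_majorant {E ι : Type*} [MeasurableSpace E] {P : Measure E} [Countable ι]
    {l : Filter ι} [l.IsCountablyGenerated] {H : ι → E → ℝ} {H₀ G : E → ℝ}
    (hH : ∀ a, Measurable (H a)) (hH₀ : Measurable H₀) (hG : Integrable G P)
    (hdom : ∀ᵐ y ∂P, ∀ a, |H a y - H₀ y| ≤ G y)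
    (hlim : ∀ᵐ y ∂P, Tendsto (fun a => H a y) l (𝓝 (H₀ y))) {ε : ℝ} (hε : 0 < ε) :
    ∃ w : E → ℝ, Measurable w ∧ Integrable w P ∧ ∫ y, w y ∂P < ε ∧
      ∃ s ∈ l, ∀ᵐ y ∂P, ∀ a ∈ s, |H a y - H₀ y| ≤ w y := by
  obtain ⟨B, hB⟩ := l.exists_antitone_basis
  -- The supremum over the `n`-th basis set is measurable because the index set is countable, is
  -- dominated by `G`, and decreases to zero; dominated convergence makes its integral small for
  -- some `n`.
  set W : ℕ → E → ℝ≥0∞ := fun n y => ⨆ a ∈ B n, ‖H a y - H₀ y‖ₑ with hW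
  have hWm : ∀ n, Measurable (W n) := fun n =>
    Measurable.biSup _ (Set.to_countable _) fun a _ => ((hH a).sub hH₀).enorm
  have hWG : ∀ n, W n ≤ᵐ[P] fun y => ‖G y‖ₑ := fun n => by
    filter_upwards [hdom] with y hy
    refine iSup₂_le fun a _ => ?_
    rw [enorm_le_iff_norm_le, Real.norm_eq_abs, Real.norm_eq_abs]
    exact (hy a).trans (le_abs_self _)
  have hWlim : ∀ᵐ y ∂P, Tendsto (fun n => W n y) atTop (𝓝 0) := by
    filter_upwards [hlim] with y hy
    rw [ENNReal.tendsto_nhds_zero]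
    intro δ hδ
    have h1 : Tendsto (fun a => ‖H a y - H₀ y‖ₑ) l (𝓝 0) := by
      have := (hy.sub_const (H₀ y)).enorm
      simpa using this
    have h2 := (ENNReal.tendsto_nhds_zero.1 h1) δ hδ
    obtain ⟨n, -, hn⟩ := hB.toHasBasis.mem_iff.1 h2
    filter_upwards [eventually_ge_atTop n] with k hk
    exact iSup₂_le fun a ha => hn (hB.antitone hk ha)
  have hint := tendsto_lintegral_of_dominated_convergence (fun y => ‖G y‖ₑ) hWm hWG hG.2.ne hWlim
  rw [lintegral_zero] at hint
  obtain ⟨n, hn⟩ := (hint.eventually_lt_const (ENNReal.ofReal_pos.2 hε)).exists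
  have hfin : ∀ᵐ y ∂P, W n y < ∞ := ae_lt_top (hWm n) hn.ne_top
  refine ⟨fun y => (W n y).toReal, (hWm n).ennreal_toReal,
    integrable_toReal_of_lintegral_ne_top (hWm n).aemeasurable hn.ne_top, ?_,
    B n, hB.mem n, ?_⟩
  · rw [integral_toReal (hWm n).aemeasurable hfin]
    exact (ENNReal.lt_ofReal_iff_toReal_lt hn.ne_top).1 hn
  · filter_upwards [hfin] with y hy a ha
    have h3 : ‖H a y - H₀ y‖ₑ ≤ W n y := le_iSup₂ (f := fun a _ => ‖H a y - H₀ y‖ₑ) a ha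
    have h4 := ENNReal.toReal_mono hy.ne h3
    rwa [toReal_enorm, Real.norm_eq_abs] at h4

theorem measurable_cutPast (n : ℕ) : Measurable (cutPast n) :=
  measurable_pi_lambda _ fun k => by
    by_cases h : k < n
    · simpa [cutPast, h] using measurable_pi_apply k
    · simp [cutPast, h]

/-- Inequalities between continuous functions extend from a dense subset. -/
theorem forall_mem_of_dense {E : Type*} [TopologicalSpace E] {B D O : Set E} (hO : IsOpen O)
    (hDB : D ⊆ B) (hBD : B ⊆ closure D) {g : E → ℝ} (hg : ContinuousOn g B) {r : ℝ}
    (h : ∀ x ∈ D, x ∈ O → g x ≤ r) : ∀ x ∈ B, x ∈ O → g x ≤ r := by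
  intro x hx hxO
  have : (𝓝[D] x).NeBot := mem_closure_iff_nhdsWithin_neBot.1 (hBD hx)
  have ht : Tendsto g (𝓝[D] x) (𝓝 (g x)) := (hg x hx).mono_left (nhdsWithin_mono x hDB)
  refine le_of_tendsto ht ?_
  filter_upwards [self_mem_nhdsWithin, mem_nhdsWithin_of_mem_nhds (hO.mem_nhds hxO)] with z hz hz'
  exact h z hz hz'

/-- A law of large numbers, uniform for parameters near `θ₀`, for functions of the truncated
past. -/
theorem ae_eventually_avg_cut_near {d : ℕ} {P : Measure (ℤ → ℕ)} (hP : StationaryErgodic P)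
    {B : Set (Param d)} {θ₀ : Param d} (hθ₀ : θ₀ ∈ B) {H : Param d → ℕ → (ℕ → ℕ) → ℝ}
    (hmeas : ∀ θ ∈ B, Measurable fun q : ℕ × (ℕ → ℕ) => H θ q.1 q.2)
    (hcont : ∀ k p, ContinuousOn (fun θ => H θ k p) B) {G : (ℤ → ℕ) → ℝ}
    (hG : Integrable G P)
    (hcut : ∀ᵐ y ∂P, ∀ θ ∈ B, ∀ n, |H θ (y 0) (cutPast n (pastPath y))| ≤ G y)
    (hfull : ∀ᵐ y ∂P, |H θ₀ (y 0) (pastPath y)| ≤ G y)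
    (hlim : ∀ᵐ y ∂P, Tendsto (fun q : Param d × ℕ => H q.1 (y 0) (cutPast q.2 (pastPath y)))
      (𝓝[B] θ₀ ×ˢ atTop) (𝓝 (H θ₀ (y 0) (pastPath y)))) :
    ∀ᵐ y ∂P, ∀ ε > 0, ∃ ρ > 0, ∀ᶠ m : ℕ in atTop, ∀ θ ∈ B, dist θ θ₀ < ρ →
      |(m : ℝ)⁻¹ * ∑ t ∈ Finset.Icc 1 m, H θ (y t) (cutPast (t - 1) (pastPath (shiftPath t y)))
        - ∫ y, H θ₀ (y 0) (pastPath y) ∂P| ≤ ε := by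
  have hpm : Measurable fun y : ℤ → ℕ => (y 0, pastPath y) :=
    (measurable_pi_apply 0).prodMk measurable_pastPath
  have hm₀ : Measurable fun y : ℤ → ℕ => H θ₀ (y 0) (pastPath y) := (hmeas θ₀ hθ₀).comp hpm
  have hi₀ : Integrable (fun y : ℤ → ℕ => H θ₀ (y 0) (pastPath y)) P :=
    hG.mono' hm₀.aestronglyMeasurable (by simpa using hfull)
  -- Suprema are taken over a countable dense set of parameters for measurability, and continuity
  -- recovers the other parameters.
  obtain ⟨D, hDB, hDc, hBD⟩ := TopologicalSpace.IsSeparable.exists_countable_dense_subset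
    (TopologicalSpace.IsSeparable.of_separableSpace B)
  have := hDc.to_subtype
  -- the majorants
  have hmaj : ∀ ε : ℝ, 0 < ε → ∃ w : (ℤ → ℕ) → ℝ, Measurable w ∧ Integrable w P ∧
      ∫ y, w y ∂P < ε ∧ ∃ ρ > 0, ∃ K : ℕ, ∀ᵐ y ∂P, ∀ θ ∈ B, dist θ θ₀ < ρ → ∀ n ≥ K,
        |H θ (y 0) (cutPast n (pastPath y)) - H θ₀ (y 0) (pastPath y)| ≤ w y := by
    intro ε hε
    obtain ⟨w, hwm, hwi, hwε, s, hs, hw⟩ := exists_majorant (P := P) (ι := D × ℕ)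
      (l := (comap (Subtype.val : D → Param d) (𝓝[B] θ₀)) ×ˢ atTop)
      (H := fun q y => H q.1 (y 0) (cutPast q.2 (pastPath y)))
      (H₀ := fun y => H θ₀ (y 0) (pastPath y)) (G := fun y => G y + G y)
      (fun q => (hmeas q.1 (hDB q.1.2)).comp
        ((measurable_pi_apply 0).prodMk ((measurable_cutPast q.2).comp measurable_pastPath)))
      hm₀ (hG.add hG) (by
        filter_upwards [hcut, hfull] with y h1 h2 q
        exact (abs_sub _ _).trans (add_le_add (h1 q.1 (hDB q.1.2) q.2) h2))
      (by
        filter_upwards [hlim] with y hy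
        exact hy.comp (tendsto_comap.prodMap tendsto_id)) hε
    obtain ⟨s1, hs1, s2, hs2, hss⟩ := mem_prod_iff.1 hs
    obtain ⟨s3, hs3, hs31⟩ := mem_comap.1 hs1
    obtain ⟨ρ, hρ, hρs⟩ := Metric.mem_nhdsWithin_iff.1 hs3
    obtain ⟨K, hK⟩ := mem_atTop_sets.1 hs2
    refine ⟨w, hwm, hwi, hwε, ρ, hρ, K, ?_⟩
    filter_upwards [hw] with y hy θ hθ hθρ n hn
    refine forall_mem_of_dense (O := Metric.ball θ₀ ρ) Metric.isOpen_ball hDB hBD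
      (g := fun θ => |H θ (y 0) (cutPast n (pastPath y)) - H θ₀ (y 0) (pastPath y)|)
      ((hcont _ _).sub continuousOn_const).abs (fun x hx hxO => ?_) θ hθ hθρ
    exact hy (⟨x, hx⟩, n) (hss ⟨hs31 (hρs ⟨hxO, hDB hx⟩), hK n hn⟩)
  -- the averages of the majorants
  have hj : ∀ᵐ y ∂P, ∀ j : ℕ, ∃ ρ > 0, ∀ᶠ m : ℕ in atTop, ∀ θ ∈ B, dist θ θ₀ < ρ →
      |(m : ℝ)⁻¹ * ∑ t ∈ Finset.Icc 1 m, H θ (y t) (cutPast (t - 1) (pastPath (shiftPath t y)))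
        - (m : ℝ)⁻¹ * ∑ t ∈ Finset.Icc 1 m, H θ₀ (y t) (pastPath (shiftPath t y))|
        ≤ 1 / ((j : ℝ) + 1) + 1 / ((j : ℝ) + 1) := by
    refine ae_all_iff.2 fun j => ?_
    obtain ⟨w, hwm, hwi, hwε, ρ, hρ, K, hw⟩ := hmaj _ (Nat.one_div_pos_of_nat (α := ℝ) (n := j))
    have hw' : ∀ᵐ y ∂P, ∀ t : ℕ, ∀ θ ∈ B, dist θ θ₀ < ρ → ∀ n ≥ K,
        |H θ (y t) (cutPast n (pastPath (shiftPath t y))) - H θ₀ (y t) (pastPath (shiftPath t y))|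
          ≤ w (shiftPath t y) := ae_all_iff.2 fun t => by
      filter_upwards [hP.ae_shift (t : ℤ) hw] with y hy
      simpa [shiftPath] using hy
    have hc' : ∀ᵐ y ∂P, ∀ t : ℕ, ∀ θ ∈ B, ∀ n,
        |H θ (y t) (cutPast n (pastPath (shiftPath t y)))| ≤ G (shiftPath t y) :=
      ae_all_iff.2 fun t => by
        filter_upwards [hP.ae_shift (t : ℤ) hcut] with y hy
        simpa [shiftPath] using hy
    have hf' : ∀ᵐ y ∂P, ∀ t : ℕ,
        |H θ₀ (y t) (pastPath (shiftPath t y))| ≤ G (shiftPath t y) :=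
      ae_all_iff.2 fun t => by
        filter_upwards [hP.ae_shift (t : ℤ) hfull] with y hy
        simpa [shiftPath] using hy
    filter_upwards [hw', hc', hf', hP.ae_tendsto_avg hwm hwi] with y h1 h2 h3 h4
    refine ⟨ρ, hρ, ?_⟩
    -- For `t > K` the truncation length `t - 1` is at least `K` and the majorant applies. The first
    -- `K` terms are bounded crudely; their sum does not depend on `m` and disappears in the
    -- average.
    set R : ℝ := ∑ t ∈ Finset.Icc 1 K, (2 * G (shiftPath t y) + |w (shiftPath t y)|) with hR
    have hlimR : Tendsto (fun m : ℕ => (m : ℝ)⁻¹ * R) atTop (𝓝 0) := by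
      simpa using tendsto_inv_atTop_nhds_zero_nat.mul_const R
    filter_upwards [h4.eventually_lt_const hwε, hlimR.eventually_lt_const
      (Nat.one_div_pos_of_nat (α := ℝ) (n := j)), eventually_ge_atTop K] with m hm1 hm2 hm3 θ hθ hθρ
    rw [← mul_sub, ← Finset.sum_sub_distrib, abs_mul, abs_of_nonneg (by positivity : (0:ℝ) ≤ (m:ℝ)⁻¹)]
    have hterm : ∀ t ∈ Finset.Icc 1 m,
        |H θ (y t) (cutPast (t - 1) (pastPath (shiftPath t y)))
          - H θ₀ (y t) (pastPath (shiftPath t y))|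
        ≤ w (shiftPath t y) +
          if t ≤ K then 2 * G (shiftPath t y) + |w (shiftPath t y)| else 0 := by
      intro t ht
      split_ifs with htK
      · have := neg_abs_le (w (shiftPath t y))
        refine (abs_sub _ _).trans ?_
        linarith [h2 t θ hθ (t - 1), h3 t]
      · rw [add_zero]
        exact h1 t θ hθ hθρ (t - 1) (by lia)
    have hsumR : ∑ t ∈ Finset.Icc 1 m, (if t ≤ K then 2 * G (shiftPath t y) + |w (shiftPath t y)|
        else 0) = R := by
      rw [← Finset.sum_filter, hR]
      refine Finset.sum_congr ?_ fun _ _ => rfl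
      ext t
      simp only [Finset.mem_filter, Finset.mem_Icc]
      lia
    calc (m : ℝ)⁻¹ * |∑ t ∈ Finset.Icc 1 m,
            (H θ (y t) (cutPast (t - 1) (pastPath (shiftPath t y)))
            - H θ₀ (y t) (pastPath (shiftPath t y)))|
        ≤ (m : ℝ)⁻¹ * ∑ t ∈ Finset.Icc 1 m, (w (shiftPath t y) +
          if t ≤ K then 2 * G (shiftPath t y) + |w (shiftPath t y)| else 0) := by
          gcongr
          exact (Finset.abs_sum_le_sum_abs _ _).trans (Finset.sum_le_sum hterm)
      _ = (m : ℝ)⁻¹ * ∑ t ∈ Finset.Icc 1 m, w (shiftPath t y) + (m : ℝ)⁻¹ * R := by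
          rw [Finset.sum_add_distrib, hsumR, mul_add]
      _ ≤ _ := add_le_add hm1.le hm2.le
  filter_upwards [hj, hP.ae_tendsto_avg hm₀ hi₀] with y h1 h2 ε hε
  obtain ⟨j, hjε⟩ := exists_nat_one_div_lt (show 0 < ε / 3 by positivity)
  obtain ⟨ρ, hρ, hev⟩ := h1 j
  refine ⟨ρ, hρ, ?_⟩
  have h3 := (Metric.tendsto_nhds.1 h2) (ε / 3) (by positivity)
  filter_upwards [hev, h3] with m hm1 hm2 θ hθ hθρ
  have h4 := hm1 θ hθ hθρ
  rw [Real.dist_eq] at hm2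
  simp only [shiftPath, zero_add] at hm2 h4 ⊢
  rw [abs_le] at h4 ⊢
  rw [abs_lt] at hm2
  constructor <;> linarith [h4.1, h4.2, hm2.1, hm2.2]

/-! ### Processes and their laws on the path space -/

section PathLaw

variable {Ω : Type*} {d : ℕ} {f : Param d → (ℕ → ℕ) → ℝ}
  {θ : Param d} {Y : ℤ → Ω → ℕ}

/-- The trajectory of a process. -/
def trajectory {Ω : Type*} (Y : ℤ → Ω → ℕ) (ω : Ω) : ℤ → ℕ := fun t => Y t ω

/-- The law of a process on the path space. -/
def pathLaw {Ω : Type*} [MeasurableSpace Ω] (μ : Measure Ω) (Y : ℤ → Ω → ℕ) : Measure (ℤ → ℕ) :=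
  μ.map (trajectory Y)

theorem measurable_of_lt {s t : ℤ} (h : s < t) : Measurable[pastSigma Y t] (Y s) := by
  rw [measurable_iff_comap_le]
  exact le_iSup₂_of_le s h le_rfl

theorem measurable_past (t : ℤ) : Measurable[pastSigma Y t] (past Y t) :=
  @measurable_pi_lambda _ _ _ (pastSigma Y t) _ _ fun k =>
    measurable_of_lt (s := t - 1 - (k : ℤ)) (by lia)

variable [mΩ : MeasurableSpace Ω] {μ : Measure Ω}

theorem pastSigma_le (hY : ∀ t, Measurable (Y t)) (t : ℤ) : pastSigma Y t ≤ mΩ :=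
  iSup₂_le fun s _ => (hY s).comap_le

namespace IsODProcess

theorem measurable_trajectory (hY : IsODProcess μ f θ Y) : Measurable (trajectory Y) :=
  measurable_pi_lambda _ hY.measurable

theorem stationaryErgodic [IsProbabilityMeasure μ] (hY : IsODProcess μ f θ Y) :
    StationaryErgodic (pathLaw μ Y) :=
  ⟨Measure.isProbabilityMeasure_map hY.measurable_trajectory.aemeasurable, hY.ergodic⟩

theorem ae_path (hY : IsODProcess μ f θ Y) {q : (ℤ → ℕ) → Prop} (h : ∀ᵐ y ∂(pathLaw μ Y), q y) :
    ∀ᵐ ω ∂μ, q (trajectory Y ω) :=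
  ae_of_ae_map hY.measurable_trajectory.aemeasurable h

theorem integrable_path (hY : IsODProcess μ f θ Y) {g : (ℤ → ℕ) → ℝ}
    (hg : Integrable g (pathLaw μ Y)) : Integrable (fun ω => g (trajectory Y ω)) μ :=
  (integrable_map_measure hg.1 hY.measurable_trajectory.aemeasurable).1 hg

theorem integral_path (hY : IsODProcess μ f θ Y) {g : (ℤ → ℕ) → ℝ} (hg : Measurable g) :
    ∫ y, g y ∂(pathLaw μ Y) = ∫ ω, g (trajectory Y ω) ∂μ :=
  integral_map hY.measurable_trajectory.aemeasurable hg.aestronglyMeasurable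

theorem integrable_path_shift [IsProbabilityMeasure μ] (hY : IsODProcess μ f θ Y) (t : ℤ)
    {g : (ℤ → ℕ) → ℝ} (hg : Integrable g (pathLaw μ Y)) :
    Integrable (fun ω => g (shiftPath t (trajectory Y ω))) μ :=
  hY.integrable_path ((hY.stationaryErgodic.measurePreserving t).integrable_comp_of_integrable hg)

theorem integral_path_shift [IsProbabilityMeasure μ] (hY : IsODProcess μ f θ Y) (t : ℤ)
    {g : (ℤ → ℕ) → ℝ} (hg : Measurable g) :
    ∫ ω, g (shiftPath t (trajectory Y ω)) ∂μ = ∫ y, g y ∂(pathLaw μ Y) := by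
  have h := hY.integral_path (hg.comp (measurable_shiftPath t))
  simp only [Function.comp_apply] at h
  rw [← h, ← integral_map (measurable_shiftPath t).aemeasurable hg.aestronglyMeasurable,
    (hY.stationaryErgodic.measurePreserving t).map_eq]

/-- Functions of the past may be pulled out of the conditional expectation. -/
theorem integral_mul_eq [IsProbabilityMeasure μ] (hY : IsODProcess μ f θ Y) (t : ℤ) {W : Ω → ℝ}
    (hW : StronglyMeasurable[pastSigma Y t] W) (hYi : Integrable (fun ω => (Y t ω : ℝ)) μ)
    (hWY : Integrable (fun ω => W ω * (Y t ω : ℝ)) μ) :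
    Integrable (fun ω => W ω * f θ (past Y t ω)) μ ∧
      ∫ ω, W ω * (Y t ω : ℝ) ∂μ = ∫ ω, W ω * f θ (past Y t ω) ∂μ := by
  have hm := pastSigma_le hY.measurable t
  have h1 : μ[fun ω => W ω * (Y t ω : ℝ) | pastSigma Y t] =ᵐ[μ]
      fun ω => W ω * f θ (past Y t ω) := by
    refine (condExp_mul_of_stronglyMeasurable_left hW hWY hYi).trans ?_
    filter_upwards [hY.condExp_eq t] with ω hω
    rw [Pi.mul_apply, hω]
  refine ⟨integrable_condExp.congr h1, ?_⟩
  rw [← integral_congr_ae h1, integral_condExp hm]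

end IsODProcess

end PathLaw

/-! ### Moments of the envelope -/

section Moments

variable {P : Measure (ℤ → ℕ)} {A : ℕ → ℝ} {C p : ℝ}

/-- The envelope has a moment of an order between `3` and `4`. -/
structure EnvelopeMoment (P : Measure (ℤ → ℕ)) (C : ℝ) (A : ℕ → ℝ) (p : ℝ) : Prop where
  stationary : StationaryErgodic P
  one_le : 1 ≤ C
  nonneg : ∀ k, 0 ≤ A k
  summable : Summable A
  three_lt : 3 < p
  le_four : p ≤ 4
  integrable : Integrable (fun y => envelope C A y ^ p) P

namespace EnvelopeMoment

theorem one_le_envelope (h : EnvelopeMoment P C A p) (y : ℤ → ℕ) : 1 ≤ envelope C A y :=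
  h.one_le.trans (le_envelope h.nonneg y)

theorem envelope_nonneg (h : EnvelopeMoment P C A p) (y : ℤ → ℕ) : 0 ≤ envelope C A y :=
  zero_le_one.trans (h.one_le_envelope y)

theorem measurable (h : EnvelopeMoment P C A p) : Measurable (envelope C A) :=
  measurable_envelope h.nonneg

theorem coord_le (h : EnvelopeMoment P C A p) (y : ℤ → ℕ) : (y 0 : ℝ) ≤ envelope C A y :=
  coord_le_envelope (zero_le_one.trans h.one_le) h.nonneg y

theorem lag_le (y : ℤ → ℕ) : C + lagSum A (pastPath y) ≤ envelope C A y := by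
  have : (0 : ℝ) ≤ y 0 := Nat.cast_nonneg _
  unfold envelope
  linarith

theorem integrable_pow (h : EnvelopeMoment P C A p) {j : ℕ} (hj : j ≤ 3) :
    Integrable (fun y => envelope C A y ^ j) P := by
  refine h.integrable.mono' (h.measurable.pow_const j).aestronglyMeasurable
    (Eventually.of_forall fun y => ?_)
  rw [Real.norm_of_nonneg (pow_nonneg (h.envelope_nonneg y) j), ← Real.rpow_natCast]
  refine Real.rpow_le_rpow_of_exponent_le (h.one_le_envelope y) ?_
  have h1 : (j : ℝ) ≤ 3 := by exact_mod_cast hj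
  linarith [h.three_lt]

theorem integrable_coord (h : EnvelopeMoment P C A p) :
    Integrable (fun y : ℤ → ℕ => (y 0 : ℝ)) P := by
  refine (h.integrable_pow (j := 1) (by norm_num)).mono' (measurable_coord 0).aestronglyMeasurable
    (Eventually.of_forall fun y => ?_)
  rw [Real.norm_of_nonneg (Nat.cast_nonneg _), pow_one]
  exact h.coord_le y

theorem ae_lagSummable (h : EnvelopeMoment P C A p) :
    ∀ᵐ y ∂P, ∀ t : ℤ, LagSummable A (pastPath (shiftPath t y)) :=
  ae_forall_lagSummable h.stationary h.nonneg h.summable h.integrable_coord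

theorem ae_lagSummable_zero (h : EnvelopeMoment P C A p) : ∀ᵐ y ∂P, LagSummable A (pastPath y) := by
  filter_upwards [h.ae_lagSummable] with y hy
  simpa [shiftPath] using hy 0

end EnvelopeMoment

theorem exists_envelopeMoment {Ω : Type*} [MeasurableSpace Ω] {μ : Measure Ω}
    [IsProbabilityMeasure μ] {d : ℕ} {f : Param d → (ℕ → ℕ) → ℝ} {θ : Param d} {Y : ℤ → Ω → ℕ}
    (hY : IsODProcess μ f θ Y)
    (hm : ∃ B : ℝ≥0, ∃ ε : ℝ, 2 < ε ∧ ∀ t, ∫⁻ ω, (Y t ω : ℝ≥0∞) ^ (1 + ε) ∂μ < B)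
    (hC : 1 ≤ C) (hA : ∀ k, 0 ≤ A k) (hAs : Summable A) :
    ∃ p, EnvelopeMoment (pathLaw μ Y) C A p := by
  obtain ⟨B, ε, hε, hB⟩ := hm
  refine ⟨min (1 + ε) 4, hY.stationaryErgodic, hC, hA, hAs, lt_min (by linarith) (by norm_num),
    min_le_right _ _, ?_⟩
  have h3 : 3 < min (1 + ε) 4 := lt_min (by linarith) (by norm_num)
  refine integrable_envelope_rpow hY.stationaryErgodic (by linarith) hA hAs
    (by linarith) ?_
  have hmeas : Measurable fun y : ℤ → ℕ => (y 0 : ℝ≥0∞) ^ min (1 + ε) 4 :=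
    ((measurable_from_top (f := fun n : ℕ => (n : ℝ≥0∞))).comp (measurable_pi_apply 0)).pow_const _
  rw [pathLaw, lintegral_map hmeas hY.measurable_trajectory]
  refine (lintegral_mono fun ω => ?_).trans_lt ((hB 0).trans ENNReal.coe_lt_top)
  change (Y 0 ω : ℝ≥0∞) ^ min (1 + ε) 4 ≤ (Y 0 ω : ℝ≥0∞) ^ (1 + ε)
  -- A natural number is `0` or at least `1`, and in both cases the larger exponent gives the larger
  -- power.
  rcases Nat.eq_zero_or_pos (Y 0 ω) with h0 | h0
  · rw [h0, Nat.cast_zero, ENNReal.zero_rpow_of_pos (by linarith)]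
    exact zero_le
  · exact ENNReal.rpow_le_rpow_of_exponent_le (by exact_mod_cast h0) (min_le_left _ _)

end Moments

/-! ### The contrast function -/

/-- The contribution of one observation to the Poisson quasi-log-likelihood. -/
def qll {d : ℕ} (f : Param d → (ℕ → ℕ) → ℝ) (θ : Param d) (k : ℕ) (p : ℕ → ℕ) : ℝ :=
  (k : ℝ) * Real.log (f θ p) - f θ p

section Contrast

variable {d : ℕ} {Θ : Set (Param d)} {f : Param d → (ℕ → ℕ) → ℝ} {c C p : ℝ} {a A : ℕ → ℝ}
  {θ : Param d} {P : Measure (ℤ → ℕ)}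

theorem measurable_pair : Measurable fun y : ℤ → ℕ => (y 0, pastPath y) :=
  (measurable_pi_apply 0).prodMk measurable_pastPath

theorem ModelBounds.measurable_qll (hM : ModelBounds Θ f c C a A) (hθ : θ ∈ Θ) :
    Measurable fun q : ℕ × (ℕ → ℕ) => qll f θ q.1 q.2 := by
  have h : Measurable fun q : ℕ × (ℕ → ℕ) => f θ q.2 := (hM.measurable θ hθ).comp measurable_snd
  exact (((measurable_from_top (f := fun n : ℕ => (n : ℝ))).comp measurable_fst).mul h.log).sub h

theorem ModelBounds.continuousOn_qll (hM : ModelBounds Θ f c C a A) (k : ℕ) (p : ℕ → ℕ) :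
    ContinuousOn (fun θ => qll f θ k p) Θ :=
  (continuousOn_const.mul ((hM.continuousOn p).log fun _ hθ => (hM.pos hθ p).ne')).sub
    (hM.continuousOn p)

theorem ModelBounds.abs_log_le (hM : ModelBounds Θ f c C a A) (hθ : θ ∈ Θ) {p : ℕ → ℕ} {z : ℝ}
    (hz : |f θ p| ≤ z) : |Real.log (f θ p)| ≤ z + |Real.log c| := by
  have h1 := hM.lower θ hθ p
  have h2 := hM.pos hθ p
  rw [abs_of_pos h2] at hz
  have h3 := Real.log_le_log hM.c_pos h1
  have h4 := Real.log_le_self h2.le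
  have h5 := neg_abs_le (Real.log c)
  have h6 := abs_nonneg (Real.log c)
  rw [_root_.abs_le]
  constructor <;> linarith

theorem ModelBounds.abs_qll_le (hM : ModelBounds Θ f c C a A) (hθ : θ ∈ Θ) {y : ℤ → ℕ}
    (hy : LagSummable A (pastPath y)) :
    |qll f θ (y 0) (pastPath y)| ≤ (2 + |Real.log c|) * envelope C A y ^ 2 := by
  set Z := envelope C A y
  have hZ1 : 1 ≤ Z := hM.one_le_C.trans (le_envelope hM.A_nonneg y)
  have hf : |f θ (pastPath y)| ≤ Z := (hM.abs_le hθ hy).trans (EnvelopeMoment.lag_le y)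
  have hl := hM.abs_log_le hθ hf
  have hy0 : (y 0 : ℝ) ≤ Z := coord_le_envelope (zero_le_one.trans hM.one_le_C) hM.A_nonneg y
  have hy1 : (0 : ℝ) ≤ y 0 := Nat.cast_nonneg _
  unfold qll
  refine (abs_sub _ _).trans ?_
  rw [abs_mul, abs_of_nonneg hy1]
  have h1 : (y 0 : ℝ) * |Real.log (f θ (pastPath y))| ≤ Z * (Z + |Real.log c|) := by gcongr
  have h2 := abs_nonneg (Real.log c)
  nlinarith [mul_nonneg h2 (mul_nonneg (zero_le_one.trans hZ1) (sub_nonneg.2 hZ1)),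
    mul_nonneg (zero_le_one.trans hZ1) (sub_nonneg.2 hZ1)]

theorem ModelBounds.integrable_qll (hM : ModelBounds Θ f c C a A) (hE : EnvelopeMoment P C A p)
    (hθ : θ ∈ Θ) : Integrable (fun y => qll f θ (y 0) (pastPath y)) P := by
  refine ((hE.integrable_pow (j := 2) (by norm_num)).const_mul (2 + |Real.log c|)).mono'
    ((hM.measurable_qll hθ).comp measurable_pair).aestronglyMeasurable ?_
  filter_upwards [hE.ae_lagSummable_zero] with y hy
  exact hM.abs_qll_le hθ hy

/-- The true parameter is the strict maximizer of the expected quasi-log-likelihood. -/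
theorem integral_qll_sub_neg {Ω : Type*} [MeasurableSpace Ω] {μ : Measure Ω}
    [IsProbabilityMeasure μ] {Y : ℤ → Ω → ℕ} {θ₀ : Param d} (hM : ModelBounds Θ f c C a A)
    (hY : IsODProcess μ f θ₀ Y) (hE : EnvelopeMoment (pathLaw μ Y) C A p)
    (hid : ∀ θ₁ ∈ Θ, ∀ θ₂ ∈ Θ,
      (∃ t : ℕ, ∀ᵐ ω ∂μ, f θ₁ (past Y t ω) = f θ₂ (past Y t ω)) → θ₁ = θ₂)
    (hθ₀ : θ₀ ∈ Θ) (hθ : θ ∈ Θ) (hne : θ ≠ θ₀) :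
    ∫ y, (qll f θ (y 0) (pastPath y) - qll f θ₀ (y 0) (pastPath y)) ∂(pathLaw μ Y) < 0 := by
  have hpast : ∀ ω, pastPath (trajectory Y ω) = past Y 0 ω := fun ω => by
    rw [past_eq_pastPath, shiftPath_zero]
    rfl
  have hqm : Measurable fun y : ℤ → ℕ =>
      qll f θ (y 0) (pastPath y) - qll f θ₀ (y 0) (pastPath y) :=
    ((hM.measurable_qll hθ).comp measurable_pair).sub ((hM.measurable_qll hθ₀).comp measurable_pair)
  have hqi := (hM.integrable_qll hE hθ).sub (hM.integrable_qll hE hθ₀)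
  rw [hY.integral_path hqm]
  set W : Ω → ℝ := fun ω => Real.log (f θ (past Y 0 ω)) - Real.log (f θ₀ (past Y 0 ω)) with hW
  have hfm : ∀ θ' ∈ Θ, Measurable[pastSigma Y 0] fun ω => f θ' (past Y 0 ω) := fun θ' hθ' =>
    (hM.measurable θ' hθ').comp (measurable_past 0)
  have hWm : StronglyMeasurable[pastSigma Y 0] W :=
    ((hfm θ hθ).log.sub (hfm θ₀ hθ₀).log).stronglyMeasurable
  have hle := pastSigma_le hY.measurable 0
  have hYi : Integrable (fun ω => (Y 0 ω : ℝ)) μ := hY.integrable_path hE.integrable_coord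
  have hfi : ∀ θ' ∈ Θ, Integrable (fun ω => f θ' (past Y 0 ω)) μ := fun θ' hθ' => by
    refine (hY.integrable_path (hE.integrable_pow (j := 1) (by norm_num))).mono'
      ((hfm θ' hθ').mono hle le_rfl).aestronglyMeasurable ?_
    filter_upwards [hY.ae_path hE.ae_lagSummable_zero] with ω hω
    rw [hpast] at hω
    refine (hM.abs_le hθ' hω).trans ?_
    rw [← hpast, pow_one]
    exact EnvelopeMoment.lag_le _
  have hqi' : Integrable (fun ω => qll f θ (Y 0 ω) (past Y 0 ω) - qll f θ₀ (Y 0 ω) (past Y 0 ω)) μ := by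
    have := hY.integrable_path hqi
    refine this.congr (Eventually.of_forall fun ω => ?_)
    simp only [Pi.sub_apply, hpast]
    rfl
  -- Integrability of the product is read off from the log-likelihood difference, which equals `W ·
  -- Y` minus a difference of intensities.
  have hWY : Integrable (fun ω => W ω * (Y 0 ω : ℝ)) μ := by
    refine (hqi'.add ((hfi θ hθ).sub (hfi θ₀ hθ₀))).congr (Eventually.of_forall fun ω => ?_)
    simp only [Pi.add_apply, Pi.sub_apply, qll, hW]
    ring
  obtain ⟨hi, heq⟩ := hY.integral_mul_eq 0 hWm hYi hWY
  -- After `Y 0` is replaced by its conditional mean `v`, minus the log-likelihood ratio becomes `v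
  -- (u/v - 1 - log (u/v))`. This is nonnegative and vanishes only for `u = v`.
  set D : Ω → ℝ := fun ω => (f θ (past Y 0 ω) - f θ₀ (past Y 0 ω)) - W ω * f θ₀ (past Y 0 ω) with hD
  have hDi : Integrable D μ := ((hfi θ hθ).sub (hfi θ₀ hθ₀)).sub hi
  have hD0 : ∀ ω, 0 ≤ D ω ∧ (D ω = 0 → f θ (past Y 0 ω) = f θ₀ (past Y 0 ω)) := by
    intro ω
    have h1 := hM.pos hθ (past Y 0 ω)
    have h2 := hM.pos hθ₀ (past Y 0 ω)
    set u := f θ (past Y 0 ω)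
    set v := f θ₀ (past Y 0 ω)
    have hWu : W ω = Real.log (u / v) := (Real.log_div h1.ne' h2.ne').symm
    have h3 : D ω = v * ((u / v - 1) - Real.log (u / v)) := by
      simp only [hD, hWu]
      field_simp
      rfl
    refine ⟨?_, fun h0 => ?_⟩
    · rw [h3]
      exact mul_nonneg h2.le (sub_nonneg.2 (Real.log_le_sub_one_of_pos (div_pos h1 h2)))
    · by_contra hne'
      have h4 : u / v ≠ 1 := fun h => hne' ((div_eq_one_iff_eq h2.ne').1 h)
      have h5 := Real.log_lt_sub_one_of_pos (div_pos h1 h2) h4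
      have h6 := mul_pos h2 (sub_pos.2 h5)
      rw [← h3, h0] at h6
      exact lt_irrefl _ h6
  have hint : ∫ ω, (qll f θ (trajectory Y ω 0) (pastPath (trajectory Y ω))
      - qll f θ₀ (trajectory Y ω 0) (pastPath (trajectory Y ω))) ∂μ = -∫ ω, D ω ∂μ := by
    have h1 : ∀ ω, qll f θ (trajectory Y ω 0) (pastPath (trajectory Y ω))
        - qll f θ₀ (trajectory Y ω 0) (pastPath (trajectory Y ω))
        = W ω * (Y 0 ω : ℝ) - (f θ (past Y 0 ω) - f θ₀ (past Y 0 ω)) := fun ω => by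
      simp only [hpast, qll, hW, trajectory]
      ring
    simp_rw [h1]
    have hdi : Integrable (fun ω => f θ (past Y 0 ω) - f θ₀ (past Y 0 ω)) μ :=
      (hfi θ hθ).sub (hfi θ₀ hθ₀)
    rw [integral_sub hWY hdi, heq, hD, integral_sub hdi hi]
    ring
  refine lt_of_eq_of_lt hint ?_
  rw [neg_lt_zero]
  refine lt_of_le_of_ne (integral_nonneg fun ω => (hD0 ω).1) fun h0 => hne ?_
  have h1 := (integral_eq_zero_iff_of_nonneg (fun ω => (hD0 ω).1) hDi).1 h0.symm
  refine hid θ hθ θ₀ hθ₀ ⟨0, ?_⟩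
  filter_upwards [h1] with ω hω
  exact (hD0 ω).2 hω

/-- Away from the true parameter, the quasi-log-likelihood ratios are bounded by finitely many
functions with negative integrals. -/
theorem exists_finite_majorants {θ₀ : Param d} (hM : ModelBounds Θ f c C a A)
    (hE : EnvelopeMoment P C A p) (hθ₀ : θ₀ ∈ Θ)
    (hneg : ∀ θ ∈ Θ, θ ≠ θ₀ →
      ∫ y, (qll f θ (y 0) (pastPath y) - qll f θ₀ (y 0) (pastPath y)) ∂P < 0)
    {ρ : ℝ} (hρ : 0 < ρ) :
    ∃ κ > 0, ∃ (F : Finset (Param d)) (h : Param d → (ℤ → ℕ) → ℝ) (sel : Param d → Param d),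
      (∀ z ∈ F, Measurable (h z) ∧ Integrable (h z) P ∧ ∫ y, h z y ∂P < -κ) ∧
      (∀ θ ∈ Θ, ρ ≤ dist θ θ₀ → sel θ ∈ F) ∧
      ∀ᵐ y ∂P, ∀ θ ∈ Θ, ρ ≤ dist θ θ₀ →
        qll f θ (y 0) (pastPath y) - qll f θ₀ (y 0) (pastPath y) ≤ h (sel θ) y := by
  set L : Set (Param d) := Θ \ Metric.ball θ₀ ρ with hL
  have hLc : IsCompact L := hM.compact.diff Metric.isOpen_ball
  obtain ⟨D, hDB, hDc, hBD⟩ := TopologicalSpace.IsSeparable.exists_countable_dense_subset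
    (TopologicalSpace.IsSeparable.of_separableSpace Θ)
  have := hDc.to_subtype
  -- Wald's argument: near `z`, the ratio is at most its value at `z` plus a majorant whose integral
  -- is smaller than the margin `δ` by which the expected ratio at `z` is negative. Compactness then
  -- leaves finitely many such neighbourhoods.
  have hloc : ∀ z : Param d, z ∈ L → ∃ (h : (ℤ → ℕ) → ℝ) (r : ℝ), 0 < r ∧ Measurable h ∧
      Integrable h P ∧ ∫ y, h y ∂P < 0 ∧ ∀ᵐ y ∂P, ∀ θ ∈ Θ, dist θ z < r →
        qll f θ (y 0) (pastPath y) - qll f θ₀ (y 0) (pastPath y) ≤ h y := by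
    intro z hz
    have hne : z ≠ θ₀ := by
      rintro rfl
      exact hz.2 (Metric.mem_ball_self hρ)
    have hn := hneg z hz.1 hne
    set δ := -∫ y, (qll f z (y 0) (pastPath y) - qll f θ₀ (y 0) (pastPath y)) ∂P with hδ
    obtain ⟨w, hwm, hwi, hwε, s, hs, hw⟩ := exists_majorant (P := P) (ι := D)
      (l := comap (Subtype.val : D → Param d) (𝓝[Θ] z))
      (H := fun q y => qll f q (y 0) (pastPath y)) (H₀ := fun y => qll f z (y 0) (pastPath y))
      (G := fun y => (2 + |Real.log c|) * envelope C A y ^ 2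
        + (2 + |Real.log c|) * envelope C A y ^ 2)
      (fun q => (hM.measurable_qll (hDB q.2)).comp measurable_pair)
      ((hM.measurable_qll hz.1).comp measurable_pair)
      (((hE.integrable_pow (j := 2) (by norm_num)).const_mul _).add
        ((hE.integrable_pow (j := 2) (by norm_num)).const_mul _))
      (by
        filter_upwards [hE.ae_lagSummable_zero] with y hy q
        exact (abs_sub _ _).trans (add_le_add (hM.abs_qll_le (hDB q.2) hy)
          (hM.abs_qll_le hz.1 hy)))
      (Eventually.of_forall fun y =>
        ((hM.continuousOn_qll (y 0) (pastPath y)) z hz.1).tendsto.comp tendsto_comap)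
      (show 0 < δ by linarith)
    obtain ⟨s3, hs3, hs31⟩ := mem_comap.1 hs
    obtain ⟨r, hr, hrs⟩ := Metric.mem_nhdsWithin_iff.1 hs3
    have hqi : Integrable (fun y : ℤ → ℕ =>
        qll f z (y 0) (pastPath y) - qll f θ₀ (y 0) (pastPath y)) P :=
      (hM.integrable_qll hE hz.1).sub (hM.integrable_qll hE hθ₀)
    refine ⟨fun y => (qll f z (y 0) (pastPath y) - qll f θ₀ (y 0) (pastPath y)) + w y, r, hr,
      (((hM.measurable_qll hz.1).comp measurable_pair).sub
        ((hM.measurable_qll hθ₀).comp measurable_pair)).add hwm, hqi.add hwi, ?_, ?_⟩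
    · rw [integral_add hqi hwi]
      linarith
    · filter_upwards [hw] with y hy θ hθ hθr
      have h1 := forall_mem_of_dense (O := Metric.ball z r) Metric.isOpen_ball hDB hBD
        (g := fun θ => |qll f θ (y 0) (pastPath y) - qll f z (y 0) (pastPath y)|)
        ((hM.continuousOn_qll _ _).sub continuousOn_const).abs (r := w y)
        (fun x hx hxO => hy ⟨x, hx⟩ (hs31 (hrs ⟨hxO, hDB hx⟩))) θ hθ hθr
      have h2 := (le_abs_self _).trans h1
      linarith
  choose! h r hr hhm hhi hhneg hh using hloc
  obtain ⟨F, hFL, hF⟩ := hLc.elim_nhds_subcover (fun z => Metric.ball z (r z))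
    fun z hz => Metric.ball_mem_nhds z (hr z hz)
  -- The centre of a neighbourhood in the finite subcover containing `θ`; outside of `L` its value
  -- is irrelevant.
  have hsel : ∀ θ : Param d, ∃ z, θ ∈ L → z ∈ F ∧ dist θ z < r z := by
    intro θ
    by_cases hθ : θ ∈ L
    · obtain ⟨z, hz, hz'⟩ := Set.mem_iUnion₂.1 (hF hθ)
      exact ⟨z, fun _ => ⟨hz, hz'⟩⟩
    · exact ⟨θ, fun hc => absurd hc hθ⟩
  choose sel hsel using hsel
  have hmemL : ∀ θ ∈ Θ, ρ ≤ dist θ θ₀ → θ ∈ L := fun θ hθ hd =>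
    ⟨hθ, fun hb => not_lt.2 hd hb⟩
  have hκ : ∃ κ > 0, ∀ z ∈ F, ∫ y, h z y ∂P < -κ := by
    rcases F.eq_empty_or_nonempty with rfl | hne
    · exact ⟨1, one_pos, by simp⟩
    · obtain ⟨z₀, hz₀, hmax⟩ := F.exists_max_image (fun z => ∫ y, h z y ∂P) hne
      have h0 := hhneg z₀ (hFL z₀ hz₀)
      exact ⟨-(∫ y, h z₀ y ∂P) / 2, by linarith, fun z hz => by linarith [hmax z hz]⟩
  obtain ⟨κ, hκ0, hκ⟩ := hκ
  refine ⟨κ, hκ0, F, h, sel, fun z hz => ⟨hhm z (hFL z hz), hhi z (hFL z hz), hκ z hz⟩,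
    fun θ hθ hd => (hsel θ (hmemL θ hθ hd)).1, ?_⟩
  have hall : ∀ᵐ y ∂P, ∀ z ∈ F, ∀ θ ∈ Θ, dist θ z < r z →
      qll f θ (y 0) (pastPath y) - qll f θ₀ (y 0) (pastPath y) ≤ h z y :=
    (Finset.eventually_all F).2 fun z hz => hh z (hFL z hz)
  filter_upwards [hall] with y hy θ hθ hd
  exact hy (sel θ) (hsel θ (hmemL θ hθ hd)).1 θ hθ (hsel θ (hmemL θ hθ hd)).2

end Contrast

/-! ### Consistency of the estimates -/

section Deterministic

variable {d : ℕ} {Θ : Set (Param d)} {f : Param d → (ℕ → ℕ) → ℝ} {c C : ℝ} {a A : ℕ → ℝ}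
  {θ : Param d}

theorem abs_log_sub_log_le {c u v : ℝ} (hc : 0 < c) (hu : c ≤ u) (hv : c ≤ v) :
    |Real.log u - Real.log v| ≤ |u - v| / c := by
  have key : ∀ u v : ℝ, c ≤ u → c ≤ v → Real.log u - Real.log v ≤ |u - v| / c := by
    intro u v hu hv
    have hu0 := hc.trans_le hu
    have hv0 := hc.trans_le hv
    rw [← Real.log_div hu0.ne' hv0.ne']
    calc Real.log (u / v) ≤ u / v - 1 := Real.log_le_sub_one_of_pos (div_pos hu0 hv0)
      _ = (u - v) / v := by field_simp
      _ ≤ |u - v| / v := by gcongr; exact le_abs_self _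
      _ ≤ |u - v| / c := by gcongr
  rw [abs_le]
  constructor
  · have := key v u hv hu
    rw [abs_sub_comm] at this
    linarith
  · exact key u v hu hv

theorem ModelBounds.abs_qll_sub_le (hM : ModelBounds Θ f c C a A) (hθ : θ ∈ Θ) (k : ℕ)
    (p p' : ℕ → ℕ) :
    |qll f θ k p - qll f θ k p'| ≤ ((k : ℝ) / c + 1) * |f θ p - f θ p'| := by
  have h := abs_log_sub_log_le hM.c_pos (hM.lower θ hθ p) (hM.lower θ hθ p')
  have he : qll f θ k p - qll f θ k p'
      = (k : ℝ) * (Real.log (f θ p) - Real.log (f θ p')) - (f θ p - f θ p') := by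
    unfold qll
    ring
  rw [he]
  refine (abs_sub _ _).trans ?_
  rw [abs_mul, abs_of_nonneg (Nat.cast_nonneg k)]
  have := mul_le_mul_of_nonneg_left h (Nat.cast_nonneg (α := ℝ) k)
  calc _ ≤ (k : ℝ) * (|f θ p - f θ p'| / c) + |f θ p - f θ p'| := by linarith
    _ = _ := by ring

/-- A maximizer of the quasi-log-likelihood has nonnegative quasi-log-likelihood ratio. -/
theorem IsPQMLE.sum_nonneg (hM : ModelBounds Θ f c C a A) {x : ℕ → ℕ} {l k : ℕ}
    (h : IsPQMLE Θ f x l k θ) {θ₀ : Param d} (hθ₀ : θ₀ ∈ Θ) {p : ℕ → ℕ → ℕ} {g e : ℕ → ℝ}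
    (he : ∀ t ∈ Finset.Icc l k, ∀ θ ∈ Θ, |f θ (truncPast x t) - f θ (p t)| ≤ e t)
    (hg : ∀ t ∈ Finset.Icc l k, qll f θ (x t) (p t) - qll f θ₀ (x t) (p t) ≤ g t) :
    0 ≤ ∑ t ∈ Finset.Icc l k, (g t + 2 * ((((x t : ℕ) : ℝ) / c + 1) * e t)) := by
  have h1 := h.2 θ₀ hθ₀
  have h2 : 0 ≤ ∑ t ∈ Finset.Icc l k,
      (qll f θ (x t) (truncPast x t) - qll f θ₀ (x t) (truncPast x t)) := by
    rw [Finset.sum_sub_distrib, sub_nonneg]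
    exact h1
  refine h2.trans (Finset.sum_le_sum fun t ht => ?_)
  have hx : (0 : ℝ) ≤ ((x t : ℕ) : ℝ) / c + 1 := by
    have := hM.c_pos
    positivity
  -- Replacing the past costs one error at `θ` and one at `θ₀`, whence the factor `2`.
  have h3 := (hM.abs_qll_sub_le h.1 (x t) (truncPast x t) (p t)).trans
    (mul_le_mul_of_nonneg_left (he t ht θ h.1) hx)
  have h4 := (hM.abs_qll_sub_le hθ₀ (x t) (truncPast x t) (p t)).trans
    (mul_le_mul_of_nonneg_left (he t ht θ₀ hθ₀) hx)
  have h5 := hg t ht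
  rw [_root_.abs_le] at h3 h4
  linarith [h3.2, h4.1]

/-- At time `t` exactly `t - 1` lags have been observed. -/
theorem truncPast_eq_cutPast {x : ℕ → ℕ} {y : ℤ → ℕ} {m : ℕ}
    (hx : ∀ t ∈ Finset.Icc 1 m, x t = y t) {t : ℕ} (ht : t ∈ Finset.Icc 1 m) :
    truncPast x t = cutPast (t - 1) (pastPath (shiftPath t y)) := by
  rw [Finset.mem_Icc] at ht
  funext k
  unfold truncPast cutPast pastPath shiftPath
  by_cases hk : k + 1 < t
  · rw [if_pos hk, if_pos (by lia), hx _ (by rw [Finset.mem_Icc]; lia)]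
    congr 1
    lia
  · rw [if_neg hk, if_neg (by lia)]

end Deterministic

/-! ### Rates of decay -/

section Decay

variable {P : Measure (ℤ → ℕ)} {a A : ℕ → ℝ} {C p R γ : ℝ}

/-- The coefficients `a` decay at a polynomial rate of order larger than `3 / 2`. -/
structure PolyDecay (a : ℕ → ℝ) (R γ : ℝ) : Prop where
  nonneg : ∀ k, 0 ≤ a k
  lt : 3 / 2 < γ
  le : ∀ k : ℕ, a k ≤ R * ((k : ℝ) + 1) ^ (-γ)

/-- Passing from `k` to `k + 1` gives a comparison sequence which is positive for every `k`; at `k =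
0` the power `k ^ (-γ)` has the value `0`, which would be useless as a bound. -/
theorem exists_polyDecay (ha : ∀ k, 0 ≤ a k) (hγ : 3 / 2 < γ)
    (h : a =O[atTop] fun k : ℕ => (k : ℝ) ^ (-γ)) : ∃ R, PolyDecay a R γ := by
  have h1 : (fun k : ℕ => (k : ℝ) ^ (-γ)) =O[atTop] fun k : ℕ => ((k : ℝ) + 1) ^ (-γ) := by
    refine Asymptotics.IsBigO.of_bound (2 ^ γ) ?_
    filter_upwards [eventually_ge_atTop 1] with k hk
    have hk' : (1 : ℝ) ≤ k := by exact_mod_cast hk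
    have hk0 : (0 : ℝ) < k := by linarith
    rw [Real.norm_of_nonneg (by positivity), Real.norm_of_nonneg (by positivity),
      Real.rpow_neg (by positivity), Real.rpow_neg (by positivity), ← div_eq_mul_inv,
      le_div_iff₀ (by positivity), inv_mul_le_iff₀ (by positivity),
      ← Real.mul_rpow (by positivity) (by positivity)]
    exact Real.rpow_le_rpow (by positivity) (by linarith) (by linarith)
  obtain ⟨R, -, hR⟩ := Asymptotics.bound_of_isBigO_nat_atTop (h.trans h1)
  refine ⟨R, ha, hγ, fun k => ?_⟩
  have h2 : (0 : ℝ) < ((k : ℝ) + 1) ^ (-γ) := by positivity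
  have := hR h2.ne'
  rwa [Real.norm_of_nonneg (ha k), Real.norm_of_nonneg h2.le] at this

theorem PolyDecay.R_nonneg (h : PolyDecay a R γ) : 0 ≤ R := by
  have := (h.nonneg 0).trans (h.le 0)
  simpa using this

/-- Since `n + i` is at least `n` and at least `i + 1`, the decay `(n + i)^(-γ)` can be shared
between the two variables in any proportion. -/
theorem PolyDecay.le_mul (h : PolyDecay a R γ) {b₁ b₂ : ℝ} (hb₁ : 0 ≤ b₁) (hb₂ : 0 ≤ b₂)
    (hb : b₁ + b₂ = γ) {n : ℕ} (hn : 1 ≤ n) (i : ℕ) :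
    a (n - 1 + i) ≤ R * (n : ℝ) ^ (-b₁) * ((i : ℝ) + 1) ^ (-b₂) := by
  refine (h.le _).trans ?_
  have h1 : ((n - 1 + i : ℕ) : ℝ) + 1 = n + i := by
    push_cast [Nat.cast_sub hn]
    ring
  have hn' : (1 : ℝ) ≤ n := by exact_mod_cast hn
  have hn0 : (0 : ℝ) < n := by linarith
  have hi : (0 : ℝ) ≤ i := Nat.cast_nonneg i
  rw [h1, mul_assoc, ← hb, neg_add, Real.rpow_add (by positivity)]
  refine mul_le_mul_of_nonneg_left (mul_le_mul ?_ ?_ (by positivity) (by positivity)) h.R_nonneg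
  · exact Real.rpow_le_rpow_of_nonpos hn0 (by linarith) (by linarith)
  · exact Real.rpow_le_rpow_of_nonpos (by positivity) (by linarith) (by linarith)

theorem summable_rpow_succ {σ : ℝ} (hσ : 1 < σ) :
    Summable fun i : ℕ => ((i : ℝ) + 1) ^ (-σ) := by
  have := (summable_nat_add_iff 1).2 (Real.summable_nat_rpow.2 (by linarith : -σ < -1))
  simpa using this

theorem pastPath_shiftPath_add {t : ℕ} (ht : 1 ≤ t) (i : ℕ) (y : ℤ → ℕ) :
    pastPath (shiftPath t y) (t - 1 + i) = y (-(i : ℤ)) := by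
  unfold pastPath shiftPath
  congr 1
  lia

/-- The influence of the observations before time `1` decays polynomially. -/
theorem PolyDecay.ae_tailSum_le (h : PolyDecay a R γ) (hP : StationaryErgodic P)
    (hm : Integrable (fun y : ℤ → ℕ => (y 0 : ℝ)) P) :
    ∀ᵐ y ∂P, ∃ K ≥ 0, ∀ t : ℕ, 1 ≤ t →
      tailSum a (t - 1) (pastPath (shiftPath t y)) ≤ K * (t : ℝ) ^ (-(γ / 2 - 1 / 4)) := by
  have hγ := h.lt
  -- The split `γ = (γ/2 - 1/4) + (γ/2 + 1/4)` leaves a power of `t` of order above `1/2` and a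
  -- power of `i` of order above `1`, which is summable.
  have hs := summable_rpow_succ (show 1 < γ / 2 + 1 / 4 by linarith)
  filter_upwards [hP.ae_summable_weighted (measurable_coord 0) hm (fun y => Nat.cast_nonneg _)
    (fun i => by positivity) hs fun i => -(i : ℤ)] with y hy
  simp only [shiftPath, zero_add] at hy
  refine ⟨R * ∑' i : ℕ, ((i : ℝ) + 1) ^ (-(γ / 2 + 1 / 4)) * (y (-(i : ℤ)) : ℝ),
    mul_nonneg h.R_nonneg (tsum_nonneg fun i => by positivity), fun t ht => ?_⟩
  have hle : ∀ i : ℕ, a (t - 1 + i) * (pastPath (shiftPath t y) (t - 1 + i) : ℝ)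
      ≤ R * (t : ℝ) ^ (-(γ / 2 - 1 / 4)) *
        (((i : ℝ) + 1) ^ (-(γ / 2 + 1 / 4)) * (y (-(i : ℤ)) : ℝ)) := fun i => by
    rw [pastPath_shiftPath_add ht, ← mul_assoc]
    exact mul_le_mul_of_nonneg_right (h.le_mul (by linarith) (by linarith) (by ring) ht i)
      (Nat.cast_nonneg _)
  have hsum := hy.mul_left (R * (t : ℝ) ^ (-(γ / 2 - 1 / 4)))
  unfold tailSum
  refine ((Summable.of_nonneg_of_le (fun i => mul_nonneg (h.nonneg _) (Nat.cast_nonneg _)) hle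
    hsum).tsum_le_tsum hle hsum).trans (le_of_eq ?_)
  rw [tsum_mul_left]
  ring

theorem ae_sum_rpow_bounded (hP : StationaryErgodic P) {g : (ℤ → ℕ) → ℝ} (hgm : Measurable g)
    (hg : Integrable g P) (hg0 : ∀ y, 0 ≤ g y) {σ : ℝ} (hσ : 1 < σ) :
    ∀ᵐ y ∂P, ∃ K ≥ 0, ∀ m : ℕ,
      ∑ t ∈ Finset.Icc 1 m, (t : ℝ) ^ (-σ) * g (shiftPath t y) ≤ K := by
  filter_upwards [hP.ae_summable_weighted hgm hg hg0 (w := fun t : ℕ => (t : ℝ) ^ (-σ))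
    (fun i => by positivity) (Real.summable_nat_rpow.2 (by linarith)) fun t => (t : ℤ)] with y hy
  exact ⟨_, tsum_nonneg fun t => mul_nonneg (by positivity) (hg0 _), fun m =>
    hy.sum_le_tsum _ fun t _ => mul_nonneg (by positivity) (hg0 _)⟩

/-- Half a power is moved out of each weight: `t^(-σ) = t^(-(σ + 1/2)) √t ≤ t^(-(σ + 1/2)) √m`, and
the remaining exponent exceeds `1`. -/
theorem ae_sum_rpow_le_sqrt (hP : StationaryErgodic P) {g : (ℤ → ℕ) → ℝ} (hgm : Measurable g)
    (hg : Integrable g P) (hg0 : ∀ y, 0 ≤ g y) {σ : ℝ} (hσ : 1 / 2 < σ) :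
    ∀ᵐ y ∂P, ∃ K ≥ 0, ∀ m : ℕ,
      ∑ t ∈ Finset.Icc 1 m, (t : ℝ) ^ (-σ) * g (shiftPath t y) ≤ K * Real.sqrt m := by
  filter_upwards [ae_sum_rpow_bounded hP hgm hg hg0 (show 1 < σ + 1 / 2 by linarith)]
    with y ⟨K, hK0, hK⟩
  refine ⟨K, hK0, fun m => ?_⟩
  calc ∑ t ∈ Finset.Icc 1 m, (t : ℝ) ^ (-σ) * g (shiftPath t y)
      ≤ ∑ t ∈ Finset.Icc 1 m, ((t : ℝ) ^ (-(σ + 1 / 2)) * g (shiftPath t y)) * Real.sqrt m := by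
        refine Finset.sum_le_sum fun t ht => ?_
        rw [Finset.mem_Icc] at ht
        have ht0 : (0 : ℝ) < t := by exact_mod_cast ht.1
        have htm : (t : ℝ) ≤ m := by exact_mod_cast ht.2
        have h1 : (t : ℝ) ^ (-σ) = (t : ℝ) ^ (-(σ + 1 / 2)) * Real.sqrt t := by
          rw [Real.sqrt_eq_rpow, ← Real.rpow_add ht0]
          congr 1
          ring
        rw [h1, mul_right_comm]
        exact mul_le_mul_of_nonneg_left (Real.sqrt_le_sqrt htm)
          (mul_nonneg (by positivity) (hg0 _))
    _ ≤ K * Real.sqrt m := by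
        rw [← Finset.sum_mul]
        exact mul_le_mul_of_nonneg_right (hK m) (Real.sqrt_nonneg _)

end Decay

/-! ### Strong consistency of the historical estimate. -/

section Consistency

variable {d : ℕ} {Θ : Set (Param d)} {f : Param d → (ℕ → ℕ) → ℝ} {c C p R γ : ℝ} {a A : ℕ → ℝ}
  {P : Measure (ℤ → ℕ)} {θ₀ : Param d}

theorem tendsto_inv_mul_sqrt : Tendsto (fun m : ℕ => (m : ℝ)⁻¹ * Real.sqrt m) atTop (𝓝 0) := by
  have h : Tendsto (fun m : ℕ => (Real.sqrt m)⁻¹) atTop (𝓝 0) :=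
    tendsto_inv_atTop_zero.comp (Real.tendsto_sqrt_atTop.comp tendsto_natCast_atTop_atTop)
  refine h.congr' ?_
  filter_upwards [eventually_gt_atTop 0] with m hm
  have : (0 : ℝ) < m := by exact_mod_cast hm
  have h2 : Real.sqrt m ≠ 0 := (Real.sqrt_pos.2 this).ne'
  field_simp
  rw [Real.sq_sqrt this.le]

theorem measurable_weight (c : ℝ) : Measurable fun y : ℤ → ℕ => (y 0 : ℝ) / c + 1 :=
  ((measurable_coord 0).div_const c).add_const 1

theorem EnvelopeMoment.integrable_weight (hE : EnvelopeMoment P C A p) (c : ℝ) :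
    Integrable (fun y : ℤ → ℕ => (y 0 : ℝ) / c + 1) P := by
  have := hE.stationary.prob
  exact (hE.integrable_coord.div_const c).add (integrable_const 1)

/-- Strong consistency of the estimate computed on the window `{1, …, m}`. -/
theorem ae_pqmle_consistent (hM : ModelBounds Θ f c C a A) (hE : EnvelopeMoment P C A p)
    (hD : PolyDecay a R γ) (hθ₀ : θ₀ ∈ Θ)
    (hneg : ∀ θ ∈ Θ, θ ≠ θ₀ →
      ∫ y, (qll f θ (y 0) (pastPath y) - qll f θ₀ (y 0) (pastPath y)) ∂P < 0) :
    ∀ᵐ y ∂P, ∀ ρ > 0, ∀ᶠ m : ℕ in atTop, ∀ x : ℕ → ℕ, (∀ t ∈ Finset.Icc 1 m, x t = y t) →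
      ∀ θ, IsPQMLE Θ f x 1 m θ → dist θ θ₀ < ρ := by
  have hγ := hD.lt
  have hj : ∀ᵐ y ∂P, ∀ j : ℕ, ∀ᶠ m : ℕ in atTop, ∀ x : ℕ → ℕ,
      (∀ t ∈ Finset.Icc 1 m, x t = y t) →
      ∀ θ, IsPQMLE Θ f x 1 m θ → dist θ θ₀ < 1 / ((j : ℝ) + 1) := by
    refine ae_all_iff.2 fun j => ?_
    obtain ⟨κ, hκ, F, h, sel, hF, hsel, hmaj⟩ := exists_finite_majorants hM hE hθ₀ hneg
      (Nat.one_div_pos_of_nat (α := ℝ) (n := j))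
    have hmaj' := ae_all_iff.2 fun t : ℕ => hE.stationary.ae_shift (t : ℤ) hmaj
    have havg : ∀ᵐ y ∂P, ∀ z ∈ F, Tendsto (fun N : ℕ => (N : ℝ)⁻¹ *
        ∑ t ∈ Finset.Icc 1 N, h z (shiftPath t y)) atTop (𝓝 (∫ y, h z y ∂P)) :=
      (Finset.eventually_all F).2 fun z hz => hE.stationary.ae_tendsto_avg (hF z hz).1 (hF z hz).2.1
    filter_upwards [hmaj', havg, hE.ae_lagSummable, hD.ae_tailSum_le hE.stationary
      hE.integrable_coord, ae_sum_rpow_le_sqrt hE.stationary (measurable_weight c)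
      (hE.integrable_weight c) (fun y => by have := hM.c_pos; positivity)
      (show 1 / 2 < γ / 2 - 1 / 4 by linarith)] with y h1 h2 h3 ⟨K, hK0, hK⟩ ⟨K', hK'0, hK'⟩
    have h5 : ∀ᶠ m : ℕ in atTop, ∀ z ∈ F,
        (m : ℝ)⁻¹ * ∑ t ∈ Finset.Icc 1 m, h z (shiftPath t y) < -κ :=
      (Finset.eventually_all F).2 fun z hz => (h2 z hz).eventually_lt_const (hF z hz).2.2
    have h6 : Tendsto (fun m : ℕ => 2 * K * K' * ((m : ℝ)⁻¹ * Real.sqrt m)) atTop (𝓝 0) := by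
      simpa using tendsto_inv_mul_sqrt.const_mul (2 * K * K')
    filter_upwards [h5, h6.eventually_lt_const hκ, eventually_gt_atTop 0] with m hm1 hm2 hm0 x hx θ hθ
    -- For an estimate far from `θ₀`, the average of its majorant is below `-κ` while the truncation
    -- error is `O(√m)` in total. Thus the log-likelihood ratio would be negative, against
    -- maximality.
    by_contra hd
    rw [not_lt] at hd
    have h7 := IsPQMLE.sum_nonneg hM hθ hθ₀ (p := fun t => pastPath (shiftPath t y))
      (g := fun t => h (sel θ) (shiftPath t y)) (e := fun t => K * (t : ℝ) ^ (-(γ / 2 - 1 / 4)))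
      (fun t ht θ' hθ' => by
        rw [truncPast_eq_cutPast hx ht]
        refine (hM.abs_sub_le hθ' (LagSummable.cut _) (h3 t) (n := t - 1)
          fun k hk => by simp [cutPast, hk]).trans ?_
        rw [tailSum_cut, zero_add]
        exact hK t (Finset.mem_Icc.1 ht).1)
      (fun t ht => by
        have := h1 t θ hθ.1 hd
        rw [hx t ht]
        simpa [shiftPath] using this)
    have h8 : ∑ t ∈ Finset.Icc 1 m, (h (sel θ) (shiftPath t y)
        + 2 * ((((x t : ℕ) : ℝ) / c + 1) * (K * (t : ℝ) ^ (-(γ / 2 - 1 / 4)))))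
        = ∑ t ∈ Finset.Icc 1 m, h (sel θ) (shiftPath t y) + 2 * K * ∑ t ∈ Finset.Icc 1 m,
          (t : ℝ) ^ (-(γ / 2 - 1 / 4)) * ((shiftPath t y 0 : ℝ) / c + 1) := by
      rw [Finset.sum_add_distrib, Finset.mul_sum]
      congr 1
      refine Finset.sum_congr rfl fun t ht => ?_
      rw [hx t ht]
      simp only [shiftPath, zero_add]
      ring
    rw [h8] at h7
    have h9 := mul_le_mul_of_nonneg_left (hK' m) (show 0 ≤ 2 * K by positivity)
    have hm' : (0 : ℝ) < (m : ℝ)⁻¹ := by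
      rw [inv_pos]
      exact_mod_cast hm0
    have h10 := hm1 (sel θ) (hsel θ hθ.1 hd)
    have h11 := mul_le_mul_of_nonneg_left (h7.trans (add_le_add_right h9 _)) hm'.le
    rw [mul_add, mul_zero] at h11
    have h12 : (m : ℝ)⁻¹ * (2 * K * (K' * Real.sqrt m)) = 2 * K * K' * ((m : ℝ)⁻¹ * Real.sqrt m) := by
      ring
    linarith
  filter_upwards [hj] with y hy ρ hρ
  obtain ⟨j, hjρ⟩ := exists_nat_one_div_lt hρ
  filter_upwards [hy j] with m hm x hx θ hθ
  exact (hm x hx θ hθ).trans hjρ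

end Consistency

/-! ### Consistency after the change -/

section PostChange

variable {d : ℕ} {Θ : Set (Param d)} {f : Param d → (ℕ → ℕ) → ℝ} {c C p R γ : ℝ} {a A : ℕ → ℝ}
  {θ₀ : Param d}

/-- The observations follow `y₁` up to time `k`, and `y₂` (with time origin at `k`) after `k`. -/
def FollowsChange (x : ℕ → ℕ) (k : ℕ) (y₁ y₂ : ℤ → ℕ) : Prop :=
  (∀ t ∈ Finset.Icc 1 k, x t = y₁ t) ∧ ∀ n : ℕ, 1 ≤ n → x (k + n) = y₂ n

/-- The influence of the observations of the first regime at time `n` after the change. -/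
def oldTail (a : ℕ → ℝ) (k n : ℕ) (y₁ : ℤ → ℕ) : ℝ :=
  ∑ i ∈ Finset.range k, a (n - 1 + i) * (y₁ ((k : ℤ) - i) : ℝ)

theorem oldTail_nonneg (ha : ∀ k, 0 ≤ a k) (k n : ℕ) (y₁ : ℤ → ℕ) : 0 ≤ oldTail a k n y₁ :=
  Finset.sum_nonneg fun _ _ => mul_nonneg (ha _) (Nat.cast_nonneg _)

/-- At time `k + n` the first `n - 1` lags belong to the new regime, and the lag index `n - 1 + i`
points to time `k - i` of the old one. For `i ≥ k` the truncated past is zero. -/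
theorem FollowsChange.tailSum_truncPast {x : ℕ → ℕ} {k : ℕ} {y₁ y₂ : ℤ → ℕ}
    (hx : FollowsChange x k y₁ y₂) {n : ℕ} (hn : 1 ≤ n) :
    tailSum a (n - 1) (truncPast x (k + n)) = oldTail a k n y₁ := by
  have hz : ∀ i, i ∉ Finset.range k →
      a (n - 1 + i) * ((truncPast x (k + n) (n - 1 + i) : ℕ) : ℝ) = 0 := fun i hi => by
    rw [Finset.mem_range, not_lt] at hi
    rw [truncPast, if_neg (by lia)]
    simp
  rw [tailSum, tsum_eq_sum hz, oldTail]
  refine Finset.sum_congr rfl fun i hi => ?_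
  rw [Finset.mem_range] at hi
  rw [truncPast, if_pos (by lia), show k + n - 1 - (n - 1 + i) = k - i by lia,
    hx.1 (k - i) (by rw [Finset.mem_Icc]; lia), Nat.cast_sub hi.le]

theorem FollowsChange.truncPast_eq {x : ℕ → ℕ} {k : ℕ} {y₁ y₂ : ℤ → ℕ}
    (hx : FollowsChange x k y₁ y₂) {n i : ℕ} (hi : i < n - 1) :
    truncPast x (k + n) i = pastPath (shiftPath n y₂) i := by
  rw [truncPast, if_pos (by lia), show k + n - 1 - i = k + (n - 1 - i) by lia,
    hx.2 (n - 1 - i) (by lia)]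
  unfold pastPath shiftPath
  congr 1
  lia

theorem lagSummable_truncPast (x : ℕ → ℕ) (t : ℕ) : LagSummable A (truncPast x t) :=
  LagSummable.of_finite (n := t) fun k hk => by
    rw [truncPast, if_neg (by lia)]

/-- The inequality satisfied by an estimate computed on the window `{k + 1, …, k + N}`. -/
theorem FollowsChange.pqmle_inequality (hM : ModelBounds Θ f c C a A) (hθ₀ : θ₀ ∈ Θ)
    {x : ℕ → ℕ} {k N : ℕ} {y₁ y₂ : ℤ → ℕ} (hx : FollowsChange x k y₁ y₂)
    (hs : ∀ n : ℕ, LagSummable A (pastPath (shiftPath n y₂))) {θ : Param d}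
    (hθ : IsPQMLE Θ f x (k + 1) (k + N) θ) {h : (ℤ → ℕ) → ℝ}
    (hh : ∀ n : ℕ, qll f θ (shiftPath n y₂ 0) (pastPath (shiftPath n y₂))
      - qll f θ₀ (shiftPath n y₂ 0) (pastPath (shiftPath n y₂)) ≤ h (shiftPath n y₂)) :
    0 ≤ ∑ n ∈ Finset.Icc 1 N, h (shiftPath n y₂)
      + 2 * ∑ n ∈ Finset.Icc 1 N, ((shiftPath n y₂ 0 : ℝ) / c + 1) *
        (oldTail a k n y₁ + tailSum a (n - 1) (pastPath (shiftPath n y₂))) := by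
  -- The observed past is compared with the full stationary past of the second regime. The two agree
  -- in the first `n - 1` lags, so the error is the sum of both tails.
  have h1 := IsPQMLE.sum_nonneg hM hθ hθ₀
    (p := fun t => pastPath (shiftPath ((t - k : ℕ) : ℤ) y₂))
    (g := fun t => h (shiftPath ((t - k : ℕ) : ℤ) y₂))
    (e := fun t => oldTail a k (t - k) y₁
      + tailSum a (t - k - 1) (pastPath (shiftPath ((t - k : ℕ) : ℤ) y₂)))
    (fun t ht θ' hθ' => by
      rw [Finset.mem_Icc] at ht
      obtain ⟨n, rfl⟩ : ∃ n, t = k + n := ⟨t - k, by lia⟩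
      have hn : 1 ≤ n := by lia
      rw [Nat.add_sub_cancel_left, ← hx.tailSum_truncPast (a := a) hn]
      exact hM.abs_sub_le hθ' (lagSummable_truncPast _ _) (hs n) fun i hi => hx.truncPast_eq hi)
    (fun t ht => by
      rw [Finset.mem_Icc] at ht
      obtain ⟨n, rfl⟩ : ∃ n, t = k + n := ⟨t - k, by lia⟩
      rw [Nat.add_sub_cancel_left, hx.2 n (by lia)]
      have := hh n
      simpa [shiftPath] using this)
  refine h1.trans (le_of_eq ?_)
  rw [Finset.sum_add_distrib, ← Finset.mul_sum]
  have hre : ∀ g : ℕ → ℝ, ∑ t ∈ Finset.Icc (k + 1) (k + N), g t = ∑ n ∈ Finset.Icc 1 N, g (k + n) := by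
    intro g
    rw [show Finset.Icc (k + 1) (k + N) = (Finset.Icc 1 N).map (addLeftEmbedding k) by
      rw [Finset.map_add_left_Icc], Finset.sum_map]
    rfl
  rw [hre, hre]
  congr 1
  · refine Finset.sum_congr rfl fun n _ => ?_
    rw [Nat.add_sub_cancel_left]
  · congr 1
    refine Finset.sum_congr rfl fun n hn => ?_
    rw [Nat.add_sub_cancel_left, hx.2 n (Finset.mem_Icc.1 hn).1]
    simp [shiftPath]

theorem sum_sq_reflect (k : ℕ) (y : ℤ → ℕ) :
    ∑ i ∈ Finset.range k, (y ((k : ℤ) - i) : ℝ) ^ 2 = ∑ t ∈ Finset.Icc 1 k, (y t : ℝ) ^ 2 := by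
  rw [sum_Icc_one_eq_sum_range, ← Finset.sum_range_reflect]
  refine Finset.sum_congr rfl fun i hi => ?_
  rw [Finset.mem_range] at hi
  congr 3
  lia

/-- The influence of the first regime decays after the change, up to the factor `√k`. -/
theorem PolyDecay.ae_oldTail_le {P : Measure (ℤ → ℕ)} (hD : PolyDecay a R γ)
    (hE : EnvelopeMoment P C A p) :
    ∀ᵐ y ∂P, ∃ K ≥ 0, ∀ k n : ℕ, 1 ≤ n →
      oldTail a k n y ≤ K * (n : ℝ) ^ (-(γ / 2 + 1 / 4)) * Real.sqrt k := by
  have hγ := hD.lt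
  -- Here `γ - 1/2 = 2 (γ/2 - 1/4)` is the exponent of the squared weights in the Cauchy-Schwarz
  -- inequality below. This is the place where `γ > 3/2` is needed.
  have hs := summable_rpow_succ (show 1 < γ - 1 / 2 by linarith)
  set S := ∑' i : ℕ, ((i : ℝ) + 1) ^ (-(γ - 1 / 2)) with hS
  have hS0 : 0 ≤ S := tsum_nonneg fun i => by positivity
  have hsq : Integrable (fun y : ℤ → ℕ => (y 0 : ℝ) ^ 2) P := by
    refine (hE.integrable_pow (j := 2) (by norm_num)).mono'
      ((measurable_coord 0).pow_const 2).aestronglyMeasurable (Eventually.of_forall fun y => ?_)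
    rw [Real.norm_of_nonneg (by positivity)]
    exact pow_le_pow_left₀ (Nat.cast_nonneg _) (hE.coord_le y) 2
  filter_upwards [hE.stationary.ae_tendsto_avg ((measurable_coord 0).pow_const 2) hsq] with y hy
  obtain ⟨B, hB⟩ := hy.bddAbove_range
  have hB' : ∀ k : ℕ, ∑ t ∈ Finset.Icc 1 k, (y t : ℝ) ^ 2 ≤ B * k := fun k => by
    rcases Nat.eq_zero_or_pos k with rfl | hk
    · simp
    · have h1 := hB ⟨k, rfl⟩
      have hk' : (0 : ℝ) < k := by exact_mod_cast hk
      simp only [shiftPath, zero_add] at h1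
      rw [inv_mul_le_iff₀ hk'] at h1
      linarith
  have hB0 : 0 ≤ B := by
    have := hB ⟨0, rfl⟩
    simpa using this
  refine ⟨R * (Real.sqrt S * Real.sqrt B), mul_nonneg hD.R_nonneg (by positivity),
    fun k n hn => ?_⟩
  have h1 : oldTail a k n y ≤ R * (n : ℝ) ^ (-(γ / 2 + 1 / 4)) * ∑ i ∈ Finset.range k,
      ((i : ℝ) + 1) ^ (-(γ / 2 - 1 / 4)) * (y ((k : ℤ) - i) : ℝ) := by
    rw [Finset.mul_sum]
    refine Finset.sum_le_sum fun i _ => ?_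
    rw [← mul_assoc]
    exact mul_le_mul_of_nonneg_right (hD.le_mul (by linarith) (by linarith) (by ring) hn i)
      (Nat.cast_nonneg _)
  -- Cauchy-Schwarz separates the weights from the first regime, whose sum of squares up to time `k`
  -- is at most `B k` by the ergodic theorem.
  have h2 : ∑ i ∈ Finset.range k, ((i : ℝ) + 1) ^ (-(γ / 2 - 1 / 4)) * (y ((k : ℤ) - i) : ℝ)
      ≤ Real.sqrt S * Real.sqrt (B * k) := by
    refine (Real.sum_mul_le_sqrt_mul_sqrt _ _ _).trans ?_
    refine mul_le_mul (Real.sqrt_le_sqrt ?_) (Real.sqrt_le_sqrt ?_) (Real.sqrt_nonneg _)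
      (Real.sqrt_nonneg _)
    · refine le_trans (le_of_eq ?_) (hs.sum_le_tsum (Finset.range k) fun i _ => by positivity)
      refine Finset.sum_congr rfl fun i _ => ?_
      rw [← Real.rpow_natCast, ← Real.rpow_mul (by positivity)]
      congr 1
      push_cast
      ring
    · rw [sum_sq_reflect]
      exact hB' k
  rw [Real.sqrt_mul hB0] at h2
  have h3 : 0 ≤ R * (n : ℝ) ^ (-(γ / 2 + 1 / 4)) := mul_nonneg hD.R_nonneg (by positivity)
  refine (h1.trans (mul_le_mul_of_nonneg_left h2 h3)).trans (le_of_eq ?_)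
  ring

/-- Strong consistency after the change. -/
theorem ae_pqmle_consistent_after {P₁ P₂ : Measure (ℤ → ℕ)} {p₁ p₂ : ℝ}
    (hM : ModelBounds Θ f c C a A) (hE₁ : EnvelopeMoment P₁ C A p₁)
    (hE₂ : EnvelopeMoment P₂ C A p₂) (hD : PolyDecay a R γ) (hθ₀ : θ₀ ∈ Θ)
    (hneg : ∀ θ ∈ Θ, θ ≠ θ₀ →
      ∫ y, (qll f θ (y 0) (pastPath y) - qll f θ₀ (y 0) (pastPath y)) ∂P₂ < 0)
    {k N : ℕ → ℕ} (hN : Tendsto N atTop atTop)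
    (hkN : Tendsto (fun m => ((N m : ℝ))⁻¹ * Real.sqrt (k m)) atTop (𝓝 0)) :
    ∃ G₁ G₂ : (ℤ → ℕ) → Prop, (∀ᵐ y ∂P₁, G₁ y) ∧ (∀ᵐ y ∂P₂, G₂ y) ∧
      ∀ y₁ y₂, G₁ y₁ → G₂ y₂ → ∀ ρ > 0, ∀ᶠ m : ℕ in atTop, ∀ x : ℕ → ℕ,
        FollowsChange x (k m) y₁ y₂ →
        ∀ θ, IsPQMLE Θ f x (k m + 1) (k m + N m) θ → dist θ θ₀ < ρ := by
  have hγ := hD.lt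
  have hfam : ∀ j : ℕ, ∃ κ > 0, ∃ (F : Finset (Param d)) (h : Param d → (ℤ → ℕ) → ℝ)
      (sel : Param d → Param d),
      (∀ z ∈ F, Measurable (h z) ∧ Integrable (h z) P₂ ∧ ∫ y, h z y ∂P₂ < -κ) ∧
      (∀ θ ∈ Θ, 1 / ((j : ℝ) + 1) ≤ dist θ θ₀ → sel θ ∈ F) ∧
      ∀ᵐ y ∂P₂, ∀ θ ∈ Θ, 1 / ((j : ℝ) + 1) ≤ dist θ θ₀ →
        qll f θ (y 0) (pastPath y) - qll f θ₀ (y 0) (pastPath y) ≤ h (sel θ) y := fun j =>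
    exists_finite_majorants hM hE₂ hθ₀ hneg (Nat.one_div_pos_of_nat (α := ℝ) (n := j))
  choose κ hκ F h sel hF hsel hmaj using hfam
  have hmaj' := ae_all_iff.2 fun j => ae_all_iff.2 fun t : ℕ =>
    hE₂.stationary.ae_shift (t : ℤ) (hmaj j)
  have havg : ∀ᵐ y ∂P₂, ∀ j, ∀ z ∈ F j, Tendsto (fun N : ℕ => (N : ℝ)⁻¹ *
      ∑ t ∈ Finset.Icc 1 N, h j z (shiftPath t y)) atTop (𝓝 (∫ y, h j z y ∂P₂)) :=
    ae_all_iff.2 fun j => (Finset.eventually_all (F j)).2 fun z hz =>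
      hE₂.stationary.ae_tendsto_avg (hF j z hz).1 (hF j z hz).2.1
  have hw0 : ∀ y : ℤ → ℕ, 0 ≤ (y 0 : ℝ) / c + 1 := fun y => by
    have := hM.c_pos
    positivity
  -- The good trajectories of the two regimes are described separately, so that no property of the
  -- joint law is needed.
  refine ⟨_, _, hD.ae_oldTail_le hE₁, hmaj'.and (havg.and (hE₂.ae_lagSummable.and
    ((hD.ae_tailSum_le hE₂.stationary hE₂.integrable_coord).and
    ((ae_sum_rpow_le_sqrt hE₂.stationary (measurable_weight c) (hE₂.integrable_weight c) hw0
      (show 1 / 2 < γ / 2 - 1 / 4 by linarith)).and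
    (ae_sum_rpow_bounded hE₂.stationary (measurable_weight c) (hE₂.integrable_weight c) hw0
      (show 1 < γ / 2 + 1 / 4 by linarith)))))), ?_⟩
  rintro y₁ y₂ ⟨K₁, hK₁0, hK₁⟩ ⟨h1, h2, h3, ⟨K₂, hK₂0, hK₂⟩, ⟨K₃, hK₃0, hK₃⟩, ⟨K₄, hK₄0, hK₄⟩⟩ ρ hρ
  obtain ⟨j, hjρ⟩ := exists_nat_one_div_lt hρ
  have h5 : ∀ᶠ m : ℕ in atTop, ∀ z ∈ F j,
      ((N m : ℕ) : ℝ)⁻¹ * ∑ t ∈ Finset.Icc 1 (N m), h j z (shiftPath t y₂) < -κ j :=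
    (Finset.eventually_all (F j)).2 fun z hz =>
      hN.eventually ((h2 j z hz).eventually_lt_const (hF j z hz).2.2)
  have h6 : Tendsto (fun m : ℕ => 2 * K₁ * K₄ * ((N m : ℝ)⁻¹ * Real.sqrt (k m))
      + 2 * K₂ * K₃ * ((N m : ℝ)⁻¹ * Real.sqrt (N m))) atTop (𝓝 0) := by
    simpa using (hkN.const_mul (2 * K₁ * K₄)).add
      ((tendsto_inv_mul_sqrt.comp hN).const_mul (2 * K₂ * K₃))
  filter_upwards [h5, h6.eventually_lt_const (hκ j), hN.eventually_gt_atTop 0]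
    with m hm1 hm2 hm0 x hx θ hθ
  refine lt_of_not_ge fun hd => ?_
  have hd' : 1 / ((j : ℝ) + 1) ≤ dist θ θ₀ := hjρ.le.trans hd
  have h7 := hx.pqmle_inequality hM hθ₀ (fun n => h3 n) hθ (h := h j (sel j θ))
    fun n => h1 j n θ hθ.1 hd'
  -- The weights `n^(-(γ/2 + 1/4))` of the old regime are summable, which leaves `O(√k)`; the
  -- stationary tail contributes `O(√N)`. Both are `o(N)`.
  have h8 : ∑ n ∈ Finset.Icc 1 (N m), ((shiftPath n y₂ 0 : ℝ) / c + 1) *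
      (oldTail a (k m) n y₁ + tailSum a (n - 1) (pastPath (shiftPath n y₂)))
      ≤ K₁ * Real.sqrt (k m) * K₄ + K₂ * (K₃ * Real.sqrt (N m)) := by
    calc _ ≤ ∑ n ∈ Finset.Icc 1 (N m), (K₁ * Real.sqrt (k m) *
            ((n : ℝ) ^ (-(γ / 2 + 1 / 4)) * ((shiftPath n y₂ 0 : ℝ) / c + 1))
          + K₂ * ((n : ℝ) ^ (-(γ / 2 - 1 / 4)) * ((shiftPath n y₂ 0 : ℝ) / c + 1))) := by
          refine Finset.sum_le_sum fun n hn => ?_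
          rw [Finset.mem_Icc] at hn
          refine (mul_le_mul_of_nonneg_left (add_le_add (hK₁ (k m) n hn.1) (hK₂ n hn.1))
            (hw0 _)).trans (le_of_eq ?_)
          ring
      _ ≤ _ := by
          rw [Finset.sum_add_distrib, ← Finset.mul_sum, ← Finset.mul_sum]
          exact add_le_add (mul_le_mul_of_nonneg_left (hK₄ (N m)) (by positivity))
            (mul_le_mul_of_nonneg_left (hK₃ (N m)) hK₂0)
  have hm' : (0 : ℝ) < (N m : ℝ)⁻¹ := by
    rw [inv_pos]
    exact_mod_cast hm0
  have h10 := hm1 (sel j θ) (hsel j θ hθ.1 hd')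
  have h11 := mul_le_mul_of_nonneg_left
    (h7.trans (add_le_add_right (mul_le_mul_of_nonneg_left h8 zero_le_two) _)) hm'.le
  rw [mul_add, mul_zero] at h11
  have h12 : (N m : ℝ)⁻¹ * (2 * (K₁ * Real.sqrt (k m) * K₄ + K₂ * (K₃ * Real.sqrt (N m))))
      = 2 * K₁ * K₄ * ((N m : ℝ)⁻¹ * Real.sqrt (k m))
      + 2 * K₂ * K₃ * ((N m : ℝ)⁻¹ * Real.sqrt (N m)) := by
    ring
  linarith

end PostChange

/-! ### Consistency in probability after the change. -/

section PostChangeProbability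

variable {d : ℕ} {Θ : Set (Param d)} {f : Param d → (ℕ → ℕ) → ℝ} {c C p R γ : ℝ} {a A : ℕ → ℝ}
  {θ₀ : Param d}

/-- By Tonelli it is enough to control each product `W · uᵢ` separately. Where the series diverges
its value is `0` and the bound is trivial. -/
theorem lintegral_mul_tsum_le {Ω : Type*} [MeasurableSpace Ω] {μ : Measure Ω} {W : Ω → ℝ}
    {u : ℕ → Ω → ℝ} (hW : ∀ ω, 0 ≤ W ω) (hu : ∀ i ω, 0 ≤ u i ω) (hWm : Measurable W)
    (hum : ∀ i, Measurable (u i)) {b : ℕ → ℝ} (hb : ∀ i, 0 ≤ b i) (hbs : Summable b) {M : ℝ≥0∞}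
    (hM : ∀ i, ∫⁻ ω, ENNReal.ofReal (W ω * u i ω) ∂μ ≤ M) :
    ∫⁻ ω, ENNReal.ofReal (W ω * ∑' i, b i * u i ω) ∂μ ≤ ENNReal.ofReal (∑' i, b i) * M := by
  have h1 : ∀ ω, ENNReal.ofReal (W ω * ∑' i, b i * u i ω)
      ≤ ∑' i, ENNReal.ofReal (b i) * ENNReal.ofReal (W ω * u i ω) := by
    intro ω
    by_cases hs : Summable fun i => b i * u i ω
    · rw [← tsum_mul_left, ENNReal.ofReal_tsum_of_nonneg
        (fun i => mul_nonneg (hW ω) (mul_nonneg (hb i) (hu i ω))) (hs.mul_left _)]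
      refine (tsum_congr fun i => ?_).le
      rw [← ENNReal.ofReal_mul (hb i)]
      congr 1
      ring
    · rw [tsum_eq_zero_of_not_summable hs]
      simp
  refine (lintegral_mono h1).trans ?_
  have h2 : ∀ i, Measurable fun ω => ENNReal.ofReal (b i) * ENNReal.ofReal (W ω * u i ω) :=
    fun i => ((hWm.mul (hum i)).ennreal_ofReal).const_mul _
  rw [lintegral_tsum fun i => (h2 i).aemeasurable]
  calc ∑' i, ∫⁻ ω, ENNReal.ofReal (b i) * ENNReal.ofReal (W ω * u i ω) ∂μ
      ≤ ∑' i, ENNReal.ofReal (b i) * M := by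
        refine ENNReal.tsum_le_tsum fun i => ?_
        rw [lintegral_const_mul' _ _ ENNReal.ofReal_ne_top]
        gcongr
        exact hM i
    _ = _ := by rw [ENNReal.tsum_mul_right, ENNReal.ofReal_tsum_of_nonneg hb hbs]

theorem measurable_tailSum (ha : ∀ k, 0 ≤ a k) (n : ℕ) : Measurable (tailSum a n) :=
  (measurable_lagSum (a := fun k => a (n + k)) fun _ => ha _).comp
    (measurable_pi_lambda (fun (p : ℕ → ℕ) k => p (n + k)) fun k => measurable_pi_apply (n + k))

/-- Consistency in probability after the change, for an arbitrary time shift of the second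
process. -/
theorem tendsto_measure_pqmle_after {Ω : Type*} [MeasurableSpace Ω] {μ : Measure Ω}
    [IsProbabilityMeasure μ] {Y₁ Y₂ : ℤ → Ω → ℕ} {θ₁ : Param d} {p₁ p₂ : ℝ}
    (hM : ModelBounds Θ f c C a A) (hY₁ : IsODProcess μ f θ₁ Y₁) (hY₂ : IsODProcess μ f θ₀ Y₂)
    (hE₁ : EnvelopeMoment (pathLaw μ Y₁) C A p₁) (hE₂ : EnvelopeMoment (pathLaw μ Y₂) C A p₂)
    (hθ₀ : θ₀ ∈ Θ)
    (hneg : ∀ θ ∈ Θ, θ ≠ θ₀ → ∫ y, (qll f θ (y 0) (pastPath y)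
      - qll f θ₀ (y 0) (pastPath y)) ∂(pathLaw μ Y₂) < 0)
    {k N : ℕ → ℕ} (hN : Tendsto N atTop atTop) {x : ℕ → Ω → ℕ → ℕ} {q : ℕ → ℤ}
    (hx : ∀ m ω, FollowsChange (x m ω) (k m) (trajectory Y₁ ω)
      (shiftPath (q m) (trajectory Y₂ ω))) {ρ : ℝ} (hρ : 0 < ρ) :
    Tendsto (fun m => μ {ω | ∃ θ, IsPQMLE Θ f (x m ω) (k m + 1) (k m + N m) θ ∧ ρ ≤ dist θ θ₀})
      atTop (𝓝 0) := by
  obtain ⟨κ, hκ, F, h, sel, hF, hsel, hmaj⟩ := exists_finite_majorants hM hE₂ hθ₀ hneg hρ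
  have hP₂ := hE₂.stationary
  have := hP₂.prob
  have hc := hM.c_pos
  have has : Summable a := Summable.of_nonneg_of_le hM.a_nonneg hM.a_le hM.A_summable
  set w : (ℤ → ℕ) → ℝ := fun y => (y 0 : ℝ) / c + 1 with hw
  have hw0 : ∀ y, 0 ≤ w y := fun y => by positivity
  -- the exceptional null set
  have hgood : ∀ᵐ ω ∂μ, (∀ t : ℤ, ∀ θ ∈ Θ, ρ ≤ dist θ θ₀ →
      qll f θ (shiftPath t (trajectory Y₂ ω) 0) (pastPath (shiftPath t (trajectory Y₂ ω)))
        - qll f θ₀ (shiftPath t (trajectory Y₂ ω) 0) (pastPath (shiftPath t (trajectory Y₂ ω)))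
        ≤ h (sel θ) (shiftPath t (trajectory Y₂ ω))) ∧
      ∀ t : ℤ, LagSummable A (pastPath (shiftPath t (trajectory Y₂ ω))) :=
    hY₂.ae_path ((ae_all_iff.2 fun t => hP₂.ae_shift t hmaj).and hE₂.ae_lagSummable)
  -- the averages of the majorants
  set B : Param d → ℕ → Set (ℤ → ℕ) := fun z n =>
    {y | -κ ≤ (n : ℝ)⁻¹ * ∑ t ∈ Finset.Icc 1 n, h z (shiftPath t y)} with hB
  have havgm : ∀ z ∈ F, ∀ n : ℕ, Measurable fun y : ℤ → ℕ =>
      (n : ℝ)⁻¹ * ∑ t ∈ Finset.Icc 1 n, h z (shiftPath t y) := fun z hz n => by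
    have h1 : ∀ t ∈ Finset.Icc 1 n, Measurable fun y : ℤ → ℕ => h z (shiftPath (t : ℕ) y) :=
      fun t _ => (hF z hz).1.comp (measurable_shiftPath t)
    exact (Finset.measurable_sum _ h1).const_mul _
  have hBm : ∀ z ∈ F, ∀ n, MeasurableSet (B z n) := fun z hz n =>
    measurableSet_le measurable_const (havgm z hz n)
  have hBlim : ∀ z ∈ F, Tendsto (fun n => pathLaw μ Y₂ (B z n)) atTop (𝓝 0) := by
    intro z hz
    have h1 := tendstoInMeasure_of_tendsto_ae
      (fun n => (havgm z hz n).aestronglyMeasurable) (hP₂.ae_tendsto_avg (hF z hz).1 (hF z hz).2.1)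
    have h2 := (hF z hz).2.2
    rw [tendstoInMeasure_iff_dist] at h1
    refine tendsto_of_tendsto_of_tendsto_of_le_of_le tendsto_const_nhds
      (h1 (-κ - ∫ y, h z y ∂(pathLaw μ Y₂)) (by linarith)) (fun n => bot_le) fun n => ?_
    refine measure_mono fun y hy => ?_
    rw [Set.mem_ofPred_eq, Real.dist_eq]
    exact (sub_le_sub_right hy _).trans (le_abs_self _)
  -- the approximation errors
  set V : ℕ → Ω → ℝ := fun m ω => ∑ n ∈ Finset.Icc 1 (N m),
    w (shiftPath n (shiftPath (q m) (trajectory Y₂ ω))) *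
      (oldTail a (k m) n (trajectory Y₁ ω)
        + tailSum a (n - 1) (pastPath (shiftPath n (shiftPath (q m) (trajectory Y₂ ω))))) with hV
  -- A distant estimate forces one of three events: the exceptional null set, a majorant whose
  -- average is not below `-κ`, or a large total approximation error.
  have hsub : ∀ m, 0 < N m → {ω | ∃ θ, IsPQMLE Θ f (x m ω) (k m + 1) (k m + N m) θ ∧ ρ ≤ dist θ θ₀}
      ⊆ {ω | ¬ ((∀ t : ℤ, ∀ θ ∈ Θ, ρ ≤ dist θ θ₀ →
      qll f θ (shiftPath t (trajectory Y₂ ω) 0) (pastPath (shiftPath t (trajectory Y₂ ω)))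
        - qll f θ₀ (shiftPath t (trajectory Y₂ ω) 0) (pastPath (shiftPath t (trajectory Y₂ ω)))
        ≤ h (sel θ) (shiftPath t (trajectory Y₂ ω))) ∧
      ∀ t : ℤ, LagSummable A (pastPath (shiftPath t (trajectory Y₂ ω))))} ∪
      ((⋃ z ∈ F, (fun ω => shiftPath (q m) (trajectory Y₂ ω)) ⁻¹' B z (N m)) ∪
      {ω | κ ≤ 2 * ((N m : ℝ)⁻¹ * V m ω)}) := by
    rintro m hm0 ω ⟨θ, hθ, hd⟩
    by_contra hcon
    simp only [Set.mem_union, not_or, Set.mem_iUnion, not_exists, Set.mem_ofPred_eq, not_not,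
      not_le, Set.mem_preimage] at hcon
    obtain ⟨⟨g1, g2⟩, g3, g4⟩ := hcon
    have h1 := (hx m ω).pqmle_inequality hM hθ₀ (fun n => by
      rw [shiftPath_shiftPath]
      exact g2 _) hθ (h := h (sel θ)) fun n => by
        rw [shiftPath_shiftPath]
        exact g1 _ θ hθ.1 hd
    have h2 := g3 (sel θ) (hsel θ hθ.1 hd)
    rw [hB, Set.mem_ofPred_eq, not_le] at h2
    have hm' : (0 : ℝ) < (N m : ℝ)⁻¹ := by
      rw [inv_pos]
      exact_mod_cast hm0
    have h3 := mul_le_mul_of_nonneg_left h1 hm'.le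
    rw [mul_zero, mul_add] at h3
    have h4 : (N m : ℝ)⁻¹ * (2 * V m ω) = 2 * ((N m : ℝ)⁻¹ * V m ω) := by ring
    simp only [hV, hw] at h4 g4
    linarith
  -- the expectation of the approximation errors
  set tl : ℕ → ℝ := fun n => ∑' i, a (n + i) with htl
  have htl0 : ∀ n, 0 ≤ tl n := fun n => tsum_nonneg fun _ => hM.a_nonneg _
  have htllim : Tendsto tl atTop (𝓝 0) := by
    have := tendsto_sum_nat_add a
    simpa only [htl, add_comm] using this
  set M₁ : ℝ≥0∞ := ∫⁻ ω, ENNReal.ofReal (envelope C A (trajectory Y₁ ω) ^ 2) ∂μ with hM₁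
  set M₂ : ℝ≥0∞ := ∫⁻ ω, ENNReal.ofReal (envelope C A (trajectory Y₂ ω) ^ 2) ∂μ with hM₂
  have hsqm : Measurable fun y : ℤ → ℕ => ENNReal.ofReal (envelope C A y ^ 2) :=
    (hE₁.measurable.pow_const 2).ennreal_ofReal
  have hMY : ∀ (Y : ℤ → Ω → ℕ) (θ' : Param d) (p' : ℝ), IsODProcess μ f θ' Y →
      EnvelopeMoment (pathLaw μ Y) C A p' →
      (∫⁻ ω, ENNReal.ofReal (envelope C A (trajectory Y ω) ^ 2) ∂μ < ∞) ∧ ∀ t : ℤ,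
      ∫⁻ ω, ENNReal.ofReal (envelope C A (shiftPath t (trajectory Y ω)) ^ 2) ∂μ
        = ∫⁻ ω, ENNReal.ofReal (envelope C A (trajectory Y ω) ^ 2) ∂μ := by
    intro Y θ' p' hY hE
    constructor
    · have := hY.integrable_path (hE.integrable_pow (j := 2) (by norm_num))
      rw [← ofReal_integral_eq_lintegral_ofReal this (Eventually.of_forall fun _ => by positivity)]
      exact ENNReal.ofReal_lt_top
    · intro t
      have h1 := lintegral_map (μ := μ) hsqm hY.measurable_trajectory
      have h2 := lintegral_map (μ := μ) (hsqm.comp (measurable_shiftPath t))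
        hY.measurable_trajectory
      simp only [Function.comp_apply] at h2
      rw [← h2, ← h1]
      exact hE.stationary.lintegral_shift t hsqm
  obtain ⟨hM₁t, hM₁s⟩ := hMY Y₁ θ₁ p₁ hY₁ hE₁
  obtain ⟨hM₂t, hM₂s⟩ := hMY Y₂ θ₀ p₂ hY₂ hE₂
  set L : ℝ := 1 / c + 1 with hL
  have hL0 : 0 ≤ L := by positivity
  -- A product of observations from the two regimes is bounded by a sum of squares, so its
  -- expectation is controlled without any knowledge of their dependence.
  have hcross : ∀ (y y' : ℤ → ℕ), w y * (y' 0 : ℝ)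
      ≤ L * (envelope C A y ^ 2 + envelope C A y' ^ 2) := by
    intro y y'
    have h1 := hE₁.one_le_envelope y
    have h2 := hE₁.coord_le y
    have h3 := hE₁.coord_le y'
    have h4 : w y ≤ L * envelope C A y := by
      simp only [hw, hL, add_mul, one_mul, div_mul_eq_mul_div]
      gcongr
    have h5 : (0 : ℝ) ≤ y' 0 := Nat.cast_nonneg _
    calc w y * (y' 0 : ℝ) ≤ (L * envelope C A y) * envelope C A y' := by
          gcongr
      _ = L * (envelope C A y * envelope C A y') := by ring
      _ ≤ _ := by
          gcongr
          nlinarith [sq_nonneg (envelope C A y - envelope C A y'), sq_nonneg (envelope C A y),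
            sq_nonneg (envelope C A y')]
  -- The first `M₂` accounts for the weight; `M₁ + M₂` covers a second factor taken from either
  -- regime.
  set M : ℝ≥0∞ := ENNReal.ofReal L * (M₂ + (M₁ + M₂)) with hMdef
  have hMtop : M ≠ ∞ := ENNReal.mul_ne_top ENNReal.ofReal_ne_top
    (ENNReal.add_ne_top.2 ⟨hM₂t.ne, ENNReal.add_ne_top.2 ⟨hM₁t.ne, hM₂t.ne⟩⟩)
  have hcrossM : ∀ (Y : ℤ → Ω → ℕ), (∀ t, Measurable (Y t)) →
      (∀ t : ℤ, ∫⁻ ω, ENNReal.ofReal (envelope C A (shiftPath t (trajectory Y ω)) ^ 2) ∂μ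
        ≤ M₁ + M₂) → ∀ r t : ℤ,
      ∫⁻ ω, ENNReal.ofReal (w (shiftPath r (trajectory Y₂ ω)) * (Y t ω : ℝ)) ∂μ ≤ M := by
    intro Y hYm hYb r t
    have htm : Measurable (trajectory Y) := measurable_pi_lambda _ hYm
    have e1 : ∀ ω, ENNReal.ofReal (w (shiftPath r (trajectory Y₂ ω)) * (Y t ω : ℝ))
        ≤ ENNReal.ofReal L * (ENNReal.ofReal (envelope C A (shiftPath r (trajectory Y₂ ω)) ^ 2)
          + ENNReal.ofReal (envelope C A (shiftPath t (trajectory Y ω)) ^ 2)) := by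
      intro ω
      rw [← ENNReal.ofReal_add (by positivity) (by positivity), ← ENNReal.ofReal_mul hL0]
      refine ENNReal.ofReal_le_ofReal ?_
      have := hcross (shiftPath r (trajectory Y₂ ω)) (shiftPath t (trajectory Y ω))
      simpa [shiftPath, trajectory] using this
    refine (lintegral_mono e1).trans ?_
    have e2 : Measurable fun ω =>
        ENNReal.ofReal (envelope C A (shiftPath r (trajectory Y₂ ω)) ^ 2) :=
      (hsqm.comp (measurable_shiftPath r)).comp hY₂.measurable_trajectory
    rw [lintegral_const_mul' _ _ ENNReal.ofReal_ne_top, lintegral_add_left e2, hM₂s]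
    exact mul_le_mul' le_rfl (add_le_add le_rfl (hYb t))
  have hVm1 : ∀ m n : ℕ, Measurable fun ω =>
      w (shiftPath n (shiftPath (q m) (trajectory Y₂ ω))) := fun m n =>
    (((measurable_weight c).comp (measurable_shiftPath n)).comp (measurable_shiftPath (q m))).comp
      hY₂.measurable_trajectory
  have hYr : ∀ (Y : ℤ → Ω → ℕ), (∀ t, Measurable (Y t)) → ∀ t : ℤ, Measurable fun ω => (Y t ω : ℝ) :=
    fun Y hYm t => (measurable_from_top (f := fun n : ℕ => (n : ℝ))).comp (hYm t)
  have hold : ∀ m n : ℕ, ∫⁻ ω, ENNReal.ofReal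
      (w (shiftPath n (shiftPath (q m) (trajectory Y₂ ω))) * oldTail a (k m) n (trajectory Y₁ ω)) ∂μ
      ≤ ENNReal.ofReal (tl (n - 1)) * M := by
    intro m n
    have e1 : ∀ ω, oldTail a (k m) n (trajectory Y₁ ω) = ∑' i, a (n - 1 + i) *
        (if i < k m then (Y₁ ((k m : ℤ) - i) ω : ℝ) else 0) := fun ω => by
      rw [tsum_eq_sum (s := Finset.range (k m)) fun i hi => by
        rw [Finset.mem_range] at hi
        rw [if_neg hi, mul_zero], oldTail]
      refine Finset.sum_congr rfl fun i hi => ?_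
      rw [if_pos (Finset.mem_range.1 hi)]
      rfl
    simp_rw [e1]
    refine lintegral_mul_tsum_le (fun ω => hw0 _) (fun i ω => by positivity) (hVm1 m n)
      (fun i => ?_) (fun i => hM.a_nonneg _) ?_ fun i => ?_
    · split_ifs
      · exact hYr Y₁ hY₁.measurable _
      · exact measurable_const
    · simpa only [add_comm] using (summable_nat_add_iff (n - 1)).2 has
    · by_cases hi : i < k m
      · simp_rw [if_pos hi, shiftPath_shiftPath]
        exact hcrossM Y₁ hY₁.measurable (fun t => by rw [hM₁s]; exact le_self_add) _ _
      · simp [if_neg hi]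
  have hnew : ∀ m n : ℕ, 1 ≤ n → ∫⁻ ω, ENNReal.ofReal
      (w (shiftPath n (shiftPath (q m) (trajectory Y₂ ω))) *
        tailSum a (n - 1) (pastPath (shiftPath n (shiftPath (q m) (trajectory Y₂ ω))))) ∂μ
      ≤ ENNReal.ofReal (tl (n - 1)) * M := by
    intro m n hn
    have e1 : ∀ ω, tailSum a (n - 1) (pastPath (shiftPath n (shiftPath (q m) (trajectory Y₂ ω))))
        = ∑' i : ℕ, a (n - 1 + i) * (Y₂ (-(i : ℤ) + q m) ω : ℝ) := fun ω => by
      refine tsum_congr fun i => ?_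
      rw [pastPath_shiftPath_add hn]
      rfl
    simp_rw [e1]
    refine lintegral_mul_tsum_le (fun ω => hw0 _) (fun i ω => by positivity) (hVm1 m n)
      (fun i => hYr Y₂ hY₂.measurable _) (fun i => hM.a_nonneg _) ?_ fun i => ?_
    · simpa only [add_comm] using (summable_nat_add_iff (n - 1)).2 has
    · simp_rw [shiftPath_shiftPath]
      exact hcrossM Y₂ hY₂.measurable (fun t => by rw [hM₂s]; exact le_add_self) _ _
  have hoTm : ∀ m n : ℕ, Measurable fun ω => oldTail a (k m) n (trajectory Y₁ ω) := fun m n =>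
    Finset.measurable_sum _ fun i _ => (hYr Y₁ hY₁.measurable ((k m : ℤ) - i)).const_mul _
  have htTm : ∀ m n : ℕ, Measurable fun ω =>
      tailSum a (n - 1) (pastPath (shiftPath n (shiftPath (q m) (trajectory Y₂ ω)))) := fun m n =>
    (measurable_tailSum hM.a_nonneg (n - 1)).comp (measurable_pastPath.comp
      ((measurable_shiftPath n).comp ((measurable_shiftPath (q m)).comp hY₂.measurable_trajectory)))
  have hVnn : ∀ (m n : ℕ) (ω : Ω), 0 ≤ w (shiftPath n (shiftPath (q m) (trajectory Y₂ ω))) *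
      (oldTail a (k m) n (trajectory Y₁ ω)
        + tailSum a (n - 1) (pastPath (shiftPath n (shiftPath (q m) (trajectory Y₂ ω))))) :=
    fun m n ω => mul_nonneg (hw0 _) (add_nonneg (oldTail_nonneg hM.a_nonneg _ _ _)
      (tailSum_nonneg hM.a_nonneg _))
  have hVint : ∀ m, ∫⁻ ω, ENNReal.ofReal (V m ω) ∂μ
      ≤ ENNReal.ofReal (∑ i ∈ Finset.range (N m), tl i) * (M + M) := by
    intro m
    have e1 : ∀ ω, ENNReal.ofReal (V m ω) = ∑ n ∈ Finset.Icc 1 (N m),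
        ENNReal.ofReal (w (shiftPath n (shiftPath (q m) (trajectory Y₂ ω))) *
      (oldTail a (k m) n (trajectory Y₁ ω)
        + tailSum a (n - 1) (pastPath (shiftPath n (shiftPath (q m) (trajectory Y₂ ω)))))) :=
      fun ω => ENNReal.ofReal_sum_of_nonneg fun n _ => hVnn m n ω
    simp_rw [e1]
    have e0 : ∀ n ∈ Finset.Icc 1 (N m), Measurable fun ω =>
        ENNReal.ofReal (w (shiftPath n (shiftPath (q m) (trajectory Y₂ ω))) *
      (oldTail a (k m) n (trajectory Y₁ ω)
        + tailSum a (n - 1) (pastPath (shiftPath n (shiftPath (q m) (trajectory Y₂ ω)))))) :=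
      fun n _ => ((hVm1 m n).mul ((hoTm m n).add (htTm m n))).ennreal_ofReal
    rw [lintegral_finsetSum _ e0,
      ENNReal.ofReal_sum_of_nonneg fun i _ => htl0 i, Finset.sum_mul]
    have e2 := sum_Icc_one_eq_sum_range (fun n => ENNReal.ofReal (tl (n - 1)) * (M + M)) (N m)
    simp only [Nat.add_sub_cancel] at e2
    rw [← e2]
    refine Finset.sum_le_sum fun n hn => ?_
    have e3 : ∀ ω, ENNReal.ofReal (w (shiftPath n (shiftPath (q m) (trajectory Y₂ ω))) *
      (oldTail a (k m) n (trajectory Y₁ ω)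
        + tailSum a (n - 1) (pastPath (shiftPath n (shiftPath (q m) (trajectory Y₂ ω))))))
        = ENNReal.ofReal (w (shiftPath n (shiftPath (q m) (trajectory Y₂ ω))) *
            oldTail a (k m) n (trajectory Y₁ ω))
          + ENNReal.ofReal (w (shiftPath n (shiftPath (q m) (trajectory Y₂ ω))) *
            tailSum a (n - 1) (pastPath (shiftPath n (shiftPath (q m) (trajectory Y₂ ω))))) :=
      fun ω => by
        rw [mul_add, ENNReal.ofReal_add (mul_nonneg (hw0 _) (oldTail_nonneg hM.a_nonneg _ _ _))
          (mul_nonneg (hw0 _) (tailSum_nonneg hM.a_nonneg _))]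
    simp_rw [e3]
    have e4 : Measurable fun ω => ENNReal.ofReal
        (w (shiftPath n (shiftPath (q m) (trajectory Y₂ ω))) * oldTail a (k m) n (trajectory Y₁ ω)) :=
      ((hVm1 m n).mul (hoTm m n)).ennreal_ofReal
    rw [lintegral_add_left e4, mul_add]
    exact add_le_add (hold m n) (hnew m n (Finset.mem_Icc.1 hn).1)
  have hVm : ∀ m, Measurable (V m) := fun m =>
    Finset.measurable_sum _ fun n _ => (hVm1 m n).mul ((hoTm m n).add (htTm m n))
  have hmarkov : ∀ m, μ {ω | κ ≤ 2 * ((N m : ℝ)⁻¹ * V m ω)}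
      ≤ ENNReal.ofReal (2 / κ * ((N m : ℝ)⁻¹ * ∑ i ∈ Finset.range (N m), tl i)) * (M + M) := by
    intro m
    have e1 : {ω | κ ≤ 2 * ((N m : ℝ)⁻¹ * V m ω)}
        ⊆ {ω | 1 ≤ ENNReal.ofReal (2 / κ * (N m : ℝ)⁻¹) * ENNReal.ofReal (V m ω)} := by
      intro ω hω
      rw [Set.mem_ofPred_eq] at hω ⊢
      rw [← ENNReal.ofReal_mul (by positivity), ← ENNReal.ofReal_one]
      refine ENNReal.ofReal_le_ofReal ?_
      rw [show 2 / κ * (N m : ℝ)⁻¹ * V m ω = 2 * ((N m : ℝ)⁻¹ * V m ω) / κ by ring,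
        le_div_iff₀ hκ]
      linarith
    refine (measure_mono e1).trans ?_
    have e2 := meas_ge_le_lintegral_div (μ := μ)
      ((hVm m).ennreal_ofReal.const_mul (ENNReal.ofReal (2 / κ * (N m : ℝ)⁻¹))).aemeasurable
      one_ne_zero ENNReal.one_ne_top
    refine e2.trans ?_
    rw [div_one, lintegral_const_mul' _ _ ENNReal.ofReal_ne_top,
      ← mul_assoc (2 / κ) (N m : ℝ)⁻¹ (∑ i ∈ Finset.range (N m), tl i),
      ENNReal.ofReal_mul (show 0 ≤ 2 / κ * (N m : ℝ)⁻¹ by positivity), mul_assoc]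
    gcongr
    exact hVint m
  have hmarkovlim : Tendsto (fun m => ENNReal.ofReal
      (2 / κ * ((N m : ℝ)⁻¹ * ∑ i ∈ Finset.range (N m), tl i)) * (M + M)) atTop (𝓝 0) := by
    -- The expected error at time `n` after the change is of the order of the tail `∑ᵢ a (n - 1 +
    -- i)`, which tends to zero; hence so do its Cesàro means.
    have e1 := ((htllim.cesaro.comp hN).const_mul (2 / κ))
    rw [mul_zero] at e1
    have e2 := ENNReal.Tendsto.mul_const (ENNReal.tendsto_ofReal e1) (b := M + M)
      (Or.inr (ENNReal.add_ne_top.2 ⟨hMtop, hMtop⟩))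
    rw [ENNReal.ofReal_zero, zero_mul] at e2
    exact e2
  have hBlim' : Tendsto (fun m => ∑ z ∈ F, pathLaw μ Y₂ (B z (N m))) atTop (𝓝 0) := by
    have := tendsto_finsetSum F fun z hz => (hBlim z hz).comp hN
    simpa using this
  have hfinal := hBlim'.add hmarkovlim
  rw [add_zero] at hfinal
  refine tendsto_of_tendsto_of_tendsto_of_le_of_le' tendsto_const_nhds hfinal
    (Eventually.of_forall fun m => bot_le) ?_
  filter_upwards [hN.eventually_gt_atTop 0] with m hm
  refine (measure_mono (hsub m hm)).trans ((measure_union_le _ _).trans ?_)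
  rw [ae_iff.1 hgood, zero_add]
  refine (measure_union_le _ _).trans (add_le_add ?_ (hmarkov m))
  refine (measure_biUnion_finset_le _ _).trans (Finset.sum_le_sum fun z hz => le_of_eq ?_)
  -- Shift invariance of the law removes `q m`: the event for the shifted trajectory has the same
  -- probability as for the unshifted one.
  rw [← (hP₂.measurePreserving (q m)).measure_preimage (hBm z hz (N m)).nullMeasurableSet]
  exact (Measure.map_apply hY₂.measurable_trajectory
    ((measurable_shiftPath (q m)) (hBm z hz (N m)))).symm

end PostChangeProbability

/-! ### The growth of sums of martingale differences -/

section MartingaleDifferences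

variable {Ω : Type*} [mΩ : MeasurableSpace Ω] {μ : Measure Ω}

theorem integral_sq_add_of_orthogonal {M ξ : Ω → ℝ} (hM : MemLp M 2 μ) (hξ : MemLp ξ 2 μ)
    (h0 : ∫ ω, M ω * ξ ω ∂μ = 0) :
    ∫ ω, (M ω + ξ ω) ^ 2 ∂μ = ∫ ω, M ω ^ 2 ∂μ + ∫ ω, ξ ω ^ 2 ∂μ := by
  have hi : Integrable (fun ω => M ω * ξ ω) μ := hM.integrable_mul hξ
  have h1 : Integrable (fun ω => M ω ^ 2) μ := hM.integrable_sq
  have h2 : Integrable (fun ω => ξ ω ^ 2) μ := hξ.integrable_sq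
  have h3 : Integrable (fun ω => 2 * (M ω * ξ ω)) μ := hi.const_mul 2
  calc ∫ ω, (M ω + ξ ω) ^ 2 ∂μ = ∫ ω, ((M ω ^ 2 + 2 * (M ω * ξ ω)) + ξ ω ^ 2) ∂μ := by
        congr 1
        funext ω
        ring
    _ = _ := by
        have h13 : Integrable (fun ω => M ω ^ 2 + 2 * (M ω * ξ ω)) μ := h1.add h3
        rw [integral_add h13 h2, integral_add h1 h3, integral_const_mul, h0]
        ring

variable [IsProbabilityMeasure μ]

/-- Square-integrable functions with `E(ξ | F) = 0` are orthogonal to square-integrable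
`F`-measurable functions. -/
theorem integral_mul_eq_zero_of_condExp {m : MeasurableSpace Ω} (hm : m ≤ mΩ) {M ξ : Ω → ℝ}
    (hMm : StronglyMeasurable[m] M) (hM : MemLp M 2 μ) (hξ : MemLp ξ 2 μ)
    (h0 : μ[ξ | m] =ᵐ[μ] 0) : ∫ ω, M ω * ξ ω ∂μ = 0 := by
  have hi : Integrable (M * ξ) μ := hM.integrable_mul hξ
  have h1 := condExp_mul_of_stronglyMeasurable_left (μ := μ) hMm hi
    (hξ.integrable (by norm_num))
  have h2 : μ[M * ξ | m] =ᵐ[μ] 0 := by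
    filter_upwards [h1, h0] with ω h1 h0
    rw [h1, Pi.mul_apply, h0]
    simp
  have h3 := integral_condExp (μ := μ) (f := M * ξ) hm
  rw [integral_congr_ae h2] at h3
  simpa using h3.symm

/-- The weighted sums of martingale differences with bounded second moments converge almost surely
if the weights are square-summable. -/
theorem ae_bddAbove_weighted_sum {ℱ : Filtration ℕ mΩ} {ξ : ℕ → Ω → ℝ} {w : ℕ → ℝ} {B : ℝ}
    (hm : ∀ n, StronglyMeasurable[ℱ n] (ξ n)) (hL : ∀ n, MemLp (ξ n) 2 μ)
    (h0 : ∀ n, μ[ξ (n + 1) | ℱ n] =ᵐ[μ] 0) (hB : ∀ n, ∫ ω, ξ n ω ^ 2 ∂μ ≤ B)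
    (hw : Summable fun n => w n ^ 2) :
    ∀ᵐ ω ∂μ, ∃ K, ∀ n, |∑ t ∈ Finset.Icc 1 n, w t * ξ t ω| ≤ K := by
  set M : ℕ → Ω → ℝ := fun n ω => ∑ t ∈ Finset.Icc 1 n, w t * ξ t ω with hMdef
  have hstep : ∀ n, M (n + 1) = fun ω => M n ω + w (n + 1) * ξ (n + 1) ω := fun n => by
    funext ω
    simp only [hMdef]
    rw [Finset.sum_Icc_succ_top (by lia)]
  have hMm : ∀ n, StronglyMeasurable[ℱ n] (M n) := fun n =>
    Finset.stronglyMeasurable_fun_sum _ fun t ht =>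
      ((hm t).mono (ℱ.mono (Finset.mem_Icc.1 ht).2)).const_mul (w t)
  have hwL : ∀ n, MemLp (fun ω => w n * ξ n ω) 2 μ := fun n => (hL n).const_mul (w n)
  have hML : ∀ n, MemLp (M n) 2 μ := fun n => memLp_finsetSum _ fun t _ => hwL t
  have hw0 : ∀ n, μ[fun ω => w (n + 1) * ξ (n + 1) ω | ℱ n] =ᵐ[μ] 0 := fun n => by
    have h1 : μ[fun ω => w (n + 1) * ξ (n + 1) ω | ℱ n] =ᵐ[μ] _ :=
      condExp_smul (w (n + 1)) (ξ (n + 1)) (ℱ n)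
    filter_upwards [h1, h0 n] with ω h1 h2
    rw [h1, Pi.smul_apply, h2]
    simp
  have hB0 : 0 ≤ B := (integral_nonneg fun ω => sq_nonneg _).trans (hB 0)
  have hsq : ∀ n, ∫ ω, M n ω ^ 2 ∂μ ≤ ∑ t ∈ Finset.Icc 1 n, w t ^ 2 * B := by
    intro n
    induction n with
    | zero => simp [hMdef]
    | succ n ih =>
      rw [hstep, integral_sq_add_of_orthogonal (hML n) (hwL _)
        (integral_mul_eq_zero_of_condExp (ℱ.le n) (hMm n) (hML n) (hwL _) (hw0 n)),
        Finset.sum_Icc_succ_top (by lia)]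
      refine add_le_add ih ?_
      simp_rw [mul_pow]
      rw [integral_const_mul]
      exact mul_le_mul_of_nonneg_left (hB _) (sq_nonneg _)
  set S := ∑' n, w n ^ 2 * B with hS
  have hle : ∀ n, ∫ ω, M n ω ^ 2 ∂μ ≤ S := fun n => (hsq n).trans
    ((hw.mul_right B).sum_le_tsum _ fun t _ => mul_nonneg (sq_nonneg _) hB0)
  have hmart : Martingale M ℱ μ := by
    refine martingale_of_condExp_sub_eq_zero_nat hMm (fun n => (hML n).integrable (by norm_num))
      fun n => ?_
    refine (condExp_congr_ae (Eventually.of_forall fun ω => ?_)).trans (hw0 n)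
    simp [hstep]
  -- The bound on second moments, obtained from orthogonality of the increments, gives a bound in
  -- `L¹` through `|z| ≤ z² + 1`; the martingale convergence theorem then applies.
  have hbdd : ∀ n, eLpNorm (M n) 1 μ ≤ (Real.toNNReal (S + 1) : ℝ≥0) := by
    intro n
    rw [eLpNorm_one_eq_lintegral_enorm]
    simp_rw [Real.enorm_eq_ofReal_abs]
    have hab : Integrable (fun ω => |M n ω|) μ := ((hML n).integrable (by norm_num)).abs
    rw [← ofReal_integral_eq_lintegral_ofReal hab (Eventually.of_forall fun ω => abs_nonneg _)]
    refine ENNReal.ofReal_le_ofReal ?_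
    have h1 : Integrable (fun ω => M n ω ^ 2 + 1) μ := (hML n).integrable_sq.add (integrable_const 1)
    refine (integral_mono hab h1 fun ω => ?_).trans (le_of_eq_of_le ?_
      (add_le_add_left (hle n) 1))
    · have : |M n ω| ≤ |M n ω| ^ 2 + 1 := by nlinarith [sq_nonneg (|M n ω| - 1)]
      simpa using this
    · rw [integral_add (hML n).integrable_sq (integrable_const 1)]
      simp
  filter_upwards [hmart.submartingale.ae_tendsto_limitProcess hbdd] with ω hω
  obtain ⟨K, hK⟩ := hω.abs.bddAbove_range
  exact ⟨K, fun n => hK ⟨n, rfl⟩⟩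

/-- Kronecker's lemma, with a rate. -/
theorem abs_sum_le_of_weighted {ξ W : ℕ → ℝ} {K : ℝ} (hW0 : ∀ n, 0 < W n) (hW : Monotone W)
    (h : ∀ n, |∑ t ∈ Finset.Icc 1 n, (W t)⁻¹ * ξ t| ≤ K) (n : ℕ) :
    |∑ t ∈ Finset.Icc 1 n, ξ t| ≤ 2 * K * W n := by
  set M : ℕ → ℝ := fun n => ∑ t ∈ Finset.Icc 1 n, (W t)⁻¹ * ξ t with hM
  have hK : 0 ≤ K := (abs_nonneg _).trans (h 0)
  -- Summation by parts in inductive form: passing from `n` to `n + 1` changes the difference by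
  -- `-(W (n+1) - W n) M n`, and these increments telescope since `W` is monotone.
  have key : ∀ n, |∑ t ∈ Finset.Icc 1 n, ξ t - W n * M n| ≤ K * W n := by
    intro n
    induction n with
    | zero => simpa [hM] using mul_nonneg hK (hW0 0).le
    | succ n ih =>
      have h1 : M (n + 1) = M n + (W (n + 1))⁻¹ * ξ (n + 1) := by
        simp only [hM]
        rw [Finset.sum_Icc_succ_top (by lia)]
      have h2 : ∑ t ∈ Finset.Icc 1 (n + 1), ξ t - W (n + 1) * M (n + 1)
          = (∑ t ∈ Finset.Icc 1 n, ξ t - W n * M n) - (W (n + 1) - W n) * M n := by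
        rw [Finset.sum_Icc_succ_top (by lia), h1]
        have := (hW0 (n + 1)).ne'
        field_simp
        ring
      rw [h2]
      refine (abs_sub _ _).trans ?_
      have h3 : 0 ≤ W (n + 1) - W n := sub_nonneg.2 (hW n.le_succ)
      rw [abs_mul, abs_of_nonneg h3]
      nlinarith [mul_le_mul_of_nonneg_left (h n) h3]
  have h1 := key n
  have h2 : |W n * M n| ≤ K * W n := by
    rw [abs_mul, abs_of_pos (hW0 n), mul_comm]
    exact mul_le_mul_of_nonneg_right (h n) (hW0 n).le
  have h3 := abs_add_le (∑ t ∈ Finset.Icc 1 n, ξ t - W n * M n) (W n * M n)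
  rw [sub_add_cancel] at h3
  linarith

/-- Sums of `n` martingale differences with bounded second moments are `O(n ^ σ)` almost surely,
for every `σ > 1/2`. -/
theorem ae_abs_sum_le_rpow {ℱ : Filtration ℕ mΩ} {ξ : ℕ → Ω → ℝ} {B σ : ℝ}
    (hm : ∀ n, StronglyMeasurable[ℱ n] (ξ n)) (hL : ∀ n, MemLp (ξ n) 2 μ)
    (h0 : ∀ n, μ[ξ (n + 1) | ℱ n] =ᵐ[μ] 0) (hB : ∀ n, ∫ ω, ξ n ω ^ 2 ∂μ ≤ B)
    (hσ : 1 / 2 < σ) :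
    ∀ᵐ ω ∂μ, ∃ K ≥ 0, ∀ n : ℕ, 1 ≤ n → |∑ t ∈ Finset.Icc 1 n, ξ t ω| ≤ K * (n : ℝ) ^ σ := by
  -- The weights `(n + 1)^(-σ)` are square-summable exactly because `2σ > 1`.
  have hs : Summable fun n : ℕ => (((n : ℝ) + 1) ^ (-σ)) ^ 2 := by
    refine (summable_rpow_succ (show 1 < 2 * σ by linarith)).congr fun n => ?_
    rw [← Real.rpow_natCast, ← Real.rpow_mul (by positivity)]
    congr 1
    push_cast
    ring
  filter_upwards [ae_bddAbove_weighted_sum hm hL h0 hB hs] with ω ⟨K, hK⟩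
  have hK0 : 0 ≤ K := (abs_nonneg _).trans (hK 0)
  have h := abs_sum_le_of_weighted (ξ := fun t => ξ t ω) (W := fun n : ℕ => ((n : ℝ) + 1) ^ σ)
    (fun n => by positivity) (fun n n' h => Real.rpow_le_rpow (by positivity)
      (by have : (n : ℝ) ≤ n' := by exact_mod_cast h
          linarith) (by linarith))
    (fun n => by
      simpa only [Real.rpow_neg (show (0 : ℝ) ≤ (_ : ℕ) + 1 by positivity)] using hK n)
  refine ⟨2 * K * 2 ^ σ, by positivity, fun n hn => (h n).trans ?_⟩
  have hn' : (1 : ℝ) ≤ n := by exact_mod_cast hn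
  rw [mul_assoc (2 * K), ← Real.mul_rpow (by norm_num) (by linarith)]
  gcongr
  linarith

end MartingaleDifferences

/-! ### The score -/

/-- The partial derivatives of the quasi-log-likelihood contribution of one observation. -/
def score {d : ℕ} (f : Param d → (ℕ → ℕ) → ℝ) (i : Fin d) (θ : Param d) (k : ℕ) (p : ℕ → ℕ) : ℝ :=
  ((k : ℝ) / f θ p - 1) * fd1 f i θ p

theorem abs_div_sub_one_le {c k u Z : ℝ} (hc : 0 < c) (hk : 0 ≤ k) (hkZ : k ≤ Z) (hZ : 1 ≤ Z)
    (hu : c ≤ u) : |k / u - 1| ≤ (1 / c + 1) * Z := by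
  have hu0 := hc.trans_le hu
  have h1 : k / u ≤ Z / c := div_le_div₀ (by linarith) hkZ hc hu
  have h2 : 0 ≤ k / u := by positivity
  refine (abs_sub _ _).trans ?_
  rw [abs_one, abs_of_nonneg h2]
  have h3 : (1 / c + 1) * Z = Z / c + Z := by ring
  linarith

theorem abs_div_sub_div_le {c k u v Z : ℝ} (hc : 0 < c) (hk : 0 ≤ k) (hkZ : k ≤ Z)
    (hu : c ≤ u) (hv : c ≤ v) : |k / u - k / v| ≤ 1 / c ^ 2 * Z * |u - v| := by
  have hu0 := hc.trans_le hu
  have hv0 := hc.trans_le hv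
  have h1 : k / u - k / v = k * (v - u) / (u * v) := by field_simp
  rw [h1, abs_div, abs_mul, abs_of_nonneg hk, abs_of_pos (mul_pos hu0 hv0), abs_sub_comm v u]
  have h2 : c ^ 2 ≤ u * v := by nlinarith
  have hZ : 0 ≤ Z := hk.trans hkZ
  calc k * |u - v| / (u * v) ≤ Z * |u - v| / c ^ 2 := by gcongr
    _ = _ := by ring

theorem abs_mul_sub_mul_le {x x' y y' Z e₁ e₂ K₁ K₂ : ℝ} (hx : |x - x'| ≤ e₁) (hy : |y| ≤ Z)
    (hx' : |x'| ≤ K₁) (hyy : |y - y'| ≤ e₂) (he₁ : e₁ * Z ≤ K₂) :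
    |x * y - x' * y'| ≤ K₂ + K₁ * e₂ := by
  have h1 : x * y - x' * y' = (x - x') * y + x' * (y - y') := by ring
  rw [h1]
  refine (abs_add_le _ _).trans ?_
  rw [abs_mul, abs_mul]
  have h2 : |x - x'| * |y| ≤ e₁ * Z :=
    mul_le_mul hx hy (abs_nonneg _) ((abs_nonneg _).trans hx)
  have h3 : |x'| * |y - y'| ≤ K₁ * e₂ :=
    mul_le_mul hx' hyy (abs_nonneg _) ((abs_nonneg _).trans hx')
  linarith

section Score

variable {d : ℕ} {Θ U : Set (Param d)} {f : Param d → (ℕ → ℕ) → ℝ} {c C : ℝ} {a A : ℕ → ℝ}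
  {θ θ' : Param d} {p p' : ℕ → ℕ} {Z : ℝ} {k : ℕ}

namespace ModelBounds

/-- The constant in the Lipschitz bounds for the score. -/
def scoreConst (c : ℝ) : ℝ := 1 / c ^ 2 + (1 / c + 1)

theorem scoreConst_nonneg (hM : ModelBounds Θ f c C a A) : 0 ≤ scoreConst c := by
  have := hM.c_pos
  unfold scoreConst
  positivity

/-- In the product rule each term carries two powers of the envelope: one from the observation, and
one from the derivative or from `1 ≤ Z`. -/
theorem abs_score_sub_le_tailSum (hM : ModelBounds Θ f c C a A) (hU : IsOpen U) (hUΘ : U ⊆ Θ)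
    (hθ : θ ∈ U) (i : Fin d) (hp : LagSummable A p) (hpZ : C + lagSum A p ≤ Z)
    (hkZ : (k : ℝ) ≤ Z) (n : ℕ) :
    |score f i θ k (cutPast n p) - score f i θ k p| ≤ scoreConst c * Z ^ 2 * tailSum a n p := by
  have hZ : 1 ≤ Z := (hM.one_le_C.trans (le_add_of_nonneg_right
    (lagSum_nonneg hM.A_nonneg))).trans hpZ
  have hc := hM.c_pos
  have hcut : ∀ k < n, cutPast n p k = p k := fun k hk => by simp [cutPast, hk]
  have ht := tailSum_nonneg hM.a_nonneg n (p := p)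
  have h1 := abs_div_sub_div_le hc (Nat.cast_nonneg k) hkZ (hM.lower θ (hUΘ hθ) (cutPast n p))
    (hM.lower θ (hUΘ hθ) p)
  have h2 := hM.abs_sub_le (hUΘ hθ) (LagSummable.cut n) hp hcut
  have h3 := hM.abs_fd1_sub_le hU hUΘ hθ i (LagSummable.cut n) hp hcut
  rw [tailSum_cut, zero_add] at h2 h3
  have h4 := (hM.abs_fd1_le hU hUΘ hθ i (LagSummable.cut (p := p) n)).trans
    ((add_le_add le_rfl (lagSum_cut_le hp hM.A_nonneg n)).trans hpZ)
  have h5 := abs_div_sub_one_le hc (Nat.cast_nonneg k) hkZ hZ (hM.lower θ (hUΘ hθ) p)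
  have h6 : |((k : ℝ) / f θ (cutPast n p) - 1) - ((k : ℝ) / f θ p - 1)|
      ≤ 1 / c ^ 2 * Z * tailSum a n p := by
    rw [sub_sub_sub_cancel_right]
    exact h1.trans (mul_le_mul_of_nonneg_left h2 (by positivity))
  refine (abs_mul_sub_mul_le h6 h4 h5 h3 le_rfl).trans ?_
  have h7 : (1 / c + 1) * Z * tailSum a n p ≤ (1 / c + 1) * Z ^ 2 * tailSum a n p := by
    gcongr
    nlinarith
  unfold scoreConst
  linarith [h7]

/-- Increments in the parameter are themselves proportional to the envelope, by the mean value
inequality. This costs one power more than a change of the past. -/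
theorem abs_score_sub_le_norm (hM : ModelBounds Θ f c C a A) (hU : IsOpen U) (hUΘ : U ⊆ Θ)
    (hUc : Convex ℝ U) (hθ : θ ∈ U) (hθ' : θ' ∈ U) (i : Fin d) (hp : LagSummable A p)
    (hpZ : C + lagSum A p ≤ Z) (hkZ : (k : ℝ) ≤ Z) :
    |score f i θ k p - score f i θ' k p| ≤ scoreConst c * Z ^ 3 * ‖θ - θ'‖ := by
  have hZ : 1 ≤ Z := (hM.one_le_C.trans (le_add_of_nonneg_right
    (lagSum_nonneg hM.A_nonneg))).trans hpZ
  have hc := hM.c_pos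
  have hn := norm_nonneg (θ - θ')
  have h1 := abs_div_sub_div_le hc (Nat.cast_nonneg k) hkZ (hM.lower θ (hUΘ hθ) p)
    (hM.lower θ' (hUΘ hθ') p)
  have h2 := (hM.abs_sub_le_mul_norm hU hUΘ hUc hθ hθ' hp).trans
    (mul_le_mul_of_nonneg_right hpZ hn)
  have h3 := (hM.abs_fd1_sub_le_mul_norm hU hUΘ hUc hθ hθ' i hp).trans
    (mul_le_mul_of_nonneg_right hpZ hn)
  have h4 := (hM.abs_fd1_le hU hUΘ hθ i hp).trans hpZ
  have h5 := abs_div_sub_one_le hc (Nat.cast_nonneg k) hkZ hZ (hM.lower θ' (hUΘ hθ') p)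
  have h6 : |((k : ℝ) / f θ p - 1) - ((k : ℝ) / f θ' p - 1)|
      ≤ 1 / c ^ 2 * Z * (Z * ‖θ - θ'‖) := by
    rw [sub_sub_sub_cancel_right]
    exact h1.trans (mul_le_mul_of_nonneg_left h2 (by positivity))
  refine (abs_mul_sub_mul_le h6 h4 h5 h3 le_rfl).trans ?_
  have h7 : (1 / c + 1) * Z * (Z * ‖θ - θ'‖) ≤ (1 / c + 1) * Z ^ 3 * ‖θ - θ'‖ := by
    have : (1 / c + 1) * Z * (Z * ‖θ - θ'‖) = (1 / c + 1) * Z ^ 2 * ‖θ - θ'‖ := by ring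
    rw [this]
    gcongr
    norm_num
  have h8 : 1 / c ^ 2 * Z * (Z * ‖θ - θ'‖) * Z = 1 / c ^ 2 * Z ^ 3 * ‖θ - θ'‖ := by ring
  unfold scoreConst
  rw [h8]
  linarith [h7]

theorem measurable_score (hM : ModelBounds Θ f c C a A) (hU : IsOpen U) (hUΘ : U ⊆ Θ)
    (hθ : θ ∈ U) (i : Fin d) : Measurable fun q : ℕ × (ℕ → ℕ) => score f i θ q.1 q.2 :=
  ((((measurable_from_top (f := fun n : ℕ => (n : ℝ))).comp measurable_fst).div
    ((hM.measurable θ (hUΘ hθ)).comp measurable_snd)).sub_const 1).mul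
    ((hM.measurable_fd1 hU hUΘ hθ i).comp measurable_snd)

end ModelBounds

end Score

/-! ### Second moments of the score -/

section ScoreMoments

variable {Ω : Type*} [mΩ : MeasurableSpace Ω] {μ : Measure Ω} [IsProbabilityMeasure μ]

/-- If the conditional expectation of `D`, weighted with a function of the conditioning variables,
is integrable, then so is the weighted `D`. -/
theorem integrable_mul_of_condExp {m : MeasurableSpace Ω} (hm : m ≤ mΩ) {W D : Ω → ℝ}
    (hW : StronglyMeasurable[m] W) (hW0 : ∀ ω, 0 ≤ W ω) (hD0 : ∀ ω, 0 ≤ D ω)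
    (hD : Integrable D μ) (hWD : Integrable (fun ω => W ω * (μ[D | m]) ω) μ) :
    Integrable (fun ω => W ω * D ω) μ := by
  -- For bounded weights the pull-out property is available; Fatou's lemma then removes the
  -- truncation.
  set V : ℕ → Ω → ℝ := fun n ω => min (W ω) n with hV
  have hV0 : ∀ n ω, 0 ≤ V n ω := fun n ω => le_min (hW0 ω) (Nat.cast_nonneg n)
  have hVm : ∀ n, StronglyMeasurable[m] (V n) := fun n => hW.inf stronglyMeasurable_const
  have hc0 : 0 ≤ᵐ[μ] μ[D | m] := condExp_nonneg (Eventually.of_forall hD0)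
  have hVD : ∀ n, Integrable (fun ω => V n ω * D ω) μ := fun n =>
    hD.bdd_mul (c := n) ((hVm n).mono hm).aestronglyMeasurable (Eventually.of_forall fun ω => by
      rw [Real.norm_of_nonneg (hV0 n ω)]
      exact min_le_right _ _)
  have hVc : ∀ n, Integrable (fun ω => V n ω * (μ[D | m]) ω) μ := fun n =>
    integrable_condExp.bdd_mul (c := n) ((hVm n).mono hm).aestronglyMeasurable
      (Eventually.of_forall fun ω => by
        rw [Real.norm_of_nonneg (hV0 n ω)]
        exact min_le_right _ _)
  have hle : ∀ n, ∫ ω, V n ω * D ω ∂μ ≤ ∫ ω, W ω * (μ[D | m]) ω ∂μ := by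
    intro n
    have h1 : μ[V n * D | m] =ᵐ[μ] V n * μ[D | m] :=
      condExp_mul_of_stronglyMeasurable_left (hVm n) (hVD n) hD
    have h2 := integral_condExp (μ := μ) (f := V n * D) hm
    rw [integral_congr_ae h1] at h2
    refine le_of_eq_of_le h2.symm (integral_mono_ae (hVc n) hWD ?_)
    filter_upwards [hc0] with ω h0
    exact mul_le_mul_of_nonneg_right (min_le_left _ _) h0
  refine ⟨((hW.mono hm).aestronglyMeasurable).mul hD.1, ?_⟩
  rw [hasFiniteIntegral_iff_ofReal (Eventually.of_forall fun ω => mul_nonneg (hW0 ω) (hD0 ω))]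
  have hlim : ∀ ω, Tendsto (fun n => ENNReal.ofReal (V n ω * D ω)) atTop
      (𝓝 (ENNReal.ofReal (W ω * D ω))) := fun ω => by
    refine tendsto_const_nhds.congr' ?_
    obtain ⟨N, hN⟩ := exists_nat_ge (W ω)
    filter_upwards [eventually_ge_atTop N] with n hn
    have : W ω ≤ n := hN.trans (by exact_mod_cast hn)
    simp only [hV, min_eq_left this]
  refine lt_of_le_of_lt ?_ (ENNReal.ofReal_lt_top (r := ∫ ω, W ω * (μ[D | m]) ω ∂μ))
  calc ∫⁻ ω, ENNReal.ofReal (W ω * D ω) ∂μ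
      = ∫⁻ ω, liminf (fun n => ENNReal.ofReal (V n ω * D ω)) atTop ∂μ :=
        lintegral_congr fun ω => (hlim ω).liminf_eq.symm
    _ ≤ liminf (fun n => ∫⁻ ω, ENNReal.ofReal (V n ω * D ω) ∂μ) atTop :=
        lintegral_liminf_le' fun n => (hVD n).1.aemeasurable.ennreal_ofReal
    _ ≤ _ := by
        refine liminf_le_of_frequently_le' (Frequently.of_forall fun n => ?_)
        rw [← ofReal_integral_eq_lintegral_ofReal (hVD n)
          (Eventually.of_forall fun ω => mul_nonneg (hV0 n ω) (hD0 ω))]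
        exact ENNReal.ofReal_le_ofReal (hle n)

end ScoreMoments

/-! ### The score along a process: second moments, centring and growth. -/

section ScoreProcess

variable {Ω : Type*} {d : ℕ} {Θ U : Set (Param d)} {f : Param d → (ℕ → ℕ) → ℝ} {c C p : ℝ}
  {a A : ℕ → ℝ} {θ : Param d} {Y : ℤ → Ω → ℕ}

theorem past_eq_trajectory (Y : ℤ → Ω → ℕ) (t : ℤ) (ω : Ω) :
    past Y t ω = pastPath (shiftPath t (trajectory Y ω)) := past_eq_pastPath Y t ω

theorem pastPath_trajectory (Y : ℤ → Ω → ℕ) (ω : Ω) : pastPath (trajectory Y ω) = past Y 0 ω := by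
  rw [past_eq_trajectory, shiftPath_zero]

theorem pastSigma_mono (Y : ℤ → Ω → ℕ) {s t : ℤ} (h : s ≤ t) : pastSigma Y s ≤ pastSigma Y t :=
  biSup_mono fun _ hr => Set.Iio_subset_Iio h hr

namespace IsODProcess

theorem measurable_fd1_past (hM : ModelBounds Θ f c C a A) (hU : IsOpen U) (hUΘ : U ⊆ Θ)
    (hθ : θ ∈ U) (i : Fin d) (t : ℤ) :
    Measurable[pastSigma Y t] fun ω => fd1 f i θ (past Y t ω) :=
  (hM.measurable_fd1 hU hUΘ hθ i).comp (measurable_past t)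

theorem measurable_past_model (hM : ModelBounds Θ f c C a A) (hθ : θ ∈ Θ) (t : ℤ) :
    Measurable[pastSigma Y t] fun ω => f θ (past Y t ω) :=
  (hM.measurable θ hθ).comp (measurable_past t)

theorem score_eq (hM : ModelBounds Θ f c C a A) (hθ : θ ∈ Θ) (i : Fin d) (k : ℕ) (p : ℕ → ℕ) :
    score f i θ k p = (f θ p)⁻¹ * fd1 f i θ p * ((k : ℝ) - f θ p) := by
  have := (hM.pos hθ p).ne'
  unfold score
  field_simp

variable [mΩ : MeasurableSpace Ω] {μ : Measure Ω}

/-- The squared deviation from the conditional mean. -/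
theorem condVar_ae_eq (hY : IsODProcess μ f θ Y) (t : ℤ) :
    Var[fun ω => (Y t ω : ℝ); μ | pastSigma Y t]
      =ᵐ[μ] μ[fun ω => ((Y t ω : ℝ) - f θ (past Y t ω)) ^ 2 | pastSigma Y t] := by
  refine condExp_congr_ae ?_
  filter_upwards [hY.condExp_eq t] with ω hω
  simp only [Pi.pow_apply, Pi.sub_apply, hω]

theorem integrandI_ae_eq (hM : ModelBounds Θ f c C a A) (hY : IsODProcess μ f θ Y)
    (hU : IsOpen U) (hUΘ : U ⊆ Θ) (hθ : θ ∈ U) (t : ℤ) (i j : Fin d) :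
    integrandI μ Θ f θ Y t i j =ᵐ[μ] fun ω =>
      ((f θ (past Y t ω))⁻¹ * fd1 f i θ (past Y t ω) * ((f θ (past Y t ω))⁻¹
        * fd1 f j θ (past Y t ω))) *
        (μ[fun ω => ((Y t ω : ℝ) - f θ (past Y t ω)) ^ 2 | pastSigma Y t]) ω := by
  filter_upwards [condVar_ae_eq hY t] with ω hω
  have h1 : ∀ i, pderiv Θ (lam f Y t ω) i θ = fd1 f i θ (past Y t ω) := fun i =>
    ModelBounds.pderiv_eq_fd1 hU hUΘ hθ i (past Y t ω)
  rw [integrandI, hω, h1, h1]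
  simp only [lam]
  have := (hM.pos (hUΘ hθ) (past Y t ω)).ne'
  field_simp

variable [IsProbabilityMeasure μ]

theorem integrable_model (hM : ModelBounds Θ f c C a A) (hY : IsODProcess μ f θ Y)
    (hE : EnvelopeMoment (pathLaw μ Y) C A p) (t : ℤ) :
    Integrable (fun ω => (Y t ω : ℝ)) μ ∧ Integrable (fun ω => (Y t ω : ℝ) ^ 2) μ ∧
      (θ ∈ Θ → Integrable (fun ω => f θ (past Y t ω)) μ ∧
        Integrable (fun ω => f θ (past Y t ω) ^ 2) μ) := by
  have hZ1 : Integrable (fun y => envelope C A y) (pathLaw μ Y) := by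
    simpa using hE.integrable_pow (j := 1) (by norm_num)
  have hZ2 := hE.integrable_pow (j := 2) (by norm_num)
  have hi1 := hY.integrable_path_shift t hZ1
  have hi2 := hY.integrable_path_shift t hZ2
  have hle : ∀ ω, (Y t ω : ℝ) ≤ envelope C A (shiftPath t (trajectory Y ω)) := fun ω => by
    have := hE.coord_le (shiftPath t (trajectory Y ω))
    simpa [shiftPath, trajectory] using this
  have hm : Measurable fun ω => (Y t ω : ℝ) :=
    (measurable_from_top (f := fun n : ℕ => (n : ℝ))).comp (hY.measurable t)
  refine ⟨hi1.mono' hm.aestronglyMeasurable (Eventually.of_forall fun ω => ?_),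
    hi2.mono' (hm.pow_const 2).aestronglyMeasurable (Eventually.of_forall fun ω => ?_),
    fun hθ => ?_⟩
  · rw [Real.norm_of_nonneg (Nat.cast_nonneg _)]
    exact hle ω
  · rw [Real.norm_of_nonneg (sq_nonneg _)]
    exact pow_le_pow_left₀ (Nat.cast_nonneg _) (hle ω) 2
  · have hfm : Measurable fun ω => f θ (past Y t ω) :=
      (measurable_past_model hM hθ t).mono (pastSigma_le hY.measurable t) le_rfl
    have hb : ∀ᵐ ω ∂μ, |f θ (past Y t ω)| ≤ envelope C A (shiftPath t (trajectory Y ω)) := by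
      filter_upwards [hY.ae_path hE.ae_lagSummable] with ω hω
      rw [past_eq_trajectory]
      exact (hM.abs_le hθ (hω t)).trans (EnvelopeMoment.lag_le _)
    refine ⟨hi1.mono' hfm.aestronglyMeasurable hb,
      hi2.mono' (hfm.pow_const 2).aestronglyMeasurable ?_⟩
    filter_upwards [hb] with ω hω
    rw [Real.norm_of_nonneg (sq_nonneg _), ← sq_abs]
    exact pow_le_pow_left₀ (abs_nonneg _) hω 2

theorem integrable_sq_sub (hM : ModelBounds Θ f c C a A) (hY : IsODProcess μ f θ Y)
    (hE : EnvelopeMoment (pathLaw μ Y) C A p) (hθ : θ ∈ Θ) (t : ℤ) :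
    Integrable (fun ω => ((Y t ω : ℝ) - f θ (past Y t ω)) ^ 2) μ := by
  obtain ⟨h1, h2, h3⟩ := hY.integrable_model hM hE t
  obtain ⟨h3, h4⟩ := h3 hθ
  have hY2 : MemLp (fun ω => (Y t ω : ℝ)) 2 μ := (memLp_two_iff_integrable_sq h1.1).2 h2
  have hf2 : MemLp (fun ω => f θ (past Y t ω)) 2 μ := (memLp_two_iff_integrable_sq h3.1).2 h4
  exact (hY2.sub hf2).integrable_sq

variable (hM : ModelBounds Θ f c C a A) (hY : IsODProcess μ f θ Y)
  (hE : EnvelopeMoment (pathLaw μ Y) C A p) (hU : IsOpen U) (hUΘ : U ⊆ Θ) (hθ : θ ∈ U)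

include hM hY hE hU hUΘ hθ

/-- The envelope alone is not enough: it bounds the squared score by a fourth power, whereas only a
moment of some order above `3` is at hand. Instead, the diagonal integrand of `I` is the conditional
second moment of the score, and its integrability is assumed. -/
theorem memLp_score (hI : ∀ i, Integrable (integrandI μ Θ f θ Y 0 i i) μ) (i : Fin d) :
    MemLp (fun y => score f i θ (y 0) (pastPath y)) 2 (pathLaw μ Y) := by
  have hmP : Measurable fun y : ℤ → ℕ => score f i θ (y 0) (pastPath y) :=
    (hM.measurable_score hU hUΘ hθ i).comp measurable_pair
  have hm := pastSigma_le hY.measurable 0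
  have hW : StronglyMeasurable[pastSigma Y 0] fun ω =>
      ((f θ (past Y 0 ω))⁻¹ * fd1 f i θ (past Y 0 ω)) ^ 2 :=
    (((measurable_past_model hM (hUΘ hθ) 0).inv.mul
      (measurable_fd1_past hM hU hUΘ hθ i 0)).pow_const 2).stronglyMeasurable
  have h := integrable_mul_of_condExp hm hW (fun ω => sq_nonneg _) (fun ω => sq_nonneg _)
    (hY.integrable_sq_sub hM hE (hUΘ hθ) 0) (((hI i).congr
      (integrandI_ae_eq hM hY hU hUΘ hθ 0 i i)).congr (Eventually.of_forall fun ω => by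
        simp only [sq]))
  rw [memLp_two_iff_integrable_sq hmP.aestronglyMeasurable]
  refine (integrable_map_measure (hmP.pow_const 2).aestronglyMeasurable
    hY.measurable_trajectory.aemeasurable).2 (h.congr (Eventually.of_forall fun ω => ?_))
  simp only [Function.comp_apply, pastPath_trajectory, score_eq hM (hUΘ hθ), trajectory]
  ring

/-- Conditioning on the past replaces the squared innovation by the conditional variance. -/
theorem integral_score_mul_score (hI : ∀ i, Integrable (integrandI μ Θ f θ Y 0 i i) μ)
    (i j : Fin d) :
    ∫ y, score f i θ (y 0) (pastPath y) * score f j θ (y 0) (pastPath y) ∂(pathLaw μ Y)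
      = matrixI μ Θ f θ Y i j := by
  have hmP : ∀ i, Measurable fun y : ℤ → ℕ => score f i θ (y 0) (pastPath y) := fun i =>
    (hM.measurable_score hU hUΘ hθ i).comp measurable_pair
  have hm := pastSigma_le hY.measurable 0
  have hint : Integrable (fun y => score f i θ (y 0) (pastPath y)
      * score f j θ (y 0) (pastPath y)) (pathLaw μ Y) :=
    (hY.memLp_score hM hE hU hUΘ hθ hI i).integrable_mul (hY.memLp_score hM hE hU hUΘ hθ hI j)
  have hWi : ∀ i, Measurable[pastSigma Y 0] fun ω =>
      (f θ (past Y 0 ω))⁻¹ * fd1 f i θ (past Y 0 ω) := fun i =>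
    (measurable_past_model hM (hUΘ hθ) 0).inv.mul (measurable_fd1_past hM hU hUΘ hθ i 0)
  set W : Ω → ℝ := fun ω => (f θ (past Y 0 ω))⁻¹ * fd1 f i θ (past Y 0 ω)
    * ((f θ (past Y 0 ω))⁻¹ * fd1 f j θ (past Y 0 ω)) with hWdef
  set D : Ω → ℝ := fun ω => ((Y 0 ω : ℝ) - f θ (past Y 0 ω)) ^ 2 with hD
  have heq : ∀ ω, score f i θ (trajectory Y ω 0) (pastPath (trajectory Y ω))
      * score f j θ (trajectory Y ω 0) (pastPath (trajectory Y ω)) = W ω * D ω := fun ω => by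
    simp only [pastPath_trajectory, score_eq hM (hUΘ hθ), hWdef, hD, trajectory]
    ring
  have hWD : Integrable (W * D) μ :=
    (hY.integrable_path hint).congr (Eventually.of_forall heq)
  have hmm : Measurable fun y : ℤ → ℕ => score f i θ (y 0) (pastPath y)
      * score f j θ (y 0) (pastPath y) := (hmP i).mul (hmP j)
  rw [hY.integral_path hmm]
  simp_rw [heq]
  have h1 : μ[W * D | pastSigma Y 0] =ᵐ[μ] W * μ[D | pastSigma Y 0] :=
    condExp_mul_of_stronglyMeasurable_left ((hWi i).mul (hWi j)).stronglyMeasurable hWD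
      (hY.integrable_sq_sub hM hE (hUΘ hθ) 0)
  have h2 := integral_condExp (μ := μ) (f := W * D) hm
  rw [integral_congr_ae h1] at h2
  refine h2.symm.trans ?_
  rw [matrixI, Matrix.of_apply]
  exact integral_congr_ae (integrandI_ae_eq hM hY hU hUΘ hθ 0 i j).symm

/-- The score is a function of the past times the innovation `Y t - f θ (past Y t)`, which is
centred given the past. -/
theorem condExp_score (hI : ∀ i, Integrable (integrandI μ Θ f θ Y 0 i i) μ) (i : Fin d) (t : ℤ) :
    μ[fun ω => score f i θ (Y t ω) (past Y t ω) | pastSigma Y t] =ᵐ[μ] 0 := by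
  obtain ⟨h1, -, h3⟩ := hY.integrable_model hM hE t
  obtain ⟨h3, -⟩ := h3 (hUΘ hθ)
  have hm := pastSigma_le hY.measurable t
  set W : Ω → ℝ := fun ω => (f θ (past Y t ω))⁻¹ * fd1 f i θ (past Y t ω) with hW
  set D : Ω → ℝ := fun ω => (Y t ω : ℝ) - f θ (past Y t ω) with hD
  have hWm : Measurable[pastSigma Y t] W :=
    (measurable_past_model hM (hUΘ hθ) t).inv.mul (measurable_fd1_past hM hU hUΘ hθ i t)
  have hfm : Measurable[pastSigma Y t] fun ω => f θ (past Y t ω) :=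
    measurable_past_model hM (hUΘ hθ) t
  have heq : (fun ω => score f i θ (Y t ω) (past Y t ω)) = W * D := by
    funext ω
    simp only [score_eq hM (hUΘ hθ), Pi.mul_apply, hW, hD]
  have hsc : Integrable (fun ω => score f i θ (Y t ω) (past Y t ω)) μ := by
    have := hE.stationary.prob
    have := hY.integrable_path_shift t
      ((hY.memLp_score hM hE hU hUΘ hθ hI i).integrable (by norm_num))
    simpa [shiftPath, trajectory, past_eq_trajectory] using this
  rw [heq] at hsc ⊢
  have hDi : Integrable D μ := h1.sub h3
  have hDc : μ[D | pastSigma Y t] =ᵐ[μ] 0 := by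
    have h4 : μ[D | pastSigma Y t] =ᵐ[μ] _ := condExp_sub h1 h3 (pastSigma Y t)
    have h5 := condExp_of_stronglyMeasurable hm hfm.stronglyMeasurable h3
    filter_upwards [h4, hY.condExp_eq t] with ω h4 h6
    rw [h4, Pi.sub_apply, h6, h5]
    simp
  filter_upwards [condExp_mul_of_stronglyMeasurable_left hWm.stronglyMeasurable hsc hDi, hDc]
    with ω h4 h5
  rw [h4, Pi.mul_apply, h5]
  simp

/-- The growth of the score at the true parameter. -/
theorem ae_abs_sum_score_le (hI : ∀ i, Integrable (integrandI μ Θ f θ Y 0 i i) μ) (i : Fin d)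
    {σ : ℝ} (hσ : 1 / 2 < σ) :
    ∀ᵐ ω ∂μ, ∃ K ≥ 0, ∀ n : ℕ, 1 ≤ n →
      |∑ t ∈ Finset.Icc 1 n, score f i θ (trajectory Y ω t)
        (pastPath (shiftPath t (trajectory Y ω)))| ≤ K * (n : ℝ) ^ σ := by
  have hprob := hE.stationary.prob
  have hL := hY.memLp_score hM hE hU hUΘ hθ hI i
  have hscm : Measurable fun y : ℤ → ℕ => score f i θ (y 0) (pastPath y) :=
    (hM.measurable_score hU hUΘ hθ i).comp measurable_pair
  -- The σ-field with index `n` must contain `Y n`, hence the time `n + 1` in `pastSigma`; it is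
  -- also the σ-field on which the score at time `n + 1` is conditioned.
  let ℱ : Filtration ℕ mΩ :=
    { seq := fun n => pastSigma Y ((n : ℤ) + 1)
      mono' := fun n n' h => pastSigma_mono Y (by lia)
      le' := fun n => pastSigma_le hY.measurable _ }
  refine ae_abs_sum_le_rpow (ℱ := ℱ)
    (ξ := fun n ω => score f i θ (trajectory Y ω n) (pastPath (shiftPath n (trajectory Y ω))))
    (B := ∫ y, score f i θ (y 0) (pastPath y) ^ 2 ∂(pathLaw μ Y)) (fun n => ?_) (fun n => ?_)
    (fun n => ?_) (fun n => le_of_eq ?_) hσ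
  · have h1 : Measurable[pastSigma Y ((n : ℤ) + 1)] (Y n) := measurable_of_lt (by lia)
    have h2 : Measurable[pastSigma Y ((n : ℤ) + 1)] (past Y n) :=
      (measurable_past (n : ℤ)).mono (pastSigma_mono Y (by lia)) le_rfl
    have h3 : Measurable[pastSigma Y ((n : ℤ) + 1)] fun ω => (Y n ω, past Y n ω) :=
      h1.prodMk h2
    have h4 := ((hM.measurable_score hU hUΘ hθ i).comp h3).stronglyMeasurable
    simp only [past_eq_trajectory] at h4
    exact h4
  · have h1 : MemLp _ 2 μ := ((hL.comp_measurePreserving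
      (hE.stationary.measurePreserving (n : ℤ)))).comp_of_map
        hY.measurable_trajectory.aemeasurable
    refine h1.congr_norm ?_ (Eventually.of_forall fun ω => ?_)
    · exact ((hscm.comp (measurable_shiftPath n)).comp
        hY.measurable_trajectory).aestronglyMeasurable.congr (Eventually.of_forall fun ω => by
          simp [shiftPath])
    · simp [shiftPath]
  · have h1 := hY.condExp_score hM hE hU hUΘ hθ hI i ((n : ℤ) + 1)
    simp only [past_eq_trajectory] at h1
    simpa [trajectory] using h1
  · have h1 := hY.integral_path_shift (n : ℤ) (hscm.pow_const 2)
    rw [← h1]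
    simp [shiftPath]

end IsODProcess

end ScoreProcess

/-! ### The Hessian and the information matrix -/

/-- The second partial derivatives of the quasi-log-likelihood contribution of one observation. -/
def hess {d : ℕ} (f : Param d → (ℕ → ℕ) → ℝ) (i j : Fin d) (θ : Param d) (k : ℕ)
    (p : ℕ → ℕ) : ℝ :=
  ((k : ℝ) / f θ p - 1) * fd2 f i j θ p - (k : ℝ) / f θ p ^ 2 * (fd1 f i θ p * fd1 f j θ p)

/-- The integrand of the information matrix as a function of the past. -/
def infoJ {d : ℕ} (f : Param d → (ℕ → ℕ) → ℝ) (i j : Fin d) (θ : Param d) (p : ℕ → ℕ) : ℝ :=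
  (f θ p)⁻¹ * (fd1 f i θ p * fd1 f j θ p)

/-- The information matrix on the path space. -/
def matrixJ {d : ℕ} (f : Param d → (ℕ → ℕ) → ℝ) (θ : Param d) (P : Measure (ℤ → ℕ)) :
    Matrix (Fin d) (Fin d) ℝ :=
  Matrix.of fun i j => ∫ y, infoJ f i j θ (pastPath y) ∂P

/-- A positive definite quadratic form is bounded below on the unit sphere. -/
theorem exists_pos_le_quadratic {d : ℕ} (J : Fin d → Fin d → ℝ)
    (hJ : ∀ u : Param d, u ≠ 0 → 0 < ∑ i, ∑ j, u i * u j * J i j) :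
    ∃ κ > 0, ∀ u : Param d, κ * ‖u‖ ^ 2 ≤ ∑ i, ∑ j, u i * u j * J i j := by
  have hcont : Continuous fun u : Param d => ∑ i, ∑ j, u i * u j * J i j := by fun_prop
  -- The unit sphere is empty only in dimension `0`. Otherwise the form attains a positive minimum
  -- on it, and homogeneity does the rest.
  rcases (Metric.sphere (0 : Param d) 1).eq_empty_or_nonempty with he | hne
  · refine ⟨1, one_pos, fun u => ?_⟩
    have hu : u = 0 := by
      by_contra h
      have : (‖u‖⁻¹ • u) ∈ Metric.sphere (0 : Param d) 1 := by
        simp [norm_smul, inv_mul_cancel₀ (norm_ne_zero_iff.2 h)]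
      rw [he] at this
      exact this
    simp [hu]
  · obtain ⟨z, hz, hmin⟩ := (isCompact_sphere (0 : Param d) 1).exists_isMinOn hne hcont.continuousOn
    have hz0 : z ≠ 0 := by
      rintro rfl
      simp at hz
    refine ⟨_, hJ z hz0, fun u => ?_⟩
    rcases eq_or_ne u 0 with rfl | hu
    · simp
    · have hn := norm_ne_zero_iff.2 hu
      have h1 : ‖u‖⁻¹ • u ∈ Metric.sphere (0 : Param d) 1 := by
        simp [norm_smul, inv_mul_cancel₀ hn]
      have h2 := isMinOn_iff.1 hmin _ h1
      have h3 : ∑ i, ∑ j, (‖u‖⁻¹ • u) i * (‖u‖⁻¹ • u) j * J i j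
          = (‖u‖ ^ 2)⁻¹ * ∑ i, ∑ j, u i * u j * J i j := by
        rw [Finset.mul_sum]
        refine Finset.sum_congr rfl fun i _ => ?_
        rw [Finset.mul_sum]
        refine Finset.sum_congr rfl fun j _ => ?_
        simp only [PiLp.smul_apply, smul_eq_mul]
        ring
      rw [h3] at h2
      have h4 : 0 < ‖u‖ ^ 2 := by positivity
      rwa [le_inv_mul_iff₀ h4, mul_comm] at h2

section Hessian

variable {d : ℕ} {Θ U : Set (Param d)} {f : Param d → (ℕ → ℕ) → ℝ} {c C : ℝ} {a A : ℕ → ℝ}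
  {θ : Param d} {p : ℕ → ℕ} {Z : ℝ} {k : ℕ}

/-- Joint convergence in the parameter and the truncation length follows from continuity at the full
past and a truncation error which is uniform in the parameter. -/
theorem tendsto_cutPast_of_le {g : Param d → (ℕ → ℕ) → ℝ} {e : ℕ → ℝ} (hθ : θ ∈ U)
    (hc : ContinuousOn (fun θ => g θ p) U)
    (hg : ∀ θ ∈ U, ∀ n, |g θ (cutPast n p) - g θ p| ≤ e n) (he : Tendsto e atTop (𝓝 0)) :
    Tendsto (fun q : Param d × ℕ => g q.1 (cutPast q.2 p)) (𝓝[U] θ ×ˢ atTop) (𝓝 (g θ p)) := by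
  have h1 : Tendsto (fun q : Param d × ℕ => g q.1 p) (𝓝[U] θ ×ˢ atTop) (𝓝 (g θ p)) :=
    (hc θ hθ).tendsto.comp tendsto_fst
  have h2 : Tendsto (fun q : Param d × ℕ => g q.1 (cutPast q.2 p) - g q.1 p)
      (𝓝[U] θ ×ˢ atTop) (𝓝 0) := by
    refine squeeze_zero_norm' ?_ (he.comp tendsto_snd)
    have hU : ∀ᶠ q : Param d × ℕ in 𝓝[U] θ ×ˢ atTop, q.1 ∈ U :=
      tendsto_fst.eventually self_mem_nhdsWithin
    filter_upwards [hU] with q hq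
    exact hg q.1 hq q.2
  simpa using h2.add h1

namespace ModelBounds

theorem tendsto_cutPast (hM : ModelBounds Θ f c C a A) (hUΘ : U ⊆ Θ) (hθ : θ ∈ U)
    (hp : LagSummable A p) :
    Tendsto (fun q : Param d × ℕ => f q.1 (cutPast q.2 p)) (𝓝[U] θ ×ˢ atTop) (𝓝 (f θ p)) := by
  refine tendsto_cutPast_of_le (e := fun n => tailSum a n p) hθ ((hM.continuousOn p).mono hUΘ)
    (fun θ' hθ' n => ?_) (tendsto_tailSum a p)
  have := hM.abs_sub_le (hUΘ hθ') (LagSummable.cut n) hp (p := cutPast n p) (n := n)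
    fun k hk => by simp [cutPast, hk]
  rwa [tailSum_cut, zero_add] at this

theorem tendsto_fd1_cutPast (hM : ModelBounds Θ f c C a A) (hU : IsOpen U) (hUΘ : U ⊆ Θ)
    (hθ : θ ∈ U) (i : Fin d) (hp : LagSummable A p) :
    Tendsto (fun q : Param d × ℕ => fd1 f i q.1 (cutPast q.2 p)) (𝓝[U] θ ×ˢ atTop)
      (𝓝 (fd1 f i θ p)) := by
  refine tendsto_cutPast_of_le (e := fun n => tailSum a n p) hθ (hM.continuousOn_fd1 hU hUΘ i p)
    (fun θ' hθ' n => ?_) (tendsto_tailSum a p)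
  have := hM.abs_fd1_sub_le hU hUΘ hθ' i (LagSummable.cut n) hp (p := cutPast n p) (n := n)
    fun k hk => by simp [cutPast, hk]
  rwa [tailSum_cut, zero_add] at this

theorem tendsto_fd2_cutPast (hM : ModelBounds Θ f c C a A) (hU : IsOpen U) (hUΘ : U ⊆ Θ)
    (hθ : θ ∈ U) (i j : Fin d) (hp : LagSummable A p) :
    Tendsto (fun q : Param d × ℕ => fd2 f i j q.1 (cutPast q.2 p)) (𝓝[U] θ ×ˢ atTop)
      (𝓝 (fd2 f i j θ p)) := by
  refine tendsto_cutPast_of_le (e := fun n => tailSum A n p) hθ (hM.continuousOn_fd2 hU hUΘ i j p)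
    (fun θ' hθ' n => ?_) (tendsto_tailSum A p)
  have := hM.abs_fd2_sub_le hU hUΘ hθ' i j (LagSummable.cut n) hp (p := cutPast n p) (n := n)
    fun k hk => by simp [cutPast, hk]
  rwa [tailSum_cut, zero_add] at this

theorem tendsto_hess_cutPast (hM : ModelBounds Θ f c C a A) (hU : IsOpen U) (hUΘ : U ⊆ Θ)
    (hθ : θ ∈ U) (i j : Fin d) (k : ℕ) (hp : LagSummable A p) :
    Tendsto (fun q : Param d × ℕ => hess f i j q.1 k (cutPast q.2 p)) (𝓝[U] θ ×ˢ atTop)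
      (𝓝 (hess f i j θ k p)) := by
  have h0 := (hM.pos (hUΘ hθ) p).ne'
  have h1 := hM.tendsto_cutPast hUΘ hθ hp
  exact (((tendsto_const_nhds.div h1 h0).sub_const 1).mul
    (hM.tendsto_fd2_cutPast hU hUΘ hθ i j hp)).sub
    ((tendsto_const_nhds.div (h1.pow 2) (pow_ne_zero 2 h0)).mul
      ((hM.tendsto_fd1_cutPast hU hUΘ hθ i hp).mul (hM.tendsto_fd1_cutPast hU hUΘ hθ j hp)))

theorem tendsto_infoJ_cutPast (hM : ModelBounds Θ f c C a A) (hU : IsOpen U) (hUΘ : U ⊆ Θ)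
    (hθ : θ ∈ U) (i j : Fin d) (hp : LagSummable A p) :
    Tendsto (fun q : Param d × ℕ => infoJ f i j q.1 (cutPast q.2 p)) (𝓝[U] θ ×ˢ atTop)
      (𝓝 (infoJ f i j θ p)) :=
  ((hM.tendsto_cutPast hUΘ hθ hp).inv₀ (hM.pos (hUΘ hθ) p).ne').mul
    ((hM.tendsto_fd1_cutPast hU hUΘ hθ i hp).mul (hM.tendsto_fd1_cutPast hU hUΘ hθ j hp))

theorem abs_fd1_mul_fd1_le (hM : ModelBounds Θ f c C a A) (hU : IsOpen U) (hUΘ : U ⊆ Θ)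
    (hθ : θ ∈ U) (i j : Fin d) (hp : LagSummable A p) (hpZ : C + lagSum A p ≤ Z) :
    |fd1 f i θ p * fd1 f j θ p| ≤ Z ^ 2 := by
  have h1 := (hM.abs_fd1_le hU hUΘ hθ i hp).trans hpZ
  have h2 := (hM.abs_fd1_le hU hUΘ hθ j hp).trans hpZ
  rw [abs_mul, sq]
  exact mul_le_mul h1 h2 (abs_nonneg _) ((abs_nonneg _).trans h1)

/-- The worst term is the observation times two first derivatives. Its three powers of the envelope
are integrable because the moment has order above `3`. -/
theorem abs_hess_le (hM : ModelBounds Θ f c C a A) (hU : IsOpen U) (hUΘ : U ⊆ Θ) (hθ : θ ∈ U)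
    (i j : Fin d) (hp : LagSummable A p) (hpZ : C + lagSum A p ≤ Z) (hkZ : (k : ℝ) ≤ Z) :
    |hess f i j θ k p| ≤ scoreConst c * Z ^ 3 := by
  have hZ : 1 ≤ Z := (hM.one_le_C.trans (le_add_of_nonneg_right
    (lagSum_nonneg hM.A_nonneg))).trans hpZ
  have hc := hM.c_pos
  have hf := hM.lower θ (hUΘ hθ) p
  have hk : (0 : ℝ) ≤ k := Nat.cast_nonneg k
  have h1 := abs_div_sub_one_le hc hk hkZ hZ hf
  have h2 := (hM.abs_fd2_le hU hUΘ hθ i j hp).trans hpZ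
  have h3 := hM.abs_fd1_mul_fd1_le hU hUΘ hθ i j hp hpZ
  have h4 : (k : ℝ) / f θ p ^ 2 ≤ Z / c ^ 2 := by gcongr
  unfold hess
  refine (abs_sub _ _).trans ?_
  rw [abs_mul, abs_mul ((k : ℝ) / f θ p ^ 2), abs_of_nonneg (show 0 ≤ (k : ℝ) / f θ p ^ 2 by positivity)]
  have h5 : |(k : ℝ) / f θ p - 1| * |fd2 f i j θ p| ≤ (1 / c + 1) * Z * Z := by gcongr
  have h6 : (k : ℝ) / f θ p ^ 2 * |fd1 f i θ p * fd1 f j θ p| ≤ Z / c ^ 2 * Z ^ 2 := by gcongr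
  have h7 : (1 / c + 1) * Z * Z ≤ (1 / c + 1) * Z ^ 3 := by
    have : (1 / c + 1) * Z * Z = (1 / c + 1) * Z ^ 2 := by ring
    rw [this]
    gcongr
    norm_num
  have h8 : Z / c ^ 2 * Z ^ 2 = 1 / c ^ 2 * Z ^ 3 := by ring
  unfold scoreConst
  linarith

theorem abs_infoJ_le (hM : ModelBounds Θ f c C a A) (hU : IsOpen U) (hUΘ : U ⊆ Θ) (hθ : θ ∈ U)
    (i j : Fin d) (hp : LagSummable A p) (hpZ : C + lagSum A p ≤ Z) :
    |infoJ f i j θ p| ≤ 1 / c * Z ^ 2 := by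
  have hc := hM.c_pos
  have h1 := hM.abs_fd1_mul_fd1_le hU hUΘ hθ i j hp hpZ
  unfold infoJ
  rw [abs_mul, abs_of_pos (inv_pos.2 (hM.pos (hUΘ hθ) p)), one_div]
  have := hM.lower θ (hUΘ hθ) p
  gcongr

theorem continuousOn_hess (hM : ModelBounds Θ f c C a A) (hU : IsOpen U) (hUΘ : U ⊆ Θ)
    (i j : Fin d) (k : ℕ) (p : ℕ → ℕ) : ContinuousOn (fun θ => hess f i j θ k p) U := by
  have h1 : ContinuousOn (fun θ => f θ p) U := (hM.continuousOn p).mono hUΘ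
  have h0 : ∀ θ ∈ U, f θ p ≠ 0 := fun θ hθ => (hM.pos (hUΘ hθ) p).ne'
  exact (((continuousOn_const.div h1 h0).sub continuousOn_const).mul
    (hM.continuousOn_fd2 hU hUΘ i j p)).sub
    ((continuousOn_const.div (h1.pow 2) fun θ hθ => pow_ne_zero 2 (h0 θ hθ)).mul
      ((hM.continuousOn_fd1 hU hUΘ i p).mul (hM.continuousOn_fd1 hU hUΘ j p)))

theorem continuousOn_infoJ (hM : ModelBounds Θ f c C a A) (hU : IsOpen U) (hUΘ : U ⊆ Θ)
    (i j : Fin d) (p : ℕ → ℕ) : ContinuousOn (fun θ => infoJ f i j θ p) U :=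
  (((hM.continuousOn p).mono hUΘ).inv₀ fun _ hθ => (hM.pos (hUΘ hθ) p).ne').mul
    ((hM.continuousOn_fd1 hU hUΘ i p).mul (hM.continuousOn_fd1 hU hUΘ j p))

theorem measurable_hess (hM : ModelBounds Θ f c C a A) (hU : IsOpen U) (hUΘ : U ⊆ Θ)
    (hθ : θ ∈ U) (i j : Fin d) : Measurable fun q : ℕ × (ℕ → ℕ) => hess f i j θ q.1 q.2 := by
  have h1 : Measurable fun q : ℕ × (ℕ → ℕ) => (q.1 : ℝ) :=
    (measurable_from_top (f := fun n : ℕ => (n : ℝ))).comp measurable_fst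
  have h2 : Measurable fun q : ℕ × (ℕ → ℕ) => f θ q.2 :=
    (hM.measurable θ (hUΘ hθ)).comp measurable_snd
  have h3 : ∀ i, Measurable fun q : ℕ × (ℕ → ℕ) => fd1 f i θ q.2 := fun i =>
    (hM.measurable_fd1 hU hUΘ hθ i).comp measurable_snd
  exact (((h1.div h2).sub_const 1).mul ((hM.measurable_fd2 hU hUΘ hθ i j).comp measurable_snd)).sub
    ((h1.div (h2.pow_const 2)).mul ((h3 i).mul (h3 j)))

theorem measurable_infoJ (hM : ModelBounds Θ f c C a A) (hU : IsOpen U) (hUΘ : U ⊆ Θ)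
    (hθ : θ ∈ U) (i j : Fin d) : Measurable (infoJ f i j θ) :=
  (hM.measurable θ (hUΘ hθ)).inv.mul
    ((hM.measurable_fd1 hU hUΘ hθ i).mul (hM.measurable_fd1 hU hUΘ hθ j))

theorem measurable_hess_path (hM : ModelBounds Θ f c C a A) (hU : IsOpen U) (hUΘ : U ⊆ Θ)
    (hθ : θ ∈ U) (i j : Fin d) : Measurable fun y : ℤ → ℕ => hess f i j θ (y 0) (pastPath y) := by
  have h := (hM.measurable_hess hU hUΘ hθ i j).comp measurable_pair
  exact h

theorem measurable_infoJ_path (hM : ModelBounds Θ f c C a A) (hU : IsOpen U) (hUΘ : U ⊆ Θ)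
    (hθ : θ ∈ U) (i j : Fin d) : Measurable fun y : ℤ → ℕ => infoJ f i j θ (pastPath y) :=
  (hM.measurable_infoJ hU hUΘ hθ i j).comp measurable_pastPath

theorem cut_le_envelope (hM : ModelBounds Θ f c C a A) {y : ℤ → ℕ}
    (hy : LagSummable A (pastPath y)) (n : ℕ) :
    C + lagSum A (cutPast n (pastPath y)) ≤ envelope C A y :=
  (add_le_add le_rfl (lagSum_cut_le hy hM.A_nonneg n)).trans (EnvelopeMoment.lag_le y)

end ModelBounds

variable {P : Measure (ℤ → ℕ)} {r : ℝ}

/-- The averaged Hessian converges locally uniformly. -/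
theorem ae_avg_hess_near (hM : ModelBounds Θ f c C a A) (hE : EnvelopeMoment P C A r)
    (hU : IsOpen U) (hUΘ : U ⊆ Θ) (hθ : θ ∈ U) (i j : Fin d) :
    ∀ᵐ y ∂P, ∀ ε > 0, ∃ ρ > 0, ∀ᶠ m : ℕ in atTop, ∀ θ' ∈ U, dist θ' θ < ρ →
      |(m : ℝ)⁻¹ * ∑ t ∈ Finset.Icc 1 m,
          hess f i j θ' (y t) (cutPast (t - 1) (pastPath (shiftPath t y)))
        - ∫ y, hess f i j θ (y 0) (pastPath y) ∂P| ≤ ε := by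
  refine ae_eventually_avg_cut_near hE.stationary hθ (fun θ hθ => hM.measurable_hess hU hUΘ hθ i j)
    (fun k p => hM.continuousOn_hess hU hUΘ i j k p)
    ((hE.integrable_pow (j := 3) le_rfl).const_mul (ModelBounds.scoreConst c)) ?_ ?_ ?_
  · filter_upwards [hE.ae_lagSummable_zero] with y hy θ' hθ' n
    exact hM.abs_hess_le hU hUΘ hθ' i j (LagSummable.cut n) (hM.cut_le_envelope hy n)
      (hE.coord_le y)
  · filter_upwards [hE.ae_lagSummable_zero] with y hy
    exact hM.abs_hess_le hU hUΘ hθ i j hy (EnvelopeMoment.lag_le y) (hE.coord_le y)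
  · filter_upwards [hE.ae_lagSummable_zero] with y hy
    exact hM.tendsto_hess_cutPast hU hUΘ hθ i j (y 0) hy

theorem ae_avg_infoJ_near (hM : ModelBounds Θ f c C a A) (hE : EnvelopeMoment P C A r)
    (hU : IsOpen U) (hUΘ : U ⊆ Θ) (hθ : θ ∈ U) (i j : Fin d) :
    ∀ᵐ y ∂P, ∀ ε > 0, ∃ ρ > 0, ∀ᶠ m : ℕ in atTop, ∀ θ' ∈ U, dist θ' θ < ρ →
      |(m : ℝ)⁻¹ * ∑ t ∈ Finset.Icc 1 m,
          infoJ f i j θ' (cutPast (t - 1) (pastPath (shiftPath t y)))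
        - matrixJ f θ P i j| ≤ ε := by
  refine ae_eventually_avg_cut_near (H := fun θ _ p => infoJ f i j θ p) hE.stationary hθ
    (fun θ hθ => (hM.measurable_infoJ hU hUΘ hθ i j).comp measurable_snd)
    (fun _ p => hM.continuousOn_infoJ hU hUΘ i j p)
    ((hE.integrable_pow (j := 2) (by norm_num)).const_mul (1 / c)) ?_ ?_ ?_
  · filter_upwards [hE.ae_lagSummable_zero] with y hy θ' hθ' n
    exact hM.abs_infoJ_le hU hUΘ hθ' i j (LagSummable.cut n) (hM.cut_le_envelope hy n)
  · filter_upwards [hE.ae_lagSummable_zero] with y hy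
    exact hM.abs_infoJ_le hU hUΘ hθ i j hy (EnvelopeMoment.lag_le y)
  · filter_upwards [hE.ae_lagSummable_zero] with y hy
    exact hM.tendsto_infoJ_cutPast hU hUΘ hθ i j hy

end Hessian

/-! ### The information identity and positivity of the information matrix. -/

section Information

variable {Ω : Type*} [mΩ : MeasurableSpace Ω] {μ : Measure Ω} [IsProbabilityMeasure μ]
  {d : ℕ} {Θ U : Set (Param d)} {f : Param d → (ℕ → ℕ) → ℝ} {c C r : ℝ} {a A : ℕ → ℝ}
  {θ : Param d} {Y : ℤ → Ω → ℕ}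

theorem integrable_hess {P : Measure (ℤ → ℕ)} (hM : ModelBounds Θ f c C a A)
    (hE : EnvelopeMoment P C A r) (hU : IsOpen U) (hUΘ : U ⊆ Θ) (hθ : θ ∈ U) (i j : Fin d) :
    Integrable (fun y => hess f i j θ (y 0) (pastPath y)) P := by
  refine ((hE.integrable_pow (j := 3) le_rfl).const_mul (ModelBounds.scoreConst c)).mono'
    (hM.measurable_hess_path hU hUΘ hθ i j).aestronglyMeasurable ?_
  filter_upwards [hE.ae_lagSummable_zero] with y hy
  exact hM.abs_hess_le hU hUΘ hθ i j hy (EnvelopeMoment.lag_le y) (hE.coord_le y)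

theorem integrable_fd2 {P : Measure (ℤ → ℕ)} (hM : ModelBounds Θ f c C a A)
    (hE : EnvelopeMoment P C A r) (hU : IsOpen U) (hUΘ : U ⊆ Θ) (hθ : θ ∈ U) (i j : Fin d) :
    Integrable (fun y => fd2 f i j θ (pastPath y)) P := by
  refine (hE.integrable_pow (j := 1) (by norm_num)).mono'
    ((hM.measurable_fd2 hU hUΘ hθ i j).comp measurable_pastPath).aestronglyMeasurable ?_
  filter_upwards [hE.ae_lagSummable_zero] with y hy
  rw [pow_one]
  exact (hM.abs_fd2_le hU hUΘ hθ i j hy).trans (EnvelopeMoment.lag_le y)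

theorem integrable_infoJ {P : Measure (ℤ → ℕ)} (hM : ModelBounds Θ f c C a A)
    (hE : EnvelopeMoment P C A r) (hU : IsOpen U) (hUΘ : U ⊆ Θ) (hθ : θ ∈ U) (i j : Fin d) :
    Integrable (fun y => infoJ f i j θ (pastPath y)) P := by
  refine ((hE.integrable_pow (j := 2) (by norm_num)).const_mul (1 / c)).mono'
    ((hM.measurable_infoJ hU hUΘ hθ i j).comp measurable_pastPath).aestronglyMeasurable ?_
  filter_upwards [hE.ae_lagSummable_zero] with y hy
  exact hM.abs_infoJ_le hU hUΘ hθ i j hy (EnvelopeMoment.lag_le y)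

/-- The information identity. -/
theorem integral_hess (hM : ModelBounds Θ f c C a A) (hY : IsODProcess μ f θ Y)
    (hE : EnvelopeMoment (pathLaw μ Y) C A r) (hU : IsOpen U) (hUΘ : U ⊆ Θ) (hθ : θ ∈ U)
    (i j : Fin d) :
    ∫ y, hess f i j θ (y 0) (pastPath y) ∂(pathLaw μ Y) = -matrixJ f θ (pathLaw μ Y) i j := by
  have hm := pastSigma_le hY.measurable 0
  have hH := hY.integrable_path (integrable_hess hM hE hU hUΘ hθ i j)
  have hF := hY.integrable_path (integrable_fd2 hM hE hU hUΘ hθ i j)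
  have hHm := hM.measurable_hess_path hU hUΘ hθ i j
  have hJm := hM.measurable_infoJ_path hU hUΘ hθ i j
  rw [matrixJ, Matrix.of_apply, hY.integral_path hHm, hY.integral_path hJm]
  simp only [pastPath_trajectory] at hH hF ⊢
  -- The coefficient of the observation in the Hessian. Thus `W · Y` is the Hessian plus `fd2`,
  -- while `W · λ` is `fd2` minus the information integrand; the two products have equal
  -- expectations.
  set W : Ω → ℝ := fun ω => (f θ (past Y 0 ω))⁻¹ * fd2 f i j θ (past Y 0 ω)
    - (f θ (past Y 0 ω))⁻¹ ^ 2 * (fd1 f i θ (past Y 0 ω) * fd1 f j θ (past Y 0 ω)) with hW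
  have hfm : Measurable[pastSigma Y 0] fun ω => f θ (past Y 0 ω) :=
    IsODProcess.measurable_past_model hM (hUΘ hθ) 0
  have h2m : Measurable[pastSigma Y 0] fun ω => fd2 f i j θ (past Y 0 ω) :=
    (hM.measurable_fd2 hU hUΘ hθ i j).comp (measurable_past 0)
  have h1m : ∀ i, Measurable[pastSigma Y 0] fun ω => fd1 f i θ (past Y 0 ω) := fun i =>
    IsODProcess.measurable_fd1_past hM hU hUΘ hθ i 0
  have hWm : Measurable[pastSigma Y 0] W :=
    (hfm.inv.mul h2m).sub ((hfm.inv.pow_const 2).mul ((h1m i).mul (h1m j)))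
  have h1 : ∀ ω, W ω * (Y 0 ω : ℝ)
      = hess f i j θ (trajectory Y ω 0) (past Y 0 ω) + fd2 f i j θ (past Y 0 ω) := fun ω => by
    simp only [hW, hess, trajectory]
    ring
  have hWY : Integrable (fun ω => W ω * (Y 0 ω : ℝ)) μ := by
    simp_rw [h1]
    exact hH.add hF
  obtain ⟨h2, h3⟩ := hY.integral_mul_eq 0 hWm.stronglyMeasurable
    (hY.integrable_model hM hE 0).1 hWY
  have h4 : ∀ ω, W ω * f θ (past Y 0 ω)
      = fd2 f i j θ (past Y 0 ω) - infoJ f i j θ (past Y 0 ω) := fun ω => by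
    have := (hM.pos (hUΘ hθ) (past Y 0 ω)).ne'
    simp only [hW, infoJ]
    field_simp
  have hJ := hY.integrable_path (integrable_infoJ hM hE hU hUΘ hθ i j)
  simp only [pastPath_trajectory] at hJ
  simp_rw [h1, h4] at h3
  rw [integral_add hH hF, integral_sub hF hJ] at h3
  linarith

-- The quadratic form is the integral of `λ⁻¹ (u · ∂λ)²`. If it vanishes, then `u · ∂λ = 0` almost
-- surely, and nondegeneracy gives `u = 0`.
omit [IsProbabilityMeasure μ] in
theorem matrixJ_pos (hM : ModelBounds Θ f c C a A) (hY : IsODProcess μ f θ Y)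
    (hE : EnvelopeMoment (pathLaw μ Y) C A r) (hU : IsOpen U) (hUΘ : U ⊆ Θ) (hθ : θ ∈ U)
    (hn : ∀ u : Param d,
      (∀ᵐ ω ∂μ, ∑ i, u i * pderiv Θ (lam f Y 0 ω) i θ = 0) → u = 0) (u : Param d) (hu : u ≠ 0) :
    0 < ∑ i, ∑ j, u i * u j * matrixJ f θ (pathLaw μ Y) i j := by
  have hint : ∀ i j, Integrable (fun y => u i * u j * infoJ f i j θ (pastPath y)) (pathLaw μ Y) :=
    fun i j => (integrable_infoJ hM hE hU hUΘ hθ i j).const_mul _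
  have hsq : ∀ p, ∑ i, ∑ j, u i * u j * infoJ f i j θ p = (f θ p)⁻¹ * (∑ i, u i * fd1 f i θ p) ^ 2 := by
    intro p
    rw [sq, Finset.sum_mul_sum, Finset.mul_sum]
    refine Finset.sum_congr rfl fun i _ => ?_
    rw [Finset.mul_sum]
    refine Finset.sum_congr rfl fun j _ => ?_
    unfold infoJ
    ring
  have heq : ∑ i, ∑ j, u i * u j * matrixJ f θ (pathLaw μ Y) i j
      = ∫ y, (f θ (pastPath y))⁻¹ * (∑ i, u i * fd1 f i θ (pastPath y)) ^ 2 ∂(pathLaw μ Y) := by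
    simp_rw [← hsq]
    rw [integral_finsetSum _ fun i _ => integrable_finsetSum _ fun j _ => hint i j]
    refine Finset.sum_congr rfl fun i _ => ?_
    rw [integral_finsetSum _ fun j _ => hint i j]
    refine Finset.sum_congr rfl fun j _ => ?_
    rw [integral_const_mul]
    rfl
  have hI : Integrable (fun y => (f θ (pastPath y))⁻¹ * (∑ i, u i * fd1 f i θ (pastPath y)) ^ 2)
      (pathLaw μ Y) := by
    simp_rw [← hsq]
    exact integrable_finsetSum _ fun i _ => integrable_finsetSum _ fun j _ => hint i j
  have h0 : ∀ y : ℤ → ℕ, 0 ≤ (f θ (pastPath y))⁻¹ * (∑ i, u i * fd1 f i θ (pastPath y)) ^ 2 :=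
    fun y => mul_nonneg (inv_nonneg.2 (hM.pos (hUΘ hθ) _).le) (sq_nonneg _)
  rw [heq]
  refine lt_of_le_of_ne (integral_nonneg h0) fun he => hu (hn u ?_)
  have h1 := hY.ae_path ((integral_eq_zero_iff_of_nonneg h0 hI).1 he.symm)
  filter_upwards [h1] with ω hω
  have h2 : ∀ i, pderiv Θ (lam f Y 0 ω) i θ = fd1 f i θ (past Y 0 ω) := fun i =>
    ModelBounds.pderiv_eq_fd1 hU hUΘ hθ i (past Y 0 ω)
  simp only [h2]
  simp only [pastPath_trajectory, Pi.zero_apply, mul_eq_zero, inv_eq_zero,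
    (hM.pos (hUΘ hθ) (past Y 0 ω)).ne', false_or] at hω
  exact pow_eq_zero_iff (two_ne_zero) |>.1 hω

end Information

/-! ### The rate of convergence of the estimate -/

/-- A second-order Taylor bound by monotonicity, applied once to the derivative and once to the
function; the second derivative need not be continuous. -/
theorem sub_le_of_second_deriv_le {φ φ' φ'' : ℝ → ℝ} {κ : ℝ}
    (h1 : ∀ s ∈ Set.Icc (0 : ℝ) 1, HasDerivAt φ (φ' s) s)
    (h2 : ∀ s ∈ Set.Icc (0 : ℝ) 1, HasDerivAt φ' (φ'' s) s)
    (h3 : ∀ s ∈ Set.Icc (0 : ℝ) 1, φ'' s ≤ -κ) : φ 1 - φ 0 ≤ φ' 0 - κ / 2 := by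
  have hsub : ∀ s ∈ interior (Set.Icc (0 : ℝ) 1), s ∈ Set.Icc (0 : ℝ) 1 := fun s hs =>
    interior_subset hs
  have hd1 : ∀ s ∈ Set.Icc (0 : ℝ) 1, HasDerivAt (fun s => φ' s + κ * s) (φ'' s + κ * 1) s :=
    fun s hs => (h2 s hs).add ((hasDerivAt_id s).const_mul κ)
  have hanti1 : AntitoneOn (fun s => φ' s + κ * s) (Set.Icc 0 1) := by
    refine antitoneOn_of_deriv_nonpos (convex_Icc 0 1)
      (fun s hs => (hd1 s hs).continuousAt.continuousWithinAt)
      (fun s hs => (hd1 s (hsub s hs)).differentiableAt.differentiableWithinAt) fun s hs => ?_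
    rw [(hd1 s (hsub s hs)).deriv]
    linarith [h3 s (hsub s hs)]
  have hle : ∀ s ∈ Set.Icc (0 : ℝ) 1, φ' s + κ * s ≤ φ' 0 := fun s hs => by
    simpa using hanti1 (Set.left_mem_Icc.2 zero_le_one) hs hs.1
  have hd2 : ∀ s ∈ Set.Icc (0 : ℝ) 1, HasDerivAt (fun s => φ s + κ / 2 * s ^ 2 - φ' 0 * s)
      (φ' s + κ / 2 * (2 * s) - φ' 0 * 1) s := fun s hs => by
    have := ((h1 s hs).add ((hasDerivAt_pow 2 s).const_mul (κ / 2))).sub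
      ((hasDerivAt_id s).const_mul (φ' 0))
    exact this.congr_deriv (by norm_num)
  have hanti2 : AntitoneOn (fun s => φ s + κ / 2 * s ^ 2 - φ' 0 * s) (Set.Icc 0 1) := by
    refine antitoneOn_of_deriv_nonpos (convex_Icc 0 1)
      (fun s hs => (hd2 s hs).continuousAt.continuousWithinAt)
      (fun s hs => (hd2 s (hsub s hs)).differentiableAt.differentiableWithinAt) fun s hs => ?_
    rw [(hd2 s (hsub s hs)).deriv]
    linarith [hle s (hsub s hs)]
  have := hanti2 (Set.left_mem_Icc.2 zero_le_one) (Set.right_mem_Icc.2 zero_le_one) zero_le_one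
  simp only at this
  linarith

/-! ### Derivatives along a segment in the parameter space. -/

section Line

variable {d : ℕ} {Θ U : Set (Param d)} {f : Param d → (ℕ → ℕ) → ℝ} {c C : ℝ} {a A : ℕ → ℝ}
  {θ u : Param d} {s : ℝ}

theorem hasDerivAt_line (θ u : Param d) (s : ℝ) : HasDerivAt (fun s : ℝ => θ + s • u) u s := by
  simpa using ((hasDerivAt_id s).smul_const u).const_add θ

namespace ModelBounds

theorem hasDerivAt_model_line (hM : ModelBounds Θ f c C a A) (hU : IsOpen U) (hUΘ : U ⊆ Θ)
    (hs : θ + s • u ∈ U) (p : ℕ → ℕ) :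
    HasDerivAt (fun s => f (θ + s • u) p) (∑ i, u i * fd1 f i (θ + s • u) p) s := by
  have h := (hM.differentiableAt hU hUΘ hs p).hasFDerivAt.comp_hasDerivAt s (hasDerivAt_line θ u s)
  rw [fderiv_eq_sum] at h
  exact h

theorem hasDerivAt_fd1_line (hM : ModelBounds Θ f c C a A) (hU : IsOpen U) (hUΘ : U ⊆ Θ)
    (hs : θ + s • u ∈ U) (i : Fin d) (p : ℕ → ℕ) :
    HasDerivAt (fun s => fd1 f i (θ + s • u) p) (∑ j, u j * fd2 f i j (θ + s • u) p) s := by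
  have h := (hM.differentiableAt_fd1 hU hUΘ hs i p).hasFDerivAt.comp_hasDerivAt s
    (hasDerivAt_line θ u s)
  rw [fderiv_eq_sum] at h
  exact h

theorem hasDerivAt_qll_line (hM : ModelBounds Θ f c C a A) (hU : IsOpen U) (hUΘ : U ⊆ Θ)
    (hs : θ + s • u ∈ U) (k : ℕ) (p : ℕ → ℕ) :
    HasDerivAt (fun s => qll f (θ + s • u) k p) (∑ i, u i * score f i (θ + s • u) k p) s := by
  have h1 := hM.hasDerivAt_model_line hU hUΘ hs p
  have h0 := (hM.pos (hUΘ hs) p).ne'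
  refine (((h1.log h0).const_mul (k : ℝ)).sub h1).congr_deriv ?_
  rw [Finset.sum_div, Finset.mul_sum, ← Finset.sum_sub_distrib]
  refine Finset.sum_congr rfl fun i _ => ?_
  unfold score
  ring

theorem hasDerivAt_score_line (hM : ModelBounds Θ f c C a A) (hU : IsOpen U) (hUΘ : U ⊆ Θ)
    (hs : θ + s • u ∈ U) (i : Fin d) (k : ℕ) (p : ℕ → ℕ) :
    HasDerivAt (fun s => score f i (θ + s • u) k p) (∑ j, u j * hess f i j (θ + s • u) k p) s := by
  have h1 := hM.hasDerivAt_model_line hU hUΘ hs p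
  have h0 := (hM.pos (hUΘ hs) p).ne'
  refine ((((hasDerivAt_const s (k : ℝ)).div h1 h0).sub_const 1).mul
    (hM.hasDerivAt_fd1_line hU hUΘ hs i p)).congr_deriv ?_
  have h2 : ∀ j, u j * hess f i j (θ + s • u) k p
      = ((k : ℝ) / f (θ + s • u) p - 1) * (u j * fd2 f i j (θ + s • u) p)
        - (k : ℝ) / f (θ + s • u) p ^ 2 * fd1 f i (θ + s • u) p
          * (u j * fd1 f j (θ + s • u) p) := fun j => by
    unfold hess
    ring
  simp_rw [h2]
  rw [Finset.sum_sub_distrib, ← Finset.mul_sum, ← Finset.mul_sum]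
  simp only [Pi.div_apply]
  ring

end ModelBounds

end Line

section Rate

variable {d : ℕ} {Θ U : Set (Param d)} {f : Param d → (ℕ → ℕ) → ℝ} {c C r R γ : ℝ} {a A : ℕ → ℝ}
  {θ₀ : Param d}

theorem abs_coord_le_norm (u : Param d) (i : Fin d) : |u i| ≤ ‖u‖ := by
  simpa using PiLp.norm_apply_le u i

/-- A maximizer near the true parameter is bounded by the score. -/
theorem norm_sub_le_of_score (hM : ModelBounds Θ f c C a A) (hU : IsOpen U) (hUΘ : U ⊆ Θ)
    {ρ κ ε : ℝ} (hball : Metric.ball θ₀ ρ ⊆ U) (J : Fin d → Fin d → ℝ) (hκ : 0 < κ)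
    (hJ : ∀ u : Param d, κ * ‖u‖ ^ 2 ≤ ∑ i, ∑ j, u i * u j * J i j)
    (hε : ε * (d * d) ≤ κ / 2) {m : ℕ} (hm : 0 < m) {x : ℕ → ℕ} {q : ℕ → ℕ → ℕ}
    (hx : ∀ t ∈ Finset.Icc 1 m, truncPast x t = q t)
    (hH : ∀ i j, ∀ θ' ∈ U, dist θ' θ₀ < ρ →
      |(m : ℝ)⁻¹ * ∑ t ∈ Finset.Icc 1 m, hess f i j θ' (x t) (q t) + J i j| ≤ ε)
    {S : ℝ} (hS : ∀ i, |∑ t ∈ Finset.Icc 1 m, score f i θ₀ (x t) (q t)| ≤ S)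
    {θ : Param d} (hθ : IsPQMLE Θ f x 1 m θ) (hθρ : dist θ θ₀ < ρ) :
    ‖θ - θ₀‖ ≤ 4 * d / κ * ((m : ℝ)⁻¹ * S) := by
  have hm0 : (0 : ℝ) < m := by exact_mod_cast hm
  set u := θ - θ₀ with hu
  have hu' : ‖u‖ < ρ := by rwa [hu, ← dist_eq_norm]
  have hρ : 0 < ρ := (norm_nonneg u).trans_lt hu'
  have hdist : ∀ s ∈ Set.Icc (0 : ℝ) 1, dist (θ₀ + s • u) θ₀ < ρ := fun s hs => by
    rw [dist_eq_norm, add_sub_cancel_left, norm_smul, Real.norm_of_nonneg hs.1]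
    exact (mul_le_of_le_one_left (norm_nonneg u) hs.2).trans_lt hu'
  have hmem : ∀ s ∈ Set.Icc (0 : ℝ) 1, θ₀ + s • u ∈ U := fun s hs => hball (hdist s hs)
  have hθ₀ : θ₀ ∈ Θ := hUΘ (hball (Metric.mem_ball_self hρ))
  have hq : ∀ θ, quasiLogLik f x 1 m θ = ∑ t ∈ Finset.Icc 1 m, qll f θ (x t) (q t) := fun θ =>
    Finset.sum_congr rfl fun t ht => by rw [← hx t ht]; rfl
  -- On the segment from `θ₀` to `θ` the average Hessian is within `ε` of `-J` entrywise, and `ε d²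
  -- ≤ κ/2` preserves half of the curvature. Maximality makes the left-hand side nonnegative, so `m
  -- κ ‖u‖² / 4 ≤ d ‖u‖ S`.
  have hmain := sub_le_of_second_deriv_le
    (φ := fun s => ∑ t ∈ Finset.Icc 1 m, qll f (θ₀ + s • u) (x t) (q t))
    (φ' := fun s => ∑ i, u i * ∑ t ∈ Finset.Icc 1 m, score f i (θ₀ + s • u) (x t) (q t))
    (φ'' := fun s => ∑ i, u i * ∑ t ∈ Finset.Icc 1 m,
      ∑ j, u j * hess f i j (θ₀ + s • u) (x t) (q t))
    (κ := m * (κ / 2 * ‖u‖ ^ 2)) (fun s hs => ?_) (fun s hs => ?_) (fun s hs => ?_)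
  · have h1 := hθ.2 θ₀ hθ₀
    rw [hq, hq] at h1
    simp only [one_smul, zero_smul, add_zero] at hmain
    have h2 : θ₀ + u = θ := by rw [hu]; abel
    rw [h2] at hmain
    have h3 : ∑ i, u i * ∑ t ∈ Finset.Icc 1 m, score f i θ₀ (x t) (q t) ≤ ∑ _i : Fin d, ‖u‖ * S := by
      refine Finset.sum_le_sum fun i _ => (le_abs_self _).trans ?_
      rw [abs_mul]
      exact mul_le_mul (abs_coord_le_norm u i) (hS i) (abs_nonneg _) (norm_nonneg u)
    rw [Finset.sum_const, Finset.card_univ, Fintype.card_fin, nsmul_eq_mul] at h3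
    have h4 : m * (κ / 2 * ‖u‖ ^ 2) / 2 ≤ d * (‖u‖ * S) := by linarith
    rcases (norm_nonneg u).eq_or_lt with h0 | h0
    · rw [← h0]
      rcases Nat.eq_zero_or_pos d with rfl | hd
      · simp
      · have hS0 : 0 ≤ S := (abs_nonneg _).trans (hS ⟨0, hd⟩)
        positivity
    · have h5 : m * κ / 4 * ‖u‖ ≤ d * S := by
        refine le_of_mul_le_mul_right ?_ h0
        nlinarith
      have h6 : 4 * d / κ * ((m : ℝ)⁻¹ * S) = (d * S) / (m * κ / 4) := by
        field_simp
      rw [h6, le_div_iff₀ (by positivity)]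
      linarith
  · have h1 := HasDerivAt.fun_sum (u := Finset.Icc 1 m) fun t _ =>
      hM.hasDerivAt_qll_line hU hUΘ (hmem s hs) (x t) (q t)
    refine h1.congr_deriv ?_
    rw [Finset.sum_comm]
    exact Finset.sum_congr rfl fun i _ => (Finset.mul_sum _ _ _).symm
  · exact HasDerivAt.fun_sum fun i _ => (HasDerivAt.fun_sum fun t _ =>
      hM.hasDerivAt_score_line hU hUΘ (hmem s hs) i (x t) (q t)).const_mul (u i)
  · have h1 : ∑ i, u i * ∑ t ∈ Finset.Icc 1 m, ∑ j, u j * hess f i j (θ₀ + s • u) (x t) (q t)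
        = m * ∑ i, ∑ j, u i * u j * ((m : ℝ)⁻¹ * ∑ t ∈ Finset.Icc 1 m,
          hess f i j (θ₀ + s • u) (x t) (q t)) := by
      rw [Finset.mul_sum]
      refine Finset.sum_congr rfl fun i _ => ?_
      rw [Finset.sum_comm, Finset.mul_sum, Finset.mul_sum]
      refine Finset.sum_congr rfl fun j _ => ?_
      rw [← Finset.mul_sum]
      field_simp
    have h2 : ∑ i, ∑ j, u i * u j * ((m : ℝ)⁻¹ * ∑ t ∈ Finset.Icc 1 m,
          hess f i j (θ₀ + s • u) (x t) (q t))
        ≤ ∑ _i : Fin d, ∑ _j : Fin d, ‖u‖ ^ 2 * ε - ∑ i, ∑ j, u i * u j * J i j := by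
      rw [← Finset.sum_sub_distrib]
      refine Finset.sum_le_sum fun i _ => ?_
      rw [← Finset.sum_sub_distrib]
      refine Finset.sum_le_sum fun j _ => ?_
      rw [le_sub_iff_add_le, ← mul_add]
      refine (le_abs_self _).trans ?_
      rw [abs_mul, abs_mul, sq]
      exact mul_le_mul (mul_le_mul (abs_coord_le_norm u i) (abs_coord_le_norm u j)
        (abs_nonneg _) (norm_nonneg u)) (hH i j _ (hmem s hs) (hdist s hs)) (abs_nonneg _)
        (by positivity)
    have h3 := hJ u
    simp only [Finset.sum_const, Finset.card_univ, Fintype.card_fin, nsmul_eq_mul] at h2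
    have h4 := mul_le_mul_of_nonneg_right hε (sq_nonneg ‖u‖)
    change ∑ i, u i * ∑ t ∈ Finset.Icc 1 m, ∑ j, u j * hess f i j (θ₀ + s • u) (x t) (q t) ≤ _
    rw [h1, ← mul_neg]
    refine mul_le_mul_of_nonneg_left ?_ hm0.le
    linarith

/-- The growth of the score computed from the observations. -/
theorem ae_abs_sum_score_cut_le {Ω : Type*} [MeasurableSpace Ω] {μ : Measure Ω}
    [IsProbabilityMeasure μ] {Y : ℤ → Ω → ℕ} (hM : ModelBounds Θ f c C a A)
    (hY : IsODProcess μ f θ₀ Y) (hE : EnvelopeMoment (pathLaw μ Y) C A r) (hD : PolyDecay a R γ)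
    (hU : IsOpen U) (hUΘ : U ⊆ Θ) (hθ₀ : θ₀ ∈ U)
    (hI : ∀ i, Integrable (integrandI μ Θ f θ₀ Y 0 i i) μ) {σ : ℝ} (hσ : 1 / 2 < σ) (i : Fin d) :
    ∀ᵐ ω ∂μ, ∃ K ≥ 0, ∀ m : ℕ, 1 ≤ m →
      |∑ t ∈ Finset.Icc 1 m, score f i θ₀ (trajectory Y ω t)
        (cutPast (t - 1) (pastPath (shiftPath t (trajectory Y ω))))| ≤ K * (m : ℝ) ^ σ := by
  have hγ := hD.lt
  have hc0 := hM.scoreConst_nonneg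
  have hZi : Integrable (fun y => ModelBounds.scoreConst c * envelope C A y ^ 2) (pathLaw μ Y) :=
    (hE.integrable_pow (j := 2) (by norm_num)).const_mul _
  filter_upwards [hY.ae_abs_sum_score_le hM hE hU hUΘ hθ₀ hI i hσ,
    hY.ae_path hE.ae_lagSummable, hY.ae_path (hD.ae_tailSum_le hE.stationary hE.integrable_coord),
    hY.ae_path (ae_sum_rpow_le_sqrt hE.stationary ((hE.measurable.pow_const 2).const_mul _) hZi
      (fun y => mul_nonneg hc0 (sq_nonneg _)) (show 1 / 2 < γ / 2 - 1 / 4 by linarith))]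
    with ω ⟨K₁, hK₁, h1⟩ h2 ⟨K₂, hK₂, h3⟩ ⟨K₃, hK₃, h4⟩
  set y := trajectory Y ω
  refine ⟨K₁ + K₂ * K₃, by positivity, fun m hm => ?_⟩
  -- Truncating the past changes the sum of scores by `O(√m)` only, which is absorbed into `m^σ`.
  have h5 : |∑ t ∈ Finset.Icc 1 m, (score f i θ₀ (y t) (cutPast (t - 1) (pastPath (shiftPath t y)))
      - score f i θ₀ (y t) (pastPath (shiftPath t y)))| ≤ K₂ * (K₃ * Real.sqrt m) := by
    refine (Finset.abs_sum_le_sum_abs _ _).trans ((Finset.sum_le_sum fun t ht => ?_).trans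
      ((Finset.mul_sum _ _ _).symm.le.trans (mul_le_mul_of_nonneg_left (h4 m) hK₂)))
    have hyt : (y t : ℝ) ≤ envelope C A (shiftPath t y) := by
      simpa [shiftPath] using hE.coord_le (shiftPath t y)
    refine (hM.abs_score_sub_le_tailSum hU hUΘ hθ₀ i (h2 t) (EnvelopeMoment.lag_le _) hyt
      (t - 1)).trans ?_
    refine (mul_le_mul_of_nonneg_left (h3 t (Finset.mem_Icc.1 ht).1)
      (mul_nonneg hc0 (sq_nonneg _))).trans (le_of_eq ?_)
    ring
  rw [Finset.sum_sub_distrib] at h5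
  have h6 : Real.sqrt m ≤ (m : ℝ) ^ σ := by
    rw [Real.sqrt_eq_rpow]
    exact Real.rpow_le_rpow_of_exponent_le (by exact_mod_cast hm) hσ.le
  have h7 : K₂ * (K₃ * Real.sqrt m) ≤ K₂ * (K₃ * (m : ℝ) ^ σ) := by gcongr
  have h8 := abs_sub_abs_le_abs_sub
    (∑ t ∈ Finset.Icc 1 m, score f i θ₀ (y t) (cutPast (t - 1) (pastPath (shiftPath t y))))
    (∑ t ∈ Finset.Icc 1 m, score f i θ₀ (y t) (pastPath (shiftPath t y)))
  linarith [h1 m hm]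

/-- The estimate computed on the window `{1, …, m}` converges almost surely with any rate
`m ^ (σ - 1)`, `σ > 1/2`. -/
theorem ae_pqmle_rate {Ω : Type*} [MeasurableSpace Ω] {μ : Measure Ω}
    [IsProbabilityMeasure μ] {Y : ℤ → Ω → ℕ} (hM : ModelBounds Θ f c C a A)
    (hY : IsODProcess μ f θ₀ Y) (hE : EnvelopeMoment (pathLaw μ Y) C A r) (hD : PolyDecay a R γ)
    (hU : IsOpen U) (hUΘ : U ⊆ Θ) (hθ₀ : θ₀ ∈ U)
    (hneg : ∀ θ ∈ Θ, θ ≠ θ₀ → ∫ y, (qll f θ (y 0) (pastPath y)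
      - qll f θ₀ (y 0) (pastPath y)) ∂(pathLaw μ Y) < 0)
    (hI : ∀ i, Integrable (integrandI μ Θ f θ₀ Y 0 i i) μ)
    (hn : ∀ u : Param d,
      (∀ᵐ ω ∂μ, ∑ i, u i * pderiv Θ (lam f Y 0 ω) i θ₀ = 0) → u = 0)
    {σ : ℝ} (hσ : 1 / 2 < σ) :
    ∀ᵐ ω ∂μ, ∃ K ≥ 0, ∀ᶠ m : ℕ in atTop, ∀ x : ℕ → ℕ,
      (∀ t ∈ Finset.Icc 1 m, x t = trajectory Y ω t) →
      ∀ θ, IsPQMLE Θ f x 1 m θ → ‖θ - θ₀‖ ≤ K * (m : ℝ) ^ (σ - 1) := by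
  obtain ⟨κ, hκ, hJ⟩ := exists_pos_le_quadratic (matrixJ f θ₀ (pathLaw μ Y))
    (matrixJ_pos hM hY hE hU hUΘ hθ₀ hn)
  obtain ⟨ρ₀, hρ₀, hball⟩ := Metric.isOpen_iff.1 hU θ₀ hθ₀
  have hS := ae_all_iff.2 fun i => ae_abs_sum_score_cut_le hM hY hE hD hU hUΘ hθ₀ hI hσ i
  have hH := ae_all_iff.2 fun i => ae_all_iff.2 fun j =>
    hY.ae_path (ae_avg_hess_near hM hE hU hUΘ hθ₀ i j)
  filter_upwards [hS, hH, hY.ae_path (ae_pqmle_consistent hM hE hD (hUΘ hθ₀) hneg)]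
    with ω h1 h2 h3
  set y := trajectory Y ω
  choose K hK0 hK using h1
  -- Chosen so that `ε d² ≤ κ/2`; the summand `1` covers dimension `0`.
  set ε := κ / (2 * (d * d + 1)) with hεdef
  have hε : 0 < ε := by positivity
  have hεd : ε * (d * d) ≤ κ / 2 := by
    rw [hεdef, div_mul_eq_mul_div, div_le_div_iff₀ (by positivity) (by positivity)]
    nlinarith
  choose ρ hρ hev using fun i j => h2 i j ε hε
  -- One radius for all entries of the Hessian. It is obtained from a neighbourhood of zero, so an
  -- empty index set needs no special treatment.
  obtain ⟨ρ₁, hρ₁, hρ₁le⟩ : ∃ ρ₁ > 0, ρ₁ ≤ ρ₀ ∧ ∀ i j, ρ₁ ≤ ρ i j := by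
    have h : ∀ᶠ x in 𝓝[>] (0 : ℝ), x ≤ ρ₀ ∧ ∀ i j, x ≤ ρ i j := by
      refine nhdsWithin_le_nhds ?_
      refine (eventually_le_nhds hρ₀).and (eventually_all.2 fun i => eventually_all.2 fun j =>
        eventually_le_nhds (hρ i j))
    obtain ⟨x, hx, hx'⟩ := (h.and self_mem_nhdsWithin).exists
    exact ⟨x, hx', hx⟩
  have hKs : ∀ i, K i ≤ ∑ i, K i := fun i =>
    Finset.single_le_sum (fun i _ => hK0 i) (Finset.mem_univ i)
  refine ⟨4 * d / κ * ∑ i, K i, mul_nonneg (by positivity) (Finset.sum_nonneg fun i _ => hK0 i), ?_⟩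
  filter_upwards [h3 ρ₁ hρ₁, eventually_gt_atTop 0, eventually_all.2 fun i => eventually_all.2 (hev i)]
    with m hm1 hm0 hm2 x hx θ hθ
  have hm0' : (0 : ℝ) < m := by exact_mod_cast hm0
  have h5 := norm_sub_le_of_score hM hU hUΘ (ρ := ρ₁)
    ((Metric.ball_subset_ball hρ₁le.1).trans hball) (matrixJ f θ₀ (pathLaw μ Y)) hκ hJ hεd hm0
    (fun t ht => truncPast_eq_cutPast hx ht) (S := (∑ i, K i) * (m : ℝ) ^ σ)
    (fun i j θ' hθ' hd => ?_) (fun i => ?_) hθ (hm1 x hx θ hθ)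
  · refine h5.trans (le_of_eq ?_)
    rw [Real.rpow_sub_one hm0'.ne']
    ring
  · have h6 := hm2 i j θ' hθ' (hd.trans_le (hρ₁le.2 i j))
    rw [integral_hess hM hY hE hU hUΘ hθ₀, sub_neg_eq_add] at h6
    rwa [Finset.sum_congr rfl fun t ht => by rw [hx t ht]]
  · rw [Finset.sum_congr rfl fun t ht => by rw [hx t ht]]
    refine (hK i m hm0).trans ?_
    gcongr
    exact hKs i

end Rate

/-! ### Consistency of the matrix estimates -/

/-- Young's inequality with weight `ε` for the cross terms: mean squared differences of size `ε²`
are multiplied by `ε⁻¹`, and the bounded mean squares by `ε`, so that every term is of order `ε`. -/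
theorem abs_avg_mul_sub_avg_mul_le {m : ℕ} {a a' b b' : ℕ → ℝ} {ε G : ℝ} (hε : 0 < ε) (hε1 : ε ≤ 1)
    (ha : (m : ℝ)⁻¹ * ∑ t ∈ Finset.Icc 1 m, (a t - a' t) ^ 2 ≤ ε ^ 2)
    (hb : (m : ℝ)⁻¹ * ∑ t ∈ Finset.Icc 1 m, (b t - b' t) ^ 2 ≤ ε ^ 2)
    (ha' : (m : ℝ)⁻¹ * ∑ t ∈ Finset.Icc 1 m, a' t ^ 2 ≤ G)
    (hb' : (m : ℝ)⁻¹ * ∑ t ∈ Finset.Icc 1 m, b' t ^ 2 ≤ G) :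
    |(m : ℝ)⁻¹ * ∑ t ∈ Finset.Icc 1 m, a t * b t - (m : ℝ)⁻¹ * ∑ t ∈ Finset.Icc 1 m, a' t * b' t|
      ≤ ε * (2 + G) := by
  have hmul : ∀ x z : ℝ, |x * z| ≤ ε⁻¹ / 2 * x ^ 2 + ε / 2 * z ^ 2 := fun x z => by
    have h1 : 0 ≤ (|x| - ε * |z|) ^ 2 := sq_nonneg _
    have h2 : ε⁻¹ / 2 * x ^ 2 + ε / 2 * z ^ 2 - |x| * |z| = ε⁻¹ / 2 * (|x| - ε * |z|) ^ 2 := by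
      rw [← sq_abs x, ← sq_abs z]
      field_simp
      ring
    rw [abs_mul]
    have h3 : 0 ≤ ε⁻¹ / 2 * (|x| - ε * |z|) ^ 2 := by positivity
    linarith
  have hterm : ∀ t, |a t * b t - a' t * b' t| ≤ (1 + ε⁻¹) / 2 * (a t - a' t) ^ 2
      + (1 + ε⁻¹) / 2 * (b t - b' t) ^ 2 + ε / 2 * a' t ^ 2 + ε / 2 * b' t ^ 2 := fun t => by
    have h1 : a t * b t - a' t * b' t
        = (a t - a' t) * (b t - b' t) + (a t - a' t) * b' t + (b t - b' t) * a' t := by ring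
    have h2 := hmul (a t - a' t) (b' t)
    have h3 := hmul (b t - b' t) (a' t)
    have h4 : |(a t - a' t) * (b t - b' t)| ≤ (a t - a' t) ^ 2 / 2 + (b t - b' t) ^ 2 / 2 := by
      rw [abs_le]
      constructor <;> nlinarith [sq_nonneg ((a t - a' t) - (b t - b' t)),
        sq_nonneg ((a t - a' t) + (b t - b' t))]
    rw [h1]
    refine (abs_add_three _ _ _).trans ?_
    linarith
  rw [← mul_sub, ← Finset.sum_sub_distrib, abs_mul, abs_of_nonneg (by positivity)]
  have h1 : (m : ℝ)⁻¹ * |∑ t ∈ Finset.Icc 1 m, (a t * b t - a' t * b' t)|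
      ≤ (m : ℝ)⁻¹ * ∑ t ∈ Finset.Icc 1 m, ((1 + ε⁻¹) / 2 * (a t - a' t) ^ 2
      + (1 + ε⁻¹) / 2 * (b t - b' t) ^ 2 + ε / 2 * a' t ^ 2 + ε / 2 * b' t ^ 2) := by
    gcongr
    exact (Finset.abs_sum_le_sum_abs _ _).trans (Finset.sum_le_sum fun t _ => hterm t)
  refine h1.trans ?_
  simp only [Finset.sum_add_distrib, ← Finset.mul_sum]
  have e1 := mul_le_mul_of_nonneg_left ha (show 0 ≤ (1 + ε⁻¹) / 2 by positivity)
  have e2 := mul_le_mul_of_nonneg_left hb (show 0 ≤ (1 + ε⁻¹) / 2 by positivity)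
  have e3 := mul_le_mul_of_nonneg_left ha' (show 0 ≤ ε / 2 by positivity)
  have e4 := mul_le_mul_of_nonneg_left hb' (show 0 ≤ ε / 2 by positivity)
  have e5 : (1 + ε⁻¹) / 2 * ε ^ 2 = (ε ^ 2 + ε) / 2 := by field_simp
  have e6 : ε ^ 2 ≤ ε := by nlinarith
  rw [e5] at e1 e2
  linarith

section Matrices

variable {d : ℕ} {Θ U : Set (Param d)} {f : Param d → (ℕ → ℕ) → ℝ} {c C r R γ : ℝ} {a A : ℕ → ℝ}
  {θ θ₀ : Param d} {P : Measure (ℤ → ℕ)}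

/-- The factor `x / λ̂ - 1` can be attached to each gradient, so `Î` is the empirical Gram matrix of
the scores. -/
theorem hatI_apply (hU : IsOpen U) (hUΘ : U ⊆ Θ) (hθ : θ ∈ U) (x : ℕ → ℕ) (m : ℕ) (i j : Fin d) :
    hatI Θ f x 1 m θ i j = (m : ℝ)⁻¹ * ∑ t ∈ Finset.Icc 1 m,
      score f i θ (x t) (truncPast x t) * score f j θ (x t) (truncPast x t) := by
  have h1 : ∀ t i, pderiv Θ (lamHat f x t) i θ = fd1 f i θ (truncPast x t) := fun t i =>
    ModelBounds.pderiv_eq_fd1 hU hUΘ hθ i (truncPast x t)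
  have h2 : (m : ℝ) - ((1 : ℕ) : ℝ) + 1 = m := by push_cast; ring
  simp only [hatI, h2, Matrix.smul_apply, Matrix.sum_apply, Matrix.vecMulVec_apply, grad, h1,
    smul_eq_mul, score, lamHat]
  refine congrArg _ (Finset.sum_congr rfl fun t _ => ?_)
  ring

theorem hatJ_apply (hU : IsOpen U) (hUΘ : U ⊆ Θ) (hθ : θ ∈ U) (x : ℕ → ℕ) (m : ℕ) (i j : Fin d) :
    hatJ Θ f x 1 m θ i j = (m : ℝ)⁻¹ * ∑ t ∈ Finset.Icc 1 m,
      infoJ f i j θ (truncPast x t) := by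
  have h1 : ∀ t i, pderiv Θ (lamHat f x t) i θ = fd1 f i θ (truncPast x t) := fun t i =>
    ModelBounds.pderiv_eq_fd1 hU hUΘ hθ i (truncPast x t)
  have h2 : (m : ℝ) - ((1 : ℕ) : ℝ) + 1 = m := by push_cast; ring
  simp only [hatJ, h2, Matrix.smul_apply, Matrix.sum_apply, Matrix.vecMulVec_apply, grad, h1,
    smul_eq_mul, infoJ, lamHat]

/-- The growth of the third powers of the envelope. -/
theorem EnvelopeMoment.ae_cube_le (hE : EnvelopeMoment P C A r) :
    ∀ᵐ y ∂P, ∃ K ≥ 0, ∀ m : ℕ, 1 ≤ m →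
      (∀ t ∈ Finset.Icc 1 m, envelope C A (shiftPath t y) ^ 3 ≤ K * (m : ℝ) ^ (3 / r)) ∧
      ∑ t ∈ Finset.Icc 1 m, envelope C A (shiftPath t y) ^ 3 ≤ K * m := by
  have hr : 0 < r := by linarith [hE.three_lt]
  filter_upwards [hE.stationary.ae_tendsto_avg (hE.measurable.pow_const r) hE.integrable] with y hy
  obtain ⟨K, hK⟩ := hy.bddAbove_range
  have hZ0 : ∀ t : ℕ, 0 ≤ envelope C A (shiftPath t y) := fun t => hE.envelope_nonneg _
  have hZ1 : ∀ t : ℕ, 1 ≤ envelope C A (shiftPath t y) := fun t => hE.one_le_envelope _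
  have hsum : ∀ m : ℕ, 1 ≤ m →
      ∑ t ∈ Finset.Icc 1 m, envelope C A (shiftPath t y) ^ r ≤ K * m := fun m hm => by
    have h1 : (m : ℝ)⁻¹ * ∑ t ∈ Finset.Icc 1 m, envelope C A (shiftPath t y) ^ r ≤ K :=
      hK ⟨m, rfl⟩
    have hm0 : (0 : ℝ) < m := by exact_mod_cast hm
    rwa [inv_mul_le_iff₀ hm0, mul_comm] at h1
  have hK0 : 0 ≤ K := by
    have h1 := (Finset.sum_nonneg fun t _ => Real.rpow_nonneg (hZ0 t) r).trans (hsum 1 le_rfl)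
    simpa using h1
  refine ⟨max K (K ^ (3 / r)), hK0.trans (le_max_left _ _), fun m hm => ⟨fun t ht => ?_, ?_⟩⟩
  -- A single term is bounded by the whole sum `∑ Z^r = O(m)`; the power `3/r` turns this into a
  -- bound for the largest cube.
  · have h1 : envelope C A (shiftPath t y) ^ r ≤ K * m :=
      (Finset.single_le_sum (f := fun t : ℕ => envelope C A (shiftPath t y) ^ r)
        (fun t _ => Real.rpow_nonneg (hZ0 t) r) ht).trans (hsum m hm)
    have h2 := Real.rpow_le_rpow (Real.rpow_nonneg (hZ0 t) r) h1 (show 0 ≤ 3 / r by positivity)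
    rw [← Real.rpow_mul (hZ0 t), mul_div_cancel₀ _ hr.ne', Real.mul_rpow hK0 (Nat.cast_nonneg m)]
      at h2
    have h3 : envelope C A (shiftPath t y) ^ (3 : ℝ) = envelope C A (shiftPath t y) ^ 3 := by
      exact_mod_cast Real.rpow_natCast _ 3
    rw [h3] at h2
    refine h2.trans ?_
    gcongr
    exact le_max_right _ _
  · refine le_trans (Finset.sum_le_sum fun t _ => ?_) ((hsum m hm).trans ?_)
    · have h3 : envelope C A (shiftPath t y) ^ (3 : ℝ) = envelope C A (shiftPath t y) ^ 3 := by
        exact_mod_cast Real.rpow_natCast _ 3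
      rw [← h3]
      exact Real.rpow_le_rpow_of_exponent_le (hZ1 t) hE.three_lt.le
    · gcongr
      exact le_max_left _ _

theorem tendsto_const_mul_rpow_neg (B : ℝ) {e : ℝ} (he : e < 0) :
    Tendsto (fun m : ℕ => B * (m : ℝ) ^ e) atTop (𝓝 0) := by
  have h := (tendsto_rpow_neg_atTop (neg_pos.2 he)).comp tendsto_natCast_atTop_atTop
  simpa using h.const_mul B

/-- The mean square distance between the estimated and the true score contributions. -/
theorem ae_avg_score_sub_sq (hM : ModelBounds Θ f c C a A) (hE : EnvelopeMoment P C A r)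
    (hD : PolyDecay a R γ) (hU : IsOpen U) (hUΘ : U ⊆ Θ) (hUc : Convex ℝ U) (hθ₀ : θ₀ ∈ U)
    {σ : ℝ} (hσ : 2 * σ - 2 + 3 / r < 0) :
    ∀ᵐ y ∂P, ∀ L ≥ 0, ∀ ε > 0, ∀ᶠ m : ℕ in atTop, ∀ θ ∈ U, ‖θ - θ₀‖ ≤ L * (m : ℝ) ^ (σ - 1) →
      ∀ i, (m : ℝ)⁻¹ * ∑ t ∈ Finset.Icc 1 m,
        (score f i θ (y t) (cutPast (t - 1) (pastPath (shiftPath t y)))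
          - score f i θ₀ (y t) (pastPath (shiftPath t y))) ^ 2 ≤ ε := by
  have hγ := hD.lt
  have hr : 3 / r < 1 := by
    rw [div_lt_one (by linarith [hE.three_lt])]
    exact hE.three_lt
  set b := γ / 2 - 1 / 4 with hb
  set S := ModelBounds.scoreConst c with hS
  have hS0 : 0 ≤ S := hM.scoreConst_nonneg
  filter_upwards [hE.ae_cube_le, hE.ae_lagSummable,
    hD.ae_tailSum_le hE.stationary hE.integrable_coord,
    ae_sum_rpow_bounded hE.stationary (hE.measurable.pow_const 3) (hE.integrable_pow le_rfl)
      (fun y => pow_nonneg (hE.envelope_nonneg y) 3) (show 1 < 2 * b by linarith)]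
    with y ⟨K₁, hK₁, h1⟩ h2 ⟨K₂, hK₂, h3⟩ ⟨K₃, hK₃, h4⟩ L hL ε hε
  -- `B₁` belongs to the estimation error and `B₂` to the truncation error. The corresponding
  -- exponents are negative by the choice of `σ` and by `r > 3`.
  set B₁ := 2 * S ^ 2 * (K₁ * K₁ * L ^ 2) with hB₁
  set B₂ := 2 * S ^ 2 * (K₂ ^ 2 * K₁ * K₃) with hB₂
  have hlim : Tendsto (fun m : ℕ => B₁ * (m : ℝ) ^ (2 * σ - 2 + 3 / r)
      + B₂ * (m : ℝ) ^ (3 / r - 1)) atTop (𝓝 (0 + 0)) :=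
    (tendsto_const_mul_rpow_neg B₁ hσ).add (tendsto_const_mul_rpow_neg B₂ (by linarith))
  rw [add_zero] at hlim
  filter_upwards [hlim.eventually_le_const hε, eventually_ge_atTop 1] with m hm hm1 θ hθ hn i
  refine le_trans ?_ hm
  obtain ⟨h5, h6⟩ := h1 m hm1
  have hm0 : (0 : ℝ) < m := by exact_mod_cast hm1
  set Z : ℕ → ℝ := fun t => envelope C A (shiftPath t y) with hZ
  have hZ1 : ∀ t, 1 ≤ Z t := fun t => hE.one_le_envelope _
  have hterm : ∀ t ∈ Finset.Icc 1 m,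
      (score f i θ (y t) (cutPast (t - 1) (pastPath (shiftPath t y)))
          - score f i θ₀ (y t) (pastPath (shiftPath t y))) ^ 2
        ≤ 2 * S ^ 2 * ((K₁ * (m : ℝ) ^ (3 / r)) * Z t ^ 3 * (L * (m : ℝ) ^ (σ - 1)) ^ 2)
          + 2 * S ^ 2 * (K₂ ^ 2 * (K₁ * (m : ℝ) ^ (3 / r)) * ((t : ℝ) ^ (-(2 * b)) * Z t ^ 3)) := by
    intro t ht
    have hyt : (y t : ℝ) ≤ Z t := by
      simpa [shiftPath] using hE.coord_le (shiftPath t y)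
    have hZt := hZ1 t
    have hZ0 : 0 ≤ Z t := by linarith
    have ht0 : (0 : ℝ) < t := by exact_mod_cast (Finset.mem_Icc.1 ht).1
    have e1 := hM.abs_score_sub_le_norm hU hUΘ hUc hθ hθ₀ i (LagSummable.cut (t - 1))
      (hM.cut_le_envelope (h2 t) (t - 1)) hyt
    have e2 := hM.abs_score_sub_le_tailSum hU hUΘ hθ₀ i (h2 t) (EnvelopeMoment.lag_le _) hyt
      (t - 1)
    have e3 := h3 t (Finset.mem_Icc.1 ht).1
    set w := score f i θ (y t) (cutPast (t - 1) (pastPath (shiftPath t y)))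
    set w' := score f i θ₀ (y t) (cutPast (t - 1) (pastPath (shiftPath t y)))
    set w₀ := score f i θ₀ (y t) (pastPath (shiftPath t y))
    have e4 : (w - w') ^ 2 ≤ (S * Z t ^ 3 * (L * (m : ℝ) ^ (σ - 1))) ^ 2 := by
      rw [← sq_abs (w - w')]
      exact pow_le_pow_left₀ (abs_nonneg _) (e1.trans (by gcongr)) 2
    have e5 : (w' - w₀) ^ 2 ≤ (S * Z t ^ 2 * (K₂ * (t : ℝ) ^ (-b))) ^ 2 := by
      rw [← sq_abs (w' - w₀)]
      exact pow_le_pow_left₀ (abs_nonneg _) (e2.trans (by gcongr)) 2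
    have e6 : (w - w₀) ^ 2 ≤ 2 * (w - w') ^ 2 + 2 * (w' - w₀) ^ 2 := by
      nlinarith [sq_nonneg ((w - w') - (w' - w₀))]
    -- The sixth power of the envelope need not be integrable: one cube is replaced by the maximal
    -- one, of order `m^(3/r)`, and the other is averaged.
    have e7 : (S * Z t ^ 3 * (L * (m : ℝ) ^ (σ - 1))) ^ 2
        ≤ S ^ 2 * ((K₁ * (m : ℝ) ^ (3 / r)) * Z t ^ 3 * (L * (m : ℝ) ^ (σ - 1)) ^ 2) := by
      have : (S * Z t ^ 3 * (L * (m : ℝ) ^ (σ - 1))) ^ 2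
        = S ^ 2 * (Z t ^ 3 * Z t ^ 3 * (L * (m : ℝ) ^ (σ - 1)) ^ 2) := by ring
      rw [this]
      gcongr
      exact h5 t ht
    have e8 : ((t : ℝ) ^ (-b)) ^ 2 = (t : ℝ) ^ (-(2 * b)) := by
      rw [← Real.rpow_natCast, ← Real.rpow_mul ht0.le]
      congr 1
      push_cast
      ring
    have e9 : (S * Z t ^ 2 * (K₂ * (t : ℝ) ^ (-b))) ^ 2
        ≤ S ^ 2 * (K₂ ^ 2 * (K₁ * (m : ℝ) ^ (3 / r)) * ((t : ℝ) ^ (-(2 * b)) * Z t ^ 3)) := by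
      have e10 : Z t ^ 4 ≤ K₁ * (m : ℝ) ^ (3 / r) * Z t ^ 3 := by
        have : Z t ≤ Z t ^ 3 := le_self_pow₀ hZt (by norm_num)
        calc Z t ^ 4 = Z t * Z t ^ 3 := by ring
          _ ≤ _ := by
            gcongr
            exact this.trans (h5 t ht)
      calc (S * Z t ^ 2 * (K₂ * (t : ℝ) ^ (-b))) ^ 2
          = S ^ 2 * (K₂ ^ 2 * (((t : ℝ) ^ (-b)) ^ 2 * Z t ^ 4)) := by ring
        _ ≤ S ^ 2 * (K₂ ^ 2 * ((t : ℝ) ^ (-(2 * b)) * (K₁ * (m : ℝ) ^ (3 / r) * Z t ^ 3))) := by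
            rw [e8]
            gcongr
        _ = _ := by ring
    linarith
  have hsum := Finset.sum_le_sum hterm
  rw [Finset.sum_add_distrib, ← Finset.mul_sum, ← Finset.mul_sum, ← Finset.sum_mul,
    ← Finset.mul_sum, ← Finset.mul_sum] at hsum
  have e11 : 2 * S ^ 2 * ((K₁ * (m : ℝ) ^ (3 / r)) * (∑ t ∈ Finset.Icc 1 m, Z t ^ 3)
        * (L * (m : ℝ) ^ (σ - 1)) ^ 2)
      ≤ 2 * S ^ 2 * ((K₁ * (m : ℝ) ^ (3 / r)) * (K₁ * m) * (L * (m : ℝ) ^ (σ - 1)) ^ 2) := by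
    gcongr
  have e12 : 2 * S ^ 2 * (K₂ ^ 2 * (K₁ * (m : ℝ) ^ (3 / r))
        * ∑ t ∈ Finset.Icc 1 m, (t : ℝ) ^ (-(2 * b)) * Z t ^ 3)
      ≤ 2 * S ^ 2 * (K₂ ^ 2 * (K₁ * (m : ℝ) ^ (3 / r)) * K₃) := by
    gcongr
    exact h4 m
  rw [inv_mul_le_iff₀ hm0]
  refine hsum.trans ((add_le_add e11 e12).trans (le_of_eq ?_))
  have e13 : ((m : ℝ) ^ (σ - 1)) ^ 2 * (m : ℝ) ^ (3 / r) = (m : ℝ) ^ (2 * σ - 2 + 3 / r) := by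
    rw [← Real.rpow_natCast, ← Real.rpow_mul hm0.le, ← Real.rpow_add hm0]
    congr 1
    push_cast
    ring
  have e14 : (m : ℝ) * (m : ℝ) ^ (3 / r - 1) = (m : ℝ) ^ (3 / r) := by
    rw [Real.rpow_sub_one hm0.ne']
    field_simp
  rw [← e13, mul_add, hB₁, hB₂]
  rw [show (m : ℝ) * (2 * S ^ 2 * (K₂ ^ 2 * K₁ * K₃) * (m : ℝ) ^ (3 / r - 1))
    = 2 * S ^ 2 * (K₂ ^ 2 * K₁ * K₃) * ((m : ℝ) * (m : ℝ) ^ (3 / r - 1)) by ring, e14]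
  ring

end Matrices

/-! ### Strong consistency of `Î` and `Ĵ`. -/

section MatrixConsistency

variable {Ω : Type*} [mΩ : MeasurableSpace Ω] {μ : Measure Ω} [IsProbabilityMeasure μ]
  {d : ℕ} {Θ U : Set (Param d)} {f : Param d → (ℕ → ℕ) → ℝ} {c C r R γ : ℝ} {a A : ℕ → ℝ}
  {θ₀ : Param d} {Y : ℤ → Ω → ℕ}

theorem ae_avg_score_mul_score (hM : ModelBounds Θ f c C a A) (hY : IsODProcess μ f θ₀ Y)
    (hE : EnvelopeMoment (pathLaw μ Y) C A r) (hU : IsOpen U) (hUΘ : U ⊆ Θ) (hθ₀ : θ₀ ∈ U)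
    (hI : ∀ i, Integrable (integrandI μ Θ f θ₀ Y 0 i i) μ) (i j : Fin d) :
    ∀ᵐ ω ∂μ, Tendsto (fun m : ℕ => (m : ℝ)⁻¹ * ∑ t ∈ Finset.Icc 1 m,
        score f i θ₀ (trajectory Y ω t) (pastPath (shiftPath t (trajectory Y ω)))
          * score f j θ₀ (trajectory Y ω t) (pastPath (shiftPath t (trajectory Y ω))))
      atTop (𝓝 (matrixI μ Θ f θ₀ Y i j)) := by
  have hm : ∀ i, Measurable fun y : ℤ → ℕ => score f i θ₀ (y 0) (pastPath y) := fun i => by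
    have h := (hM.measurable_score hU hUΘ hθ₀ i).comp measurable_pair
    exact h
  have hint : Integrable (fun y => score f i θ₀ (y 0) (pastPath y)
      * score f j θ₀ (y 0) (pastPath y)) (pathLaw μ Y) :=
    (hY.memLp_score hM hE hU hUΘ hθ₀ hI i).integrable_mul (hY.memLp_score hM hE hU hUΘ hθ₀ hI j)
  have hmm : Measurable fun y : ℤ → ℕ => score f i θ₀ (y 0) (pastPath y)
      * score f j θ₀ (y 0) (pastPath y) := (hm i).mul (hm j)
  filter_upwards [hY.ae_path (hE.stationary.ae_tendsto_avg hmm hint)] with ω hω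
  rw [hY.integral_score_mul_score hM hE hU hUΘ hθ₀ hI] at hω
  simpa [shiftPath] using hω

/-- The matrix estimates are strongly consistent. -/
theorem ae_matrices_consistent (hM : ModelBounds Θ f c C a A) (hY : IsODProcess μ f θ₀ Y)
    (hE : EnvelopeMoment (pathLaw μ Y) C A r) (hD : PolyDecay a R γ)
    (hU : IsOpen U) (hUΘ : U ⊆ Θ) (hUc : Convex ℝ U) (hθ₀ : θ₀ ∈ U)
    (hneg : ∀ θ ∈ Θ, θ ≠ θ₀ → ∫ y, (qll f θ (y 0) (pastPath y)
      - qll f θ₀ (y 0) (pastPath y)) ∂(pathLaw μ Y) < 0)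
    (hI : ∀ i, Integrable (integrandI μ Θ f θ₀ Y 0 i i) μ)
    (hn : ∀ u : Param d,
      (∀ᵐ ω ∂μ, ∑ i, u i * pderiv Θ (lam f Y 0 ω) i θ₀ = 0) → u = 0) :
    ∀ᵐ ω ∂μ, ∀ ε > 0, ∀ᶠ m : ℕ in atTop, ∀ x : ℕ → ℕ,
      (∀ t ∈ Finset.Icc 1 m, x t = trajectory Y ω t) → ∀ θ, IsPQMLE Θ f x 1 m θ → ∀ i j,
        |hatI Θ f x 1 m θ i j - matrixI μ Θ f θ₀ Y i j| ≤ ε ∧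
        |hatJ Θ f x 1 m θ i j - matrixJ f θ₀ (pathLaw μ Y) i j| ≤ ε := by
  have hr : 3 / r < 1 := by
    rw [div_lt_one (by linarith [hE.three_lt])]
    exact hE.three_lt
  obtain ⟨ρ₀, hρ₀, hball⟩ := Metric.isOpen_iff.1 hU θ₀ hθ₀
  filter_upwards [ae_all_iff.2 fun i => ae_all_iff.2 fun j =>
      ae_avg_score_mul_score hM hY hE hU hUΘ hθ₀ hI i j,
    -- The value `σ = 3/4 - 3/(4r)` satisfies both `σ > 1/2` and `2σ - 2 + 3/r < 0`; each of these
    -- inequalities amounts to `r > 3`.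
    ae_pqmle_rate hM hY hE hD hU hUΘ hθ₀ hneg hI hn (σ := 3 / 4 - 3 / r / 4) (by linarith),
    hY.ae_path (ae_avg_score_sub_sq hM hE hD hU hUΘ hUc hθ₀ (σ := 3 / 4 - 3 / r / 4) (by linarith)),
    hY.ae_path (ae_pqmle_consistent hM hE hD (hUΘ hθ₀) hneg),
    ae_all_iff.2 fun i => ae_all_iff.2 fun j =>
      hY.ae_path (ae_avg_infoJ_near hM hE hU hUΘ hθ₀ i j)] with ω h1 ⟨L, hL, h2⟩ h3 h4 h5 ε hε
  set y := trajectory Y ω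
  choose ρ hρ hev using fun i j => h5 i j ε hε
  -- An eventual bound for the mean squares of all true score components.
  set G := ∑ i, (|matrixI μ Θ f θ₀ Y i i| + 1) with hG
  have hG0 : 0 ≤ G := Finset.sum_nonneg fun i _ => by positivity
  obtain ⟨η, hη, hη1, hηε⟩ : ∃ η > 0, η ≤ 1 ∧ η * (2 + G) ≤ ε / 2 :=
    ⟨min 1 (ε / 2 / (2 + G)), lt_min one_pos (by positivity), min_le_left _ _,
      (mul_le_mul_of_nonneg_right (min_le_right _ _) (by positivity)).trans
        (le_of_eq (div_mul_cancel₀ _ (by positivity)))⟩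
  have h6 : ∀ᶠ m : ℕ in atTop, ∀ i j, |(m : ℝ)⁻¹ * ∑ t ∈ Finset.Icc 1 m,
        score f i θ₀ (y t) (pastPath (shiftPath t y)) * score f j θ₀ (y t) (pastPath (shiftPath t y))
        - matrixI μ Θ f θ₀ Y i j| < min 1 (ε / 2) :=
    eventually_all.2 fun i => eventually_all.2 fun j =>
      (Metric.tendsto_nhds.1 (h1 i j)) _ (lt_min one_pos (by positivity))
  filter_upwards [h2, h3 L hL (η ^ 2) (by positivity), h4 ρ₀ hρ₀, h6,
    eventually_all.2 fun i => eventually_all.2 fun j => hev i j,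
    eventually_all.2 fun i => eventually_all.2 fun j => h4 (ρ i j) (hρ i j)]
    with m m2 m3 m4 m6 m5 m7 x hx θ hθ i j
  have hθU : θ ∈ U := hball (m4 x hx θ hθ)
  rw [hatI_apply hU hUΘ hθU, hatJ_apply hU hUΘ hθU]
  constructor
  · have e1 := m3 θ hθU (m2 x hx θ hθ)
    have e2 : ∀ i, (m : ℝ)⁻¹ * ∑ t ∈ Finset.Icc 1 m,
        score f i θ₀ (y t) (pastPath (shiftPath t y)) ^ 2 ≤ G := fun i => by
      have e3 := (abs_lt.1 ((m6 i i).trans_le (min_le_left _ _))).2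
      simp only [← sq] at e3
      refine le_trans ?_ (Finset.single_le_sum (f := fun i => |matrixI μ Θ f θ₀ Y i i| + 1)
        (fun i _ => by positivity) (Finset.mem_univ i))
      have := le_abs_self (matrixI μ Θ f θ₀ Y i i)
      linarith
    have e4 := abs_avg_mul_sub_avg_mul_le hη hη1 (e1 i) (e1 j) (e2 i) (e2 j)
    have e5 := (m6 i j).trans_le (min_le_right _ _)
    have e6 : ∑ t ∈ Finset.Icc 1 m,
          score f i θ (x t) (truncPast x t) * score f j θ (x t) (truncPast x t)
        = ∑ t ∈ Finset.Icc 1 m, score f i θ (y t) (cutPast (t - 1) (pastPath (shiftPath t y)))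
          * score f j θ (y t) (cutPast (t - 1) (pastPath (shiftPath t y))) :=
      Finset.sum_congr rfl fun t ht => by rw [truncPast_eq_cutPast hx ht, hx t ht]
    rw [e6]
    refine (abs_sub_le _ _ _).trans ((add_le_add (e4.trans hηε) e5.le).trans (le_of_eq ?_))
    ring
  · have e6 : ∑ t ∈ Finset.Icc 1 m, infoJ f i j θ (truncPast x t)
        = ∑ t ∈ Finset.Icc 1 m, infoJ f i j θ (cutPast (t - 1) (pastPath (shiftPath t y))) :=
      Finset.sum_congr rfl fun t ht => by rw [truncPast_eq_cutPast hx ht]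
    rw [e6]
    exact m5 i j θ hθU (m7 i j x hx θ hθ)

end MatrixConsistency

/-! ### Lower bounds for the standardized difference of the estimates -/

section InvSqrt

variable {d : ℕ} {A B : Matrix (Fin d) (Fin d) ℝ}

theorem norm_sq_eq_dotProduct (w : Fin d → ℝ) : ‖(WithLp.toLp 2 w : Param d)‖ ^ 2 = w ⬝ᵥ w := by
  rw [EuclideanSpace.real_norm_sq_eq]
  simp [dotProduct, sq]

theorem dotProduct_mulVec_eq_sum (M : Matrix (Fin d) (Fin d) ℝ) (u : Fin d → ℝ) :
    u ⬝ᵥ (M.mulVec u) = ∑ i, ∑ j, u i * u j * M i j := by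
  simp only [dotProduct, Matrix.mulVec, Finset.mul_sum]
  refine Finset.sum_congr rfl fun i _ => Finset.sum_congr rfl fun j _ => ?_
  ring

/-- The spectrum is finite and positive, so every function is continuous on it and the identities
for `√z` and `1/√z` pass through the functional calculus. -/
theorem exists_sqrt_mul_invSqrt (hA : A.PosDef) :
    ∃ Q : Matrix (Fin d) (Fin d) ℝ, Q.transpose = Q ∧ Q * Q = A ∧ Q * invSqrt A = 1 := by
  have hsa : IsSelfAdjoint A := hA.1.isSelfAdjoint
  have hcont : ∀ g : ℝ → ℝ, ContinuousOn g (spectrum ℝ A) := fun g =>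
    A.finite_real_spectrum.continuousOn g
  have hpos : ∀ z ∈ spectrum ℝ A, 0 < z := fun z hz => by
    rw [hA.1.spectrum_real_eq_range_eigenvalues] at hz
    obtain ⟨i, rfl⟩ := hz
    exact hA.eigenvalues_pos i
  refine ⟨cfc Real.sqrt A, ?_, ?_, ?_⟩
  · have h : IsSelfAdjoint (cfc Real.sqrt A) := cfc_predicate _ _
    have h2 : (cfc Real.sqrt A).conjTranspose = cfc Real.sqrt A := h
    rwa [Matrix.conjTranspose_eq_transpose_of_trivial] at h2
  · rw [← cfc_mul Real.sqrt Real.sqrt A (hcont _) (hcont _)]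
    conv_rhs => rw [← cfc_id' ℝ A hsa]
    exact cfc_congr fun z hz => Real.mul_self_sqrt (hpos z hz).le
  · rw [invSqrt, ← cfc_mul Real.sqrt _ A (hcont _) (hcont _), ← cfc_one ℝ A hsa]
    exact cfc_congr fun z hz => mul_inv_cancel₀ (Real.sqrt_pos.2 (hpos z hz)).ne'

/-- With `z = A^{-1/2} w` and the symmetric root `Q` one has `w = Q z`, hence `‖w‖² = z · A z`, to
which the upper bound for the form applies. -/
theorem norm_sq_le_invSqrt (hA : A.PosDef) {D : ℝ}
    (hD : ∀ u : Param d, ∑ i, ∑ j, u i * u j * A i j ≤ D * ‖u‖ ^ 2) (w : Fin d → ℝ) :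
    ‖(WithLp.toLp 2 w : Param d)‖ ^ 2
      ≤ D * ‖(WithLp.toLp 2 ((invSqrt A).mulVec w) : Param d)‖ ^ 2 := by
  obtain ⟨Q, hQt, hQQ, hQ⟩ := exists_sqrt_mul_invSqrt hA
  set z := (invSqrt A).mulVec w with hz
  have hw : w = Q.mulVec z := by rw [hz, Matrix.mulVec_mulVec, hQ, Matrix.one_mulVec]
  have h := hD (WithLp.toLp 2 z)
  rw [norm_sq_eq_dotProduct]
  refine le_of_eq_of_le ?_ h
  change w ⬝ᵥ w = ∑ i, ∑ j, z i * z j * A i j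
  rw [← dotProduct_mulVec_eq_sum, ← hQQ, ← Matrix.mulVec_mulVec, ← hw, Matrix.dotProduct_mulVec,
    ← Matrix.mulVec_transpose, hQt, ← hw]

theorem posDef_of_quadratic_le (hA : A.IsHermitian) {κ : ℝ} (hκ : 0 < κ)
    (h : ∀ u : Param d, κ * ‖u‖ ^ 2 ≤ ∑ i, ∑ j, u i * u j * A i j) : A.PosDef := by
  refine Matrix.PosDef.of_dotProduct_mulVec_pos hA fun u hu => ?_
  have h1 := h (WithLp.toLp 2 u)
  rw [star_trivial, dotProduct_mulVec_eq_sum]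
  refine lt_of_lt_of_le ?_ h1
  have h2 : (WithLp.toLp 2 u : Param d) ≠ 0 := fun h0 => hu (by simpa using h0)
  have := norm_pos_iff.2 h2
  positivity

/-- Cauchy-Schwarz for `⟨u, B u⟩`; symmetry of `B` is not needed. -/
theorem mul_norm_le_of_quadratic_le {κ : ℝ}
    (h : ∀ u : Param d, κ * ‖u‖ ^ 2 ≤ ∑ i, ∑ j, u i * u j * B i j) (u : Param d) :
    κ * ‖u‖ ≤ ‖(WithLp.toLp 2 (B.mulVec u) : Param d)‖ := by
  rcases (norm_nonneg u).eq_or_lt with h0 | h0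
  · rw [← h0, mul_zero]
    exact norm_nonneg _
  · have h1 := h u
    have h2 : ∑ i, ∑ j, u i * u j * B i j = inner ℝ u (WithLp.toLp 2 (B.mulVec u) : Param d) := by
      rw [← dotProduct_mulVec_eq_sum]
      simp [PiLp.inner_apply, dotProduct, mul_comm]
    rw [h2] at h1
    have h3 := h1.trans (real_inner_le_norm _ _)
    refine le_of_mul_le_mul_right ?_ h0
    linarith

theorem abs_quadratic_le {M : Fin d → Fin d → ℝ} {ε : ℝ} (hM : ∀ i j, |M i j| ≤ ε) (u : Param d) :
    |∑ i, ∑ j, u i * u j * M i j| ≤ ε * (d * d) * ‖u‖ ^ 2 := by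
  have h1 : ∀ i j, |u i * u j * M i j| ≤ ‖u‖ * ‖u‖ * ε := fun i j => by
    rw [abs_mul, abs_mul]
    exact mul_le_mul (mul_le_mul (abs_coord_le_norm u i) (abs_coord_le_norm u j)
      (abs_nonneg _) (norm_nonneg u)) (hM i j) (abs_nonneg _) (by positivity)
  refine (Finset.abs_sum_le_sum_abs _ _).trans ((Finset.sum_le_sum fun i _ =>
    (Finset.abs_sum_le_sum_abs _ _).trans (Finset.sum_le_sum fun j _ => h1 i j)).trans
    (le_of_eq ?_))
  simp only [Finset.sum_const, Finset.card_univ, Fintype.card_fin, nsmul_eq_mul]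
  ring

/-- A lower bound for `‖A^{-1/2} B u‖` which is uniform over neighbourhoods of positive definite
matrices. -/
theorem exists_lower_bound_invSqrt_mul {I J : Matrix (Fin d) (Fin d) ℝ}
    (hI : ∀ u : Param d, u ≠ 0 → 0 < ∑ i, ∑ j, u i * u j * I i j)
    (hJ : ∀ u : Param d, u ≠ 0 → 0 < ∑ i, ∑ j, u i * u j * J i j) :
    ∃ ε > 0, ∃ q > 0, ∀ A B : Matrix (Fin d) (Fin d) ℝ, A.IsHermitian →
      (∀ i j, |A i j - I i j| ≤ ε) → (∀ i j, |B i j - J i j| ≤ ε) → ∀ u : Param d,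
      q * ‖u‖ ≤ ‖(WithLp.toLp 2 ((invSqrt A * B).mulVec u) : Param d)‖ := by
  obtain ⟨κ, hκ, hIκ⟩ := exists_pos_le_quadratic I hI
  obtain ⟨κ', hκ', hJκ⟩ := exists_pos_le_quadratic J hJ
  set ε := min κ κ' / (2 * (d * d + 1)) with hεdef
  have hmin : 0 < min κ κ' := lt_min hκ hκ'
  have hε : 0 < ε := by positivity
  have hεd : ε * (d * d) ≤ min κ κ' / 2 := by
    rw [hεdef, div_mul_eq_mul_div, div_le_div_iff₀ (by positivity) (by positivity)]
    nlinarith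
  have hε1 : ε * (d * d) ≤ κ / 2 := hεd.trans (by linarith [min_le_left κ κ'])
  have hε2 : ε * (d * d) ≤ κ' / 2 := hεd.trans (by linarith [min_le_right κ κ'])
  have hlow : ∀ (M N : Matrix (Fin d) (Fin d) ℝ) (k : ℝ), ε * (d * d) ≤ k / 2 →
      (∀ u : Param d, k * ‖u‖ ^ 2 ≤ ∑ i, ∑ j, u i * u j * N i j) →
      (∀ i j, |M i j - N i j| ≤ ε) →
      ∀ u : Param d, k / 2 * ‖u‖ ^ 2 ≤ ∑ i, ∑ j, u i * u j * M i j := by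
    intro M N k hk hN hMN u
    have h1 := (abs_le.1 (abs_quadratic_le hMN u)).1
    simp only [mul_sub, Finset.sum_sub_distrib] at h1
    have h2 := hN u
    have h3 := mul_le_mul_of_nonneg_right hk (sq_nonneg ‖u‖)
    linarith
  set D := (∑ i, ∑ j, |I i j| + ε) * (d * d) + 1 with hDdef
  have hS0 : 0 ≤ ∑ i, ∑ j, |I i j| := Finset.sum_nonneg fun i _ => Finset.sum_nonneg fun j _ =>
    abs_nonneg _
  have hD : 0 < D := by positivity
  -- The factor `κ'/2` is the coercivity left to `B`, and `1/√D` is the least amount by which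
  -- `A^{-1/2}` stretches when the form of `A` is at most `D`.
  refine ⟨ε, hε, κ' / 2 / Real.sqrt D, by positivity, fun A B hA hAI hBJ u => ?_⟩
  have hAlow := hlow A I κ hε1 hIκ hAI
  have hBlow := hlow B J κ' hε2 hJκ hBJ
  have hAup : ∀ u : Param d, ∑ i, ∑ j, u i * u j * A i j ≤ D * ‖u‖ ^ 2 := fun u => by
    have hent : ∀ i j, |A i j| ≤ ∑ i, ∑ j, |I i j| + ε := fun i j => by
      have h1 : |I i j| ≤ ∑ j, |I i j| :=
        Finset.single_le_sum (f := fun j => |I i j|) (fun j _ => abs_nonneg _) (Finset.mem_univ j)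
      have h2 : ∑ j, |I i j| ≤ ∑ i, ∑ j, |I i j| :=
        Finset.single_le_sum (f := fun i => ∑ j, |I i j|)
          (fun i _ => Finset.sum_nonneg fun j _ => abs_nonneg _) (Finset.mem_univ i)
      have h3 := abs_sub_abs_le_abs_sub (A i j) (I i j)
      linarith [hAI i j]
    refine (le_abs_self _).trans ((abs_quadratic_le hent u).trans ?_)
    gcongr
    rw [hDdef]
    linarith
  have h1 := norm_sq_le_invSqrt (posDef_of_quadratic_le hA (half_pos hκ) hAlow) hAup (B.mulVec u)
  rw [Matrix.mulVec_mulVec] at h1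
  have h2 := mul_norm_le_of_quadratic_le hBlow u
  have h3 := Real.sqrt_le_sqrt h1
  rw [Real.sqrt_sq (norm_nonneg _), Real.sqrt_mul hD.le, Real.sqrt_sq (norm_nonneg _)] at h3
  rw [div_mul_eq_mul_div, div_le_iff₀ (Real.sqrt_pos.2 hD), mul_comm _ (Real.sqrt D)]
  exact h2.trans h3

end InvSqrt

theorem isHermitian_hatI {d : ℕ} (Θ : Set (Param d)) (f : Param d → (ℕ → ℕ) → ℝ) (x : ℕ → ℕ)
    (l k : ℕ) (θ : Param d) : (hatI Θ f x l k θ).IsHermitian := by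
  refine Matrix.IsHermitian.ext fun i j => ?_
  simp only [hatI, Matrix.smul_apply, Matrix.sum_apply, Matrix.vecMulVec_apply, star_trivial,
    smul_eq_mul]
  refine congrArg _ (Finset.sum_congr rfl fun t _ => ?_)
  ring

/-! ### Measurability and convergence in probability -/

/-- Events determined by finitely many observations are measurable; if almost surely only finitely
many of them occur, their probabilities tend to zero. -/
theorem tendsto_measure_of_ae_eventually {Ω : Type*} [MeasurableSpace Ω] {μ : Measure Ω}
    [IsFiniteMeasure μ] {Y : ℤ → Ω → ℕ} (hY : ∀ t, Measurable (Y t))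
    (p : (m : ℕ) → (Fin m → ℕ) → Prop)
    (h : ∀ᵐ ω ∂μ, ∀ᶠ m : ℕ in atTop, p m fun i => Y ((i : ℤ) + 1) ω) :
    Tendsto (fun m => μ {ω | ¬ p m fun i => Y ((i : ℤ) + 1) ω}) atTop (𝓝 0) := by
  -- No measurability of `p` is required: tuples of naturals form a countable discrete space, in
  -- which every set is measurable.
  have hm : ∀ m, MeasurableSet {ω | ¬ p m fun i => Y ((i : ℤ) + 1) ω} := fun m =>
    (measurable_pi_lambda (fun ω (i : Fin m) => Y ((i : ℤ) + 1) ω) fun i => hY _)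
      (Set.to_countable {z | ¬ p m z}).measurableSet
  have := tendsto_measure_of_ae_tendsto_indicator_of_isFiniteMeasure (μ := μ) atTop
    MeasurableSet.empty hm (by
      filter_upwards [h] with ω hω
      filter_upwards [hω] with m hm
      simp [hm])
  simpa using this

/-! ### The detector after the change -/

section Procedure

variable {Ω : Type*} [MeasurableSpace Ω] {μ : Measure Ω} [IsProbabilityMeasure μ]
  {d : ℕ} {Θ : Set (Param d)} {f : Param d → (ℕ → ℕ) → ℝ} {c C r R γ : ℝ} {a A : ℕ → ℝ}

/-- The standardization computed from the historical sample `z` is bounded below by `q`, and the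
estimate is close to the true parameter. -/
def GoodHistory (Θ : Set (Param d)) (f : Param d → (ℕ → ℕ) → ℝ) (θ₁ : Param d) (q ρ : ℝ) (m : ℕ)
    (z : Fin m → ℕ) : Prop :=
  ∀ x : ℕ → ℕ, (∀ i : Fin m, x (i + 1) = z i) → ∀ θ, IsPQMLE Θ f x 1 m θ → dist θ θ₁ < ρ ∧
    ∀ u : Param d, q * ‖u‖
      ≤ ‖(WithLp.toLp 2 ((invSqrt (hatI Θ f x 1 m θ) * hatJ Θ f x 1 m θ).mulVec u) : Param d)‖

theorem integral_qll_sub_neg_of_regular {θ : Param d} {Y : ℤ → Ω → ℕ}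
    (hM : ModelBounds Θ f c C a A) (hY : IsODProcess μ f θ Y) (hR : Regular μ Θ f θ Y)
    (hE : EnvelopeMoment (pathLaw μ Y) C A r) :
    ∀ θ' ∈ Θ, θ' ≠ θ → ∫ y, (qll f θ' (y 0) (pastPath y)
      - qll f θ (y 0) (pastPath y)) ∂(pathLaw μ Y) < 0 := fun _ hθ' hne =>
  integral_qll_sub_neg hM hY hE hR.identifiable (interior_subset hR.mem_interior) hθ' hne

/-- `GoodHistory` speaks of all maximizers and all continuations of the sample, so it is determined
by the first `m` observations alone. This makes its failure a measurable event even if the estimates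
are not selected measurably. -/
theorem ae_eventually_goodHistory {θ₁ : Param d} {Y₁ : ℤ → Ω → ℕ}
    (hM : ModelBounds Θ f c C a A) (hY : IsODProcess μ f θ₁ Y₁) (hR : Regular μ Θ f θ₁ Y₁)
    (hE : EnvelopeMoment (pathLaw μ Y₁) C A r) (hD : PolyDecay a R γ)
    (hI : (matrixI μ Θ f θ₁ Y₁).PosDef) {ρ : ℝ} (hρ : 0 < ρ) :
    ∃ q > 0, ∀ᵐ ω ∂μ, ∀ᶠ m : ℕ in atTop,
      GoodHistory Θ f θ₁ q ρ m fun i => Y₁ ((i : ℤ) + 1) ω := by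
  obtain ⟨ρ₀, hρ₀, hball⟩ := Metric.isOpen_iff.1 isOpen_interior θ₁ hR.mem_interior
  have hU : IsOpen (Metric.ball θ₁ ρ₀) := Metric.isOpen_ball
  have hUΘ : Metric.ball θ₁ ρ₀ ⊆ Θ := hball.trans interior_subset
  have hθ₁ : θ₁ ∈ Metric.ball θ₁ ρ₀ := Metric.mem_ball_self hρ₀
  have hneg := integral_qll_sub_neg_of_regular hM hY hR hE
  obtain ⟨ε, hε, q, hq, hlow⟩ := exists_lower_bound_invSqrt_mul (I := matrixI μ Θ f θ₁ Y₁)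
    (J := matrixJ f θ₁ (pathLaw μ Y₁)) (fun u hu => by
      rw [← dotProduct_mulVec_eq_sum]
      have hu' : u.ofLp ≠ 0 := fun h => hu (by ext i; simp [h])
      simpa using hI.dotProduct_mulVec_pos hu')
    (matrixJ_pos hM hY hE hU hUΘ hθ₁ (hR.nondegenerate 0))
  refine ⟨q, hq, ?_⟩
  filter_upwards [ae_matrices_consistent hM hY hE hD hU hUΘ (convex_ball θ₁ ρ₀) hθ₁ hneg
      (fun i => hR.exists_I 0 i i) (hR.nondegenerate 0),
    hY.ae_path (ae_pqmle_consistent hM hE hD (hUΘ hθ₁) hneg)] with ω h1 h2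
  filter_upwards [h1 ε hε, h2 ρ hρ] with m m1 m2 x hx θ hθ
  have hx' : ∀ t ∈ Finset.Icc 1 m, x t = trajectory Y₁ ω t := fun t ht => by
    rw [Finset.mem_Icc] at ht
    have h := hx ⟨t - 1, by lia⟩
    simp only [Nat.sub_add_cancel ht.1] at h
    rw [h, trajectory]
    congr 1
    lia
  exact ⟨m2 x hx' θ hθ, hlow _ _ (isHermitian_hatI Θ f x 1 m θ) (fun i j => (m1 x hx' θ hθ i j).1)
    fun i j => (m1 x hx' θ hθ i j).2⟩

theorem le_maxDetector (Θ : Set (Param d)) (f : Param d → (ℕ → ℕ) → ℝ) (x : ℕ → ℕ)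
    (est : ℕ → ℕ → Param d) (b : ℝ → ℝ) {v : ℕ → ℕ} {m k l : ℕ} (hl : l ∈ window v m k) :
    detector Θ f x est m k l / b (((k : ℝ) - (l : ℝ)) / (m : ℝ))
      ≤ maxDetector Θ f x est b v m k :=
  le_csSup (((window v m k).finite_toSet.image _).bddAbove) ⟨l, hl, rfl⟩

/-- A lower bound for the detector if the estimates before and after the change are separated. -/
theorem le_maxDetector_of_good {θ₁ θ₂ : Param d} {q ρ B : ℝ} (hq : 0 ≤ q)
    (hdist : 3 * ρ ≤ dist θ₁ θ₂) (hρ : 0 ≤ ρ) {b : ℝ → ℝ} (hb0 : ∀ t > 0, 0 < b t)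
    (hbB : ∀ t > 0, b t ≤ B) {v : ℕ → ℕ} {m k N : ℕ} (hm : 0 < m) (hN : v m + 1 ≤ N) (hv : 1 ≤ v m)
    (hmk : m ≤ k) {x : ℕ → ℕ} {est : ℕ → ℕ → Param d}
    (hest : ∀ l k, 1 ≤ l → l ≤ k → IsPQMLE Θ f x l k (est l k))
    {z : Fin m → ℕ} (hz : ∀ i : Fin m, x (i + 1) = z i) (hgood : GoodHistory Θ f θ₁ q ρ m z)
    (hafter : dist (est (k + 1) (k + N)) θ₂ < ρ) :
    Real.sqrt m * (((N : ℝ) - 1) / ((k : ℝ) + N)) * (q * ρ) / B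
      ≤ maxDetector Θ f x est b v m (k + N) := by
  have hN2 : 2 ≤ N := by lia
  have hNr : (2 : ℝ) ≤ N := by exact_mod_cast hN2
  have hmr : (0 : ℝ) < m := by exact_mod_cast hm
  -- The window starting right after the change is admissible: `k + 1 ≥ m - v m` since `k ≥ m`, and
  -- `k + 1 ≤ k + N - v m` since `v m + 1 ≤ N`.
  have hl : k + 1 ∈ window v m (k + N) := by
    rw [window, Finset.mem_Icc]
    lia
  refine le_trans ?_ (le_maxDetector Θ f x est b hl)
  obtain ⟨h1, h2⟩ := hgood x hz (est 1 m) (hest 1 m le_rfl hm)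
  have hcast : ((k + N : ℕ) : ℝ) - ((k + 1 : ℕ) : ℝ) = N - 1 := by push_cast; ring
  have hcast2 : ((k + N : ℕ) : ℝ) = (k : ℝ) + N := by push_cast; ring
  -- The true parameters are at least `3ρ` apart and each estimate is within `ρ` of its limit.
  have hsep : ρ ≤ ‖est (k + 1) (k + N) - est 1 m‖ := by
    rw [← dist_eq_norm]
    have h3 := dist_triangle4 θ₁ (est 1 m) (est (k + 1) (k + N)) θ₂
    rw [dist_comm θ₁ (est 1 m), dist_comm (est 1 m) (est (k + 1) (k + N))] at h3
    linarith
  have hdet : Real.sqrt m * (((N : ℝ) - 1) / ((k : ℝ) + N)) * (q * ρ)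
      ≤ detector Θ f x est m (k + N) (k + 1) := by
    unfold detector
    rw [hcast, hcast2]
    have h4 : 0 ≤ ((N : ℝ) - 1) / ((k : ℝ) + N) := div_nonneg (by linarith) (by positivity)
    have h5 : q * ρ ≤ _ := (mul_le_mul_of_nonneg_left hsep hq).trans (h2 _)
    gcongr
  have ht : 0 < (((k + N : ℕ) : ℝ) - ((k + 1 : ℕ) : ℝ)) / (m : ℝ) := by
    rw [hcast]
    exact div_pos (by linarith) hmr
  have hdet0 : 0 ≤ detector Θ f x est m (k + N) (k + 1) := by
    refine le_trans ?_ hdet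
    have h4 : 0 ≤ ((N : ℝ) - 1) / ((k : ℝ) + N) := div_nonneg (by linarith) (by positivity)
    positivity
  exact div_le_div₀ hdet0 hdet (hb0 _ ht) (hbB _ ht)

end Procedure

/-! ### The monitoring instants -/

section Times

variable {Tstar δ : ℝ}

theorem le_changeTime (hT : 1 < Tstar) (m : ℕ) : m ≤ changeTime Tstar m := by
  refine Nat.le_floor ?_
  have : (0 : ℝ) ≤ m := Nat.cast_nonneg m
  nlinarith

theorem changeTime_le (hT : 1 < Tstar) (m : ℕ) : (changeTime Tstar m : ℝ) ≤ Tstar * m :=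
  Nat.floor_le (by positivity)

theorem tendsto_floor_rpow (hδ : 0 < δ) : Tendsto (fun m : ℕ => ⌊(m : ℝ) ^ δ⌋₊) atTop atTop :=
  tendsto_nat_floor_atTop.comp ((tendsto_rpow_atTop hδ).comp tendsto_natCast_atTop_atTop)

/-- The length of the monitoring period is of larger order than the square root. -/
theorem eventually_four_sqrt_le (hδ : 1 / 2 < δ) :
    ∀ᶠ m : ℕ in atTop, 4 * Real.sqrt m ≤ (m : ℝ) ^ δ := by
  have h := ((tendsto_rpow_atTop (show 0 < δ - 1 / 2 by linarith)).comp
    tendsto_natCast_atTop_atTop).eventually_ge_atTop (4 : ℝ)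
  filter_upwards [h, eventually_gt_atTop 0] with m hm hm0
  have hm0' : (0 : ℝ) < m := by exact_mod_cast hm0
  have h1 : (m : ℝ) ^ δ = (m : ℝ) ^ (δ - 1 / 2) * Real.sqrt m := by
    rw [Real.sqrt_eq_rpow, ← Real.rpow_add hm0']
    congr 1
    ring
  rw [h1]
  exact mul_le_mul_of_nonneg_right hm (Real.sqrt_nonneg _)

/-- The factor in `4 √m ≤ m^δ` serves two purposes: `v m + 1 ≤ 2 √m` fits below the floor, and `m^δ
≥ 4` makes `m^δ - 2` at least half of `m^δ`. -/
theorem eventually_floor_rpow_bounds (hδ : 1 / 2 < δ) {v : ℕ → ℕ}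
    (hv' : Tendsto (fun m : ℕ => (v m : ℝ) / Real.sqrt m) atTop (𝓝 0)) :
    ∀ᶠ m : ℕ in atTop, v m + 1 ≤ ⌊(m : ℝ) ^ δ⌋₊ ∧ (m : ℝ) ^ δ / 2 ≤ (⌊(m : ℝ) ^ δ⌋₊ : ℝ) - 1 ∧
      (⌊(m : ℝ) ^ δ⌋₊ : ℝ) ≤ (m : ℝ) ^ δ := by
  filter_upwards [eventually_four_sqrt_le hδ, eventually_gt_atTop 0,
    hv'.eventually_le_const (show (0 : ℝ) < 1 by norm_num)] with m h1 h2 h3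
  have hm1 : (1 : ℝ) ≤ m := by exact_mod_cast h2
  have hs : 1 ≤ Real.sqrt m := Real.one_le_sqrt.2 hm1
  rw [div_le_one (by linarith)] at h3
  have h4 := (Nat.sub_one_lt_floor ((m : ℝ) ^ δ)).le
  refine ⟨Nat.le_floor ?_, by linarith, Nat.floor_le (by positivity)⟩
  push_cast
  linarith

theorem tendsto_inv_floor_mul_sqrt_changeTime (hT : 1 < Tstar) (hδ : 1 / 2 < δ) :
    Tendsto (fun m : ℕ => ((⌊(m : ℝ) ^ δ⌋₊ : ℝ))⁻¹ * Real.sqrt (changeTime Tstar m)) atTop (𝓝 0) := by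
  have hlim := tendsto_const_mul_rpow_neg (2 * Real.sqrt Tstar) (show 1 / 2 - δ < 0 by linarith)
  refine squeeze_zero' (Eventually.of_forall fun m => by positivity) ?_ hlim
  have h0 : Tendsto (fun m : ℕ => ((0 : ℕ) : ℝ) / Real.sqrt m) atTop (𝓝 0) := by simp
  filter_upwards [eventually_floor_rpow_bounds (v := fun _ => 0) hδ h0, eventually_gt_atTop 0]
    with m ⟨_, h1, _⟩ h2
  have hm0 : (0 : ℝ) < m := by exact_mod_cast h2
  have hp : 0 < (m : ℝ) ^ δ := by positivity
  have h3 : (⌊(m : ℝ) ^ δ⌋₊ : ℝ)⁻¹ ≤ ((m : ℝ) ^ δ / 2)⁻¹ := by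
    gcongr
    linarith
  have h4 : Real.sqrt (changeTime Tstar m) ≤ Real.sqrt Tstar * Real.sqrt m := by
    rw [← Real.sqrt_mul (by linarith)]
    exact Real.sqrt_le_sqrt (changeTime_le hT m)
  calc (⌊(m : ℝ) ^ δ⌋₊ : ℝ)⁻¹ * Real.sqrt (changeTime Tstar m)
      ≤ ((m : ℝ) ^ δ / 2)⁻¹ * (Real.sqrt Tstar * Real.sqrt m) := by gcongr
    _ = 2 * Real.sqrt Tstar * (m : ℝ) ^ (1 / 2 - δ) := by
        rw [Real.rpow_sub hm0, ← Real.sqrt_eq_rpow]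
        field_simp

/-- The lower bound for the detector diverges. -/
theorem eventually_rpow_le_lower_bound (hT : 1 < Tstar) (hδ : 1 / 2 < δ) (hδ1 : δ < 1) {q B : ℝ}
    (hq : 0 < q) (hB : 0 < B) :
    ∀ᶠ m : ℕ in atTop, q / (2 * (Tstar + 1) * B) * (m : ℝ) ^ (δ - 1 / 2)
      ≤ Real.sqrt m * (((⌊(m : ℝ) ^ δ⌋₊ : ℝ) - 1)
        / ((changeTime Tstar m : ℝ) + ⌊(m : ℝ) ^ δ⌋₊)) * q / B := by
  have h0 : Tendsto (fun m : ℕ => ((0 : ℕ) : ℝ) / Real.sqrt m) atTop (𝓝 0) := by simp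
  filter_upwards [eventually_floor_rpow_bounds (v := fun _ => 0) hδ h0, eventually_gt_atTop 0]
    with m ⟨hN, h1, h3⟩ h2
  have hm0 : (0 : ℝ) < m := by exact_mod_cast h2
  have hm1 : (1 : ℝ) ≤ m := by exact_mod_cast h2
  have hp : 0 < (m : ℝ) ^ δ := by positivity
  have h4 : (m : ℝ) ^ δ ≤ m := by
    simpa using Real.rpow_le_rpow_of_exponent_le hm1 hδ1.le
  -- Since `δ < 1`, the monitoring instant is at most `(T* + 1) m`, so dividing by it costs no more
  -- than a factor of order `m`.
  have h5 : (changeTime Tstar m : ℝ) + ⌊(m : ℝ) ^ δ⌋₊ ≤ (Tstar + 1) * m := by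
    linarith [changeTime_le hT m]
  have hNpos : (0 : ℝ) < ⌊(m : ℝ) ^ δ⌋₊ := by
    have : 0 < ⌊(m : ℝ) ^ δ⌋₊ := by lia
    exact_mod_cast this
  have h6 : (m : ℝ) ^ δ / 2 / ((Tstar + 1) * m)
      ≤ ((⌊(m : ℝ) ^ δ⌋₊ : ℝ) - 1) / ((changeTime Tstar m : ℝ) + ⌊(m : ℝ) ^ δ⌋₊) :=
    div_le_div₀ (by linarith) h1 (by positivity) h5
  have h7 : (m : ℝ) ^ (δ - 1 / 2) = Real.sqrt m * ((m : ℝ) ^ δ / m) := by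
    rw [Real.sqrt_eq_rpow, ← Real.rpow_sub_one hm0.ne', ← Real.rpow_add hm0]
    congr 1
    ring
  calc q / (2 * (Tstar + 1) * B) * (m : ℝ) ^ (δ - 1 / 2)
      = Real.sqrt m * ((m : ℝ) ^ δ / 2 / ((Tstar + 1) * m)) * q / B := by
        rw [h7]
        have : Tstar + 1 ≠ 0 := by linarith
        field_simp
    _ ≤ _ := by gcongr

end Times

section Observations

/-- Moving the time origin of the second process to the change turns the shift `s` into `k - s`. -/
theorem followsChange_observed {Ω : Type*} (Y₁ Y₂ : ℤ → Ω → ℕ) (k : ℕ) (s : ℤ) (ω : Ω) :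
    FollowsChange (observed Y₁ Y₂ k s ω) k (trajectory Y₁ ω)
      (shiftPath ((k : ℤ) - s) (trajectory Y₂ ω)) := by
  refine ⟨fun t ht => ?_, fun n hn => ?_⟩
  · rw [observed, if_pos (Finset.mem_Icc.1 ht).2]
    rfl
  · rw [observed, if_neg (by lia), shiftPath, trajectory]
    congr 1
    push_cast
    ring

theorem observed_history {Ω : Type*} (Y₁ Y₂ : ℤ → Ω → ℕ) {m k : ℕ} (hmk : m ≤ k) (s : ℤ) (ω : Ω)
    (i : Fin m) : observed Y₁ Y₂ k s ω (i + 1) = Y₁ ((i : ℤ) + 1) ω := by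
  have := i.2
  rw [observed, if_pos (by lia)]
  push_cast
  rfl

end Observations

/-- If the detector exceeds the threshold at the time `k + N`, the delay is at most `N`. -/
theorem detectionDelay_le {d : ℕ} {Θ : Set (Param d)} {f : Param d → (ℕ → ℕ) → ℝ} {x : ℕ → ℕ}
    {est : ℕ → ℕ → Param d} {b : ℝ → ℝ} (hb : ∀ t > 0, 0 < b t) {v : ℕ → ℕ} {T : ℝ≥0∞}
    {m k N : ℕ} (hm : 0 < m) (hv : 1 ≤ v m) (hmk : m < k + N)
    (hT : T = ∞ ∨ k + N ≤ ⌊T.toReal * (m : ℝ)⌋₊ + 1)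
    (h : 1 < maxDetector Θ f x est b v m (k + N)) :
    detectionDelay k (stoppingTime Θ f x est b v T m) ≤ N := by
  -- An empty set would have supremum `0`, which is not above `1`.
  have hne : ((fun l : ℕ => detector Θ f x est m (k + N) l
      / b ((((k + N : ℕ) : ℝ) - (l : ℝ)) / (m : ℝ))) '' (window v m (k + N) : Set ℕ)).Nonempty := by
    by_contra hne
    rw [Set.not_nonempty_iff_eq_empty] at hne
    rw [maxDetector, hne, Real.sSup_empty] at h
    linarith
  obtain ⟨_, ⟨l, hl, rfl⟩, hlt⟩ := exists_lt_of_lt_csSup hne h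
  have hlw : l ∈ window v m (k + N) := hl
  -- Because `v m ≥ 1`, the window ends before the current time, so the threshold is evaluated at a
  -- positive argument.
  have hlk : l < k + N := by
    rw [window, Finset.mem_Icc] at hlw
    lia
  have hpos : 0 < b ((((k + N : ℕ) : ℝ) - (l : ℝ)) / (m : ℝ)) := by
    refine hb _ (div_pos ?_ (by exact_mod_cast hm))
    rw [sub_pos]
    exact_mod_cast hlk
  have hdet := (lt_div_iff₀ hpos).1 hlt
  rw [one_mul] at hdet
  have hτ : stoppingTime Θ f x est b v T m ≤ ((k + N : ℕ) : ℕ∞) :=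
    sInf_le ⟨k + N, ⟨hmk, hT, l, hlw, hdet⟩, rfl⟩
  unfold detectionDelay
  rw [tsub_le_iff_left]
  refine (ENat.toENNReal_le.2 hτ).trans (le_of_eq ?_)
  simp

end ChangePoint

end

/-! ### Divergence of the detector and order of the delay. -/

open ChangePoint in
theorem theorem4p3 {Ω : Type*} [MeasurableSpace Ω] (μ : Measure Ω) [IsProbabilityMeasure μ]
    {d : ℕ} (Θ : Set (ChangePoint.Param d)) (hΘ : IsCompact Θ)
    -- the model
    (f : ChangePoint.Param d → (ℕ → ℕ) → ℝ) (hf : ∀ θ ∈ Θ, Measurable (f θ))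
    (c : ℝ) (hc : 0 < c) (hfc : ∀ θ ∈ Θ, ∀ y, c ≤ f θ y)
    (α : ℕ → ℕ → ℝ) (hα : ∀ i ≤ 2, ChangePoint.SmoothLipschitz Θ f i (α i))
    (hα0 : ∑' k, α 0 k < 1)
    (γ : ℝ) (hγ : 3 / 2 < γ)
    (hαγ : (fun k : ℕ => α 0 k + α 1 k) =O[atTop] fun k : ℕ => (k : ℝ) ^ (-γ))
    -- the two regimes
    (θ₁ θ₂ : ChangePoint.Param d) (hθ : θ₁ ≠ θ₂)
    (Y₁ Y₂ : ℤ → Ω → ℕ)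
    (hY₁ : ChangePoint.IsODProcess μ f θ₁ Y₁) (hY₂ : ChangePoint.IsODProcess μ f θ₂ Y₂)
    (hR₁ : ChangePoint.Regular μ Θ f θ₁ Y₁) (hR₂ : ChangePoint.Regular μ Θ f θ₂ Y₂)
    (hI : (ChangePoint.matrixI μ Θ f θ₁ Y₁).PosDef)
    -- the procedure
    (v : ℕ → ℕ) (hv : Tendsto v atTop atTop)
    (hv' : Tendsto (fun m : ℕ => (v m : ℝ) / Real.sqrt m) atTop (𝓝 0))
    (b : ℝ → ℝ) (hb_anti : AntitoneOn b (Set.Ioi 0)) (hb_cont : ContinuousOn b (Set.Ioi 0))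
    (hb_inf : ∃ r > 0, ∀ t > 0, r ≤ b t) (hb_sup : ∃ R, ∀ t > 0, b t ≤ R)
    (T : ℝ≥0∞) (Tstar : ℝ) (hT₁ : 1 < Tstar) (hT : ENNReal.ofReal Tstar < T)
    -- the observations for each historical sample size `m`, and the estimates
    (s : ℕ → ℤ) (x : ℕ → Ω → ℕ → ℕ)
    (hx : ∀ m ω, x m ω =
      ChangePoint.observed Y₁ Y₂ (ChangePoint.changeTime Tstar m) (s m) ω)
    (est : ℕ → Ω → ℕ → ℕ → ChangePoint.Param d)
    (hest : ∀ m ω l k, 1 ≤ l → l ≤ k → ChangePoint.IsPQMLE Θ f (x m ω) l k (est m ω l k)) :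
    -- almost sure divergence, where `(Y₂ n)` is the trajectory after the change for every `m`
    ((∀ m, s m = (ChangePoint.changeTime Tstar m : ℤ)) →
      ∀ δ : ℝ, 1 / 2 < δ → δ < 1 → ∀ᵐ ω ∂μ, Tendsto
        (fun m : ℕ => ChangePoint.maxDetector Θ f (x m ω) (est m ω) b v m
          (ChangePoint.monitorTime Tstar δ m)) atTop atTop) ∧
    -- divergence in probability, whatever the shifts `s m`
    (∀ δ : ℝ, 1 / 2 < δ → δ < 1 → ∀ M : ℝ, Tendsto
      (fun m : ℕ => μ {ω | ChangePoint.maxDetector Θ f (x m ω) (est m ω) b v m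
        (ChangePoint.monitorTime Tstar δ m) ≤ M}) atTop (𝓝 0)) ∧
    -- order of the detection delay, whatever the shifts `s m`
    (∀ ε : ℝ, 0 < ε → ChangePoint.IsBigOP μ
      (fun m ω => ChangePoint.detectionDelay (ChangePoint.changeTime Tstar m)
        (ChangePoint.stoppingTime Θ f (x m ω) (est m ω) b v T m))
      (fun m => (m : ℝ) ^ (1 / 2 + ε))) := by
  obtain ⟨C, hM⟩ := exists_modelBounds hΘ hf hc hfc hα
  obtain ⟨R, hD⟩ := exists_polyDecay hM.a_nonneg hγ hαγ
  obtain ⟨p₁, hE₁⟩ := exists_envelopeMoment hY₁ hR₁.moment hM.one_le_C hM.A_nonneg hM.A_summable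
  obtain ⟨p₂, hE₂⟩ := exists_envelopeMoment hY₂ hR₂.moment hM.one_le_C hM.A_nonneg hM.A_summable
  have hneg₂ := integral_qll_sub_neg_of_regular hM hY₂ hR₂ hE₂
  have hθ₂ : θ₂ ∈ Θ := interior_subset hR₂.mem_interior
  set ρ := dist θ₁ θ₂ / 3 with hρdef
  have hρ : 0 < ρ := div_pos (dist_pos.2 hθ) (by norm_num)
  have h3ρ : 3 * ρ ≤ dist θ₁ θ₂ := by rw [hρdef]; linarith
  obtain ⟨q, hq, hgood⟩ := ae_eventually_goodHistory hM hY₁ hR₁ hE₁ hD hI hρ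
  obtain ⟨r, hr, hbr⟩ := hb_inf
  obtain ⟨B, hbB⟩ := hb_sup
  have hb0 : ∀ t > 0, 0 < b t := fun t ht => hr.trans_le (hbr t ht)
  have hB : 0 < B := (hb0 1 one_pos).trans_le (hbB 1 one_pos)
  have hx' : ∀ m ω, FollowsChange (x m ω) (changeTime Tstar m) (trajectory Y₁ ω)
      (shiftPath ((changeTime Tstar m : ℤ) - s m) (trajectory Y₂ ω)) := fun m ω => by
    rw [hx]
    exact followsChange_observed Y₁ Y₂ _ _ ω
  -- the lower bound for the detector
  have hlow : ∀ δ : ℝ, 1 / 2 < δ → δ < 1 → ∃ L : ℕ → ℝ, Tendsto L atTop atTop ∧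
      ∀ᶠ m : ℕ in atTop, ∀ ω, (GoodHistory Θ f θ₁ q ρ m fun i => Y₁ ((i : ℤ) + 1) ω) →
        dist (est m ω (changeTime Tstar m + 1) (changeTime Tstar m + ⌊(m : ℝ) ^ δ⌋₊)) θ₂ < ρ →
        L m ≤ maxDetector Θ f (x m ω) (est m ω) b v m (monitorTime Tstar δ m) := by
    intro δ hδ hδ1
    refine ⟨fun m => q * ρ / (2 * (Tstar + 1) * B) * (m : ℝ) ^ (δ - 1 / 2),
      ((tendsto_rpow_atTop (by linarith)).comp tendsto_natCast_atTop_atTop).const_mul_atTop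
        (by positivity), ?_⟩
    filter_upwards [eventually_rpow_le_lower_bound hT₁ hδ hδ1 (mul_pos hq hρ) hB,
      eventually_floor_rpow_bounds hδ hv', hv.eventually_ge_atTop 1, eventually_gt_atTop 0]
      with m m1 ⟨m2, _, _⟩ m3 m4 ω hgω hω
    refine m1.trans ?_
    refine le_maxDetector_of_good hq.le h3ρ hρ.le hb0 hbB m4 m2 m3 (le_changeTime hT₁ m)
      (hest m ω) (fun i => ?_) hgω hω
    rw [hx]
    exact observed_history Y₁ Y₂ (le_changeTime hT₁ m) _ _ i
  have hpart2 : ∀ δ : ℝ, 1 / 2 < δ → δ < 1 → ∀ M : ℝ, Tendsto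
      (fun m : ℕ => μ {ω | maxDetector Θ f (x m ω) (est m ω) b v m (monitorTime Tstar δ m) ≤ M})
      atTop (𝓝 0) := by
    intro δ hδ hδ1 M
    obtain ⟨L, hL, hev⟩ := hlow δ hδ hδ1
    have hN := tendsto_floor_rpow (show 0 < δ by linarith)
    -- Outside two events of vanishing outer probability, a distant estimate after the change and a
    -- bad history, the deterministic lower bound applies.
    have t1 := tendsto_measure_pqmle_after hM hY₁ hY₂ hE₁ hE₂ hθ₂ hneg₂ hN hx' hρ
    have t2 := tendsto_measure_of_ae_eventually hY₁.measurable _ hgood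
    have t3 := t1.add t2
    rw [add_zero] at t3
    refine tendsto_of_tendsto_of_tendsto_of_le_of_le' tendsto_const_nhds t3
      (Eventually.of_forall fun _ => zero_le) ?_
    filter_upwards [hev, hL.eventually_gt_atTop M, hN.eventually_ge_atTop 1] with m m1 m2 m3
    refine (measure_mono fun ω hω => ?_).trans (measure_union_le _ _)
    by_contra hcon
    rw [Set.mem_union, not_or] at hcon
    obtain ⟨hc1, hc2⟩ := hcon
    refine absurd (m1 ω (not_not.1 hc2) (not_le.1 fun hle => hc1 ⟨_, hest m ω _ _ ?_ ?_, hle⟩))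
      (not_le.2 (lt_of_le_of_lt hω m2))
    · lia
    · lia
  refine ⟨fun hs δ hδ hδ1 => ?_, hpart2, fun ε hε η hη => ?_⟩
  · obtain ⟨L, hL, hev⟩ := hlow δ hδ hδ1
    have hN := tendsto_floor_rpow (show 0 < δ by linarith)
    obtain ⟨G₁, G₂, hG₁, hG₂, hG⟩ := ae_pqmle_consistent_after hM hE₁ hE₂ hD hθ₂ hneg₂ hN
      (tendsto_inv_floor_mul_sqrt_changeTime hT₁ hδ)
    filter_upwards [hY₁.ae_path hG₁, hY₂.ae_path hG₂, hgood] with ω hω₁ hω₂ hω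
    refine tendsto_atTop_mono' atTop ?_ hL
    filter_upwards [hev, hG _ _ hω₁ hω₂ ρ hρ, hω, hN.eventually_ge_atTop 1] with m m1 m2 m3 m4
    refine m1 ω m3 (m2 (x m ω) ?_ _ (hest m ω _ _ (by lia) (by lia)))
    -- For `s m = k*` the shift is zero, so one fixed trajectory of the second regime serves every
    -- `m`, as the almost sure statement requires.
    have h := hx' m ω
    rwa [hs, sub_self, shiftPath_zero] at h
  -- Strictly between `1/2` and `1/2 + ε`, and below `1`, so that `N < m^(1/2 + ε)` and the
  -- divergence in probability applies. The constant `C = 1` then works for every `η`.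
  · set δ := min (1 / 2 + ε / 2) (3 / 4) with hδdef
    have hδ : 1 / 2 < δ := lt_min (by linarith) (by norm_num)
    have hδ1 : δ < 1 := (min_le_right _ _).trans_lt (by norm_num)
    have hδε : δ < 1 / 2 + ε := (min_le_left _ _).trans_lt (by linarith)
    have hN := tendsto_floor_rpow (show 0 < δ by linarith)
    refine ⟨1, one_pos, ?_⟩
    -- In the closed-end case `T* < T` leaves room of order `m` after the change, which exceeds
    -- `m^δ`, so the alarm falls within the monitoring horizon.
    have hTev : ∀ᶠ m : ℕ in atTop, T = ∞ ∨
        changeTime Tstar m + ⌊(m : ℝ) ^ δ⌋₊ ≤ ⌊T.toReal * (m : ℝ)⌋₊ + 1 := by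
      rcases eq_or_ne T ∞ with hTi | hTi
      · exact Eventually.of_forall fun m => Or.inl hTi
      · have hTT : Tstar < T.toReal := (ENNReal.ofReal_lt_iff_lt_toReal (by linarith) hTi).1 hT
        have hlim := tendsto_const_mul_rpow_neg 1 (show δ - 1 < 0 by linarith)
        filter_upwards [hlim.eventually_le_const (sub_pos.2 hTT), eventually_gt_atTop 0]
          with m m1 m2
        have hm0 : (0 : ℝ) < m := by exact_mod_cast m2
        refine Or.inr (le_trans (Nat.le_floor ?_) (Nat.le_succ _))
        rw [one_mul, Real.rpow_sub_one hm0.ne', div_le_iff₀ hm0] at m1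
        have h3 : (⌊(m : ℝ) ^ δ⌋₊ : ℝ) ≤ (m : ℝ) ^ δ := Nat.floor_le (by positivity)
        push_cast
        linarith [changeTime_le hT₁ m]
    filter_upwards [(hpart2 δ hδ hδ1 1).eventually_le_const (ENNReal.ofReal_pos.2 hη), hTev,
      hN.eventually_ge_atTop 1, hv.eventually_ge_atTop 1, eventually_gt_atTop 1]
      with m m1 m2 m3 m4 m5
    refine (measure_mono fun ω hω => ?_).trans m1
    by_contra hcon
    have hlt : 1 < maxDetector Θ f (x m ω) (est m ω) b v m
        (changeTime Tstar m + ⌊(m : ℝ) ^ δ⌋₊) := not_le.1 hcon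
    have hdelay := detectionDelay_le hb0 (by lia) m4
      (by have := le_changeTime hT₁ m; lia) m2 hlt
    have h4 : ENNReal.ofReal (1 * (m : ℝ) ^ (1 / 2 + ε)) ≤ (⌊(m : ℝ) ^ δ⌋₊ : ℝ≥0∞) :=
      le_trans hω hdelay
    have hm1 : (1 : ℝ) < m := by exact_mod_cast m5
    have h5 : (⌊(m : ℝ) ^ δ⌋₊ : ℝ) < (m : ℝ) ^ (1 / 2 + ε) :=
      (Nat.floor_le (by positivity)).trans_lt (Real.rpow_lt_rpow_of_exponent_lt hm1 hδε)
    rw [one_mul, ← ENNReal.ofReal_natCast, ENNReal.ofReal_le_ofReal_iff (Nat.cast_nonneg _)] at h4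
    linarith
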